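/- Work in ZFC. Let $\kappa \le \lambda$ be infinite cardinals with $\lambda=\lambda^{<\kappa}$. Then the following are equivalent. 1. $\kappa$ is *$\lambda$-reflective for $\Pi^1_1$ assertions*: for every first-order language $L$ with fewer than $\kappa$ symbols, every $L$-structure $M$ of size $\lambda$ with $\kappa\subseteq M$, and every $\Pi^1_1$ sentence $\varphi$ of $L$ that is true in $M$ (that is, $\varphi=\forall X_1\cdots\forall X_n\,\psi$ with $\psi$ first-order and the $X_i$ relation variables of finite arity ranging over all relations on the domain), there is a first-order elementary substructure $m\prec M$ of size less than $\kappa$ with $m\cap\kappa\in\kappa$ such that $\varphi$ is true in $m$. 2. $\kappa$ is *nearly $\lambda$-supercompact*: for every $A\subseteq\lambda$ there are a transitive set $M$ with $\langle M,\in\rangle\models\mathrm{ZFC}^-$, closed under sequences of length less than $\kappa$, with $\lambda,A\in M$, a transitive set $N$, and an elementary embedding $j:M\to N$ with critical point $\kappa$ such that $\lambda<j(\kappa)$ and $\{j(\alpha) : \alpha<\lambda\}\in N$. Here $\mathrm{ZFC}^-$ is ZFC without the power set axiom, formulated with the separation and collection schemes and the well-ordering principle. -/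

import Mathlib

open FirstOrder Cardinal

universe u v w

namespace NearSupercompact

/-! ### The language of set theory and the theory ZFC without power set -/

/-- The only symbol of the language of set theory: a binary relation symbol. -/
inductive MemRel : ℕ → Type
  | mem : MemRel 2

/-- The first-order language of set theory (equality is a logical symbol). -/
def setLang : FirstOrder.Language.{0, 0} := ⟨fun _ => Empty, MemRel⟩

/-- Every set `M` is a structure for the language of set theory, with the true membership
relation. -/
instance setStructure (M : ZFSet.{u}) : setLang.Structure M where
  funMap f _ := nomatch f
  RelMap r x := match r, x with
    | MemRel.mem, x => (x 0 : ZFSet.{u}) ∈ (x 1 : ZFSet.{u})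

/-- The membership relation of a structure for the language of set theory. -/
def Mem {M : Type v} [setLang.Structure M] (x y : M) : Prop :=
  FirstOrder.Language.Structure.RelMap (L := setLang) MemRel.mem ![x, y]

theorem mem_iff {M : ZFSet.{u}} (x y : M) : Mem x y ↔ (x : ZFSet.{u}) ∈ (y : ZFSet.{u}) :=
  Iff.rfl

/-- In the structure `M`, the object `p` is the Kuratowski pair `{{x}, {x, y}}`. -/
def IsPair {M : Type v} [setLang.Structure M] (p x y : M) : Prop :=
  ∃ s t : M, (∀ z, Mem z s ↔ z = x) ∧ (∀ z, Mem z t ↔ z = x ∨ z = y) ∧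
    ∀ z, Mem z p ↔ z = s ∨ z = t

/-- In the structure `M`, the pair `(x, y)` belongs to `r`. -/
def PairMem {M : Type v} [setLang.Structure M] (r x y : M) : Prop :=
  ∃ p : M, IsPair p x y ∧ Mem p r

/-- `M` is a model of ZFC⁻, that is, of ZFC without the power set axiom, formulated with the
schemes of separation and collection (for all first-order formulas with parameters), and with the
axiom of choice in the form of the well-ordering principle. -/
structure ModelsZFCMinus (M : Type v) [setLang.Structure M] : Prop where
  extensionality : ∀ x y : M, (∀ z, Mem z x ↔ Mem z y) → x = y
  foundation : ∀ a : M, (∃ x, Mem x a) → ∃ x, Mem x a ∧ ∀ y, Mem y x → ¬ Mem y a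
  pairing : ∀ x y : M, ∃ a : M, ∀ z, Mem z a ↔ z = x ∨ z = y
  union : ∀ a : M, ∃ b : M, ∀ z, Mem z b ↔ ∃ x, Mem x a ∧ Mem z x
  infinity : ∃ a : M, (∃ e, Mem e a ∧ ∀ z, ¬ Mem z e) ∧
    ∀ x, Mem x a → ∃ y, Mem y a ∧ ∀ z, Mem z y ↔ Mem z x ∨ z = x
  separation : ∀ (n : ℕ) (φ : setLang.Formula (Fin (n + 1))) (p : Fin n → M) (a : M),
    ∃ b : M, ∀ x, Mem x b ↔ Mem x a ∧ φ.Realize (Fin.cons x p : Fin (n + 1) → M)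
  collection : ∀ (n : ℕ) (φ : setLang.Formula (Fin (n + 2))) (p : Fin n → M) (a : M),
    (∀ x, Mem x a → ∃ y, φ.Realize (Fin.cons x (Fin.cons y p) : Fin (n + 2) → M)) →
    ∃ b : M, ∀ x, Mem x a →
      ∃ y, Mem y b ∧ φ.Realize (Fin.cons x (Fin.cons y p) : Fin (n + 2) → M)
  wellOrdering : ∀ a : M, ∃ r : M,
    (∀ x, Mem x a → ¬ PairMem r x x) ∧
    (∀ x y z, Mem x a → Mem y a → Mem z a → PairMem r x y → PairMem r y z → PairMem r x z) ∧
    (∀ x y, Mem x a → Mem y a → PairMem r x y ∨ x = y ∨ PairMem r y x) ∧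
    (∀ b, (∃ x, Mem x b) → (∀ x, Mem x b → Mem x a) →
      ∃ x, Mem x b ∧ ∀ y, Mem y b → ¬ PairMem r y x)

/-! ### Near supercompactness -/

/-- `M` is closed under sequences of length less than `κ`: every function from an ordinal
`β < κ` to `M` is an element of `M`. -/
def ClosedUnderSequences (κ : Cardinal.{u}) (M : ZFSet.{u}) : Prop :=
  ∀ β < κ.ord, ∀ f : ZFSet.{u}, ZFSet.IsFunc β.toZFSet M f → f ∈ M

/-- The ordinal `κ` belongs to `M` and is the least ordinal moved by `j`. -/
def IsCriticalPoint {M N : ZFSet.{u}} (j : M ↪ₑ[setLang] N) (κ : Ordinal.{u}) : Prop :=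
  (∃ k : M, (k : ZFSet.{u}) = κ.toZFSet ∧ (j k : ZFSet.{u}) ≠ κ.toZFSet) ∧
    ∀ α < κ, ∀ a : M, (a : ZFSet.{u}) = α.toZFSet → (j a : ZFSet.{u}) = α.toZFSet

/-- The cardinal `κ` is nearly `μ`-supercompact: for every `A ⊆ μ` there are a transitive set
`M ⊨ ZFC⁻`, closed under sequences of length less than `κ`, with `μ, A ∈ M`, a transitive set `N`,
and an elementary embedding `j : M → N` with critical point `κ`, for which `μ < j κ` and
`j '' μ ∈ N`. -/
def IsNearlySupercompact (κ μ : Cardinal.{u}) : Prop :=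
  ∀ A : ZFSet.{u}, A ⊆ μ.ord.toZFSet →
    ∃ M N : ZFSet.{u}, M.IsTransitive ∧ N.IsTransitive ∧ ModelsZFCMinus M ∧
      ClosedUnderSequences κ M ∧ μ.ord.toZFSet ∈ M ∧ A ∈ M ∧
      ∃ j : M ↪ₑ[setLang] N, IsCriticalPoint j κ.ord ∧
        (∃ k : M, (k : ZFSet.{u}) = κ.ord.toZFSet ∧ μ.ord.toZFSet ∈ (j k : ZFSet.{u})) ∧
        ∃ s ∈ N, ∀ y : ZFSet.{u},
          y ∈ s ↔ ∃ a : M, (a : ZFSet.{u}) ∈ μ.ord.toZFSet ∧ (j a : ZFSet.{u}) = y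

/-! ### Second-order sentences of complexity `Π¹₁` -/

/-- The language with one relation symbol of arity `arity i` for each `i < n` and nothing else,
used for the second-order variables of a formula. -/
def varLang {n : ℕ} (arity : Fin n → ℕ) : FirstOrder.Language.{0, 0} :=
  ⟨fun _ => Empty, fun k => {i : Fin n // arity i = k}⟩

/-- An assignment of relations on `M` to the second-order variables. -/
@[reducible]
def varStructure {n : ℕ} {arity : Fin n → ℕ} {M : Type v}
    (X : (i : Fin n) → Set (Fin (arity i) → M)) : (varLang arity).Structure M where
  funMap f _ := nomatch f
  RelMap r x := (fun l => x (Fin.cast r.2 l)) ∈ X r.1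

/-- A `Π¹₁` sentence `∀ X₁ … ∀ Xₙ ψ` of the language `L`: the `Xᵢ` are second-order variables of
given arities and `ψ` is a first-order sentence in which they may occur as predicates. -/
structure PiOneOneSentence (L : FirstOrder.Language.{u, v}) where
  numVars : ℕ
  arity : Fin numVars → ℕ
  matrix : (L.sum (varLang arity)).Sentence

/-- Truth of a `Π¹₁` sentence in a structure, the second-order variables ranging over all
relations on the domain (full second-order semantics). -/
def PiOneOneSentence.Realize {L : FirstOrder.Language.{u, v}} (φ : PiOneOneSentence L) (M : Type w)
    [L.Structure M] : Prop :=
  ∀ X : (i : Fin φ.numVars) → Set (Fin (φ.arity i) → M),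
    letI : (varLang φ.arity).Structure M := varStructure X
    FirstOrder.Language.Sentence.Realize (L := L.sum (varLang φ.arity)) M φ.matrix

/-! ### Reflective cardinals -/

/-- The cardinal `κ` is `μ`-reflective for `Π¹₁` assertions: every `Π¹₁` sentence true in a
structure with domain `D ⊇ κ` of size `μ`, in a language of size less than `κ`, is true in a
first-order elementary substructure `m` of it with `|m| < κ` and `m ∩ κ ∈ κ`. -/
def IsPiOneOneReflective (κ μ : Cardinal.{u}) : Prop :=
  ∀ (L : FirstOrder.Language.{u, u}), L.card < κ →
    ∀ (D : ZFSet.{u}) [L.Structure D], κ.ord.toZFSet ⊆ D → D.card = μ →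
      ∀ φ : PiOneOneSentence L, φ.Realize D →
        ∃ m : L.ElementarySubstructure D, #m < Cardinal.lift.{u + 1} κ ∧
          (∃ δ < κ.ord, ((↑) '' (m : Set D) ∩ κ.ord.toZFSet : Set ZFSet.{u}) = δ.toZFSet) ∧
          φ.Realize m

end NearSupercompact

namespace NearSupercompact
open Set Filter
open FirstOrder.Language FirstOrder.Language.Structure

/-! ### Normal fine ultrafilters -/

/-! Both properties are equivalent to a third, `HasNormalUltrafilters`: any `μ` many regressive
functions on the small subsets of `μ` can be made constant almost everywhere by one fine
ultrafilter. No completeness is demanded of the ultrafilter. Whatever completeness or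
well-foundedness an argument needs is obtained by adding suitable functions to the family.

Reflection gives ultrafilters. If the functions `F i` have no such ultrafilter, then no assignment
`i ↦ c i` has the property that any finitely many demands `i ∈ x`, `F i x = c i` hold at some small
`x`. With finite sets of demands coded as elements of `μ`, this is a `Π¹₁` statement. It cannot
reflect to a small `m`, because `m` is itself a small set and `i ↦ F i m` is such an assignment on
`m`.

Ultrafilters give reflection. If a `Π¹₁` sentence fails in all small substructures, each small `x`
gives a substructure with counterexample relations. Taking the relations that hold almost everywhere
yields a counterexample on the whole domain, by a version of the theorem of Łoś in which normality
makes the witnesses constant (`realize_iff_eventually_realize`). That almost every `x` gives an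
elementary substructure is also a normality argument (`exists_normal_elementary`).

Ultrafilters give embeddings. Since `μ ^< κ = μ`, there is a suitable transitive model `M` of size
at most `μ` containing `A` (`exists_model`). An ultrapower of `M` by only `μ` many functions, closed
under Skolem functions, is well-founded if the ultrafilter is normal for the right family, which
includes one function for each `ω`-sequence of functions. In its collapse the identity represents `j
'' μ`, and `x ↦ otp (x ∩ α)` represents `α`, so `μ < j κ`.

Embeddings give ultrafilters. The values `F i x` are coded into one `A ⊆ μ`
(`exists_coding_function`), and `j : M → N` is taken for this `A`. In `N` the set `j '' μ` is a
small subset of `j μ`, so by elementarity the coded function sends each `j i` to an element `j (c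
i)` of `j '' μ`. For finitely many `i`, the existence of a set with these coded values pulls back to
`M`, and compactness gives the ultrafilter. -/

/-- The subsets of `μ` of size less than `κ` that meet `κ` in an ordinal below `κ`. -/
def IsSmallSubset (κ μ : Cardinal.{u}) (x : Set Ordinal.{u}) : Prop :=
  x ⊆ Iio μ.ord ∧ #x < Cardinal.lift.{u + 1} κ ∧ ∃ δ < κ.ord, x ∩ Iio κ.ord = Iio δ

/-- For each family of `μ` many regressive functions there is a fine ultrafilter on the small
subsets of `μ` with respect to which all of them are constant almost everywhere. -/
def HasNormalUltrafilters (κ μ : Cardinal.{u}) : Prop :=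
  ∀ F : Ordinal.{u} → Set Ordinal.{u} → Ordinal.{u}, (∀ i x, i ∈ x → F i x ∈ x) →
    ∃ 𝒰 : Ultrafilter (Set Ordinal.{u}), (∀ᶠ x in 𝒰, IsSmallSubset κ μ x) ∧
      (∀ α < μ.ord, ∀ᶠ x : Set Ordinal.{u} in 𝒰, α ∈ x) ∧ ∀ i < μ.ord, ∃ v, ∀ᶠ x in 𝒰, F i x = v

/-- Compactness: the sets of small `x` with `i ∈ x` and `F i x = c i` have the finite intersection
property, and fineness is built into them. Both proofs of `HasNormalUltrafilters` produce the values
`c` and end here. -/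
theorem exists_ultrafilter_of_finite {κ μ : Cardinal.{u}} (hμ : 0 < μ)
    (F : Ordinal.{u} → Set Ordinal.{u} → Ordinal.{u}) (c : Ordinal.{u} → Ordinal.{u})
    (h : ∀ s : Finset Ordinal.{u}, (∀ i ∈ s, i < μ.ord) →
      ∃ x, IsSmallSubset κ μ x ∧ ∀ i ∈ s, i ∈ x ∧ F i x = c i) :
    ∃ 𝒰 : Ultrafilter (Set Ordinal.{u}), (∀ᶠ x in 𝒰, IsSmallSubset κ μ x) ∧
      (∀ α < μ.ord, ∀ᶠ x : Set Ordinal.{u} in 𝒰, α ∈ x) ∧ ∀ i < μ.ord, ∃ v, ∀ᶠ x in 𝒰, F i x = v := by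
  classical
  let B : Ordinal.{u} → Set (Set Ordinal.{u}) :=
    fun i => {x | IsSmallSubset κ μ x ∧ i ∈ x ∧ F i x = c i}
  have h0 : 0 < μ.ord := by simpa using hμ
  obtain ⟨𝒰, h𝒰⟩ := Ultrafilter.exists_ultrafilter_of_finite_inter_nonempty (B '' Iio μ.ord) (by
    intro T hT
    obtain ⟨s, hs, rfl⟩ := Finset.subset_set_image_iff.1 hT
    obtain ⟨x, hx, hxs⟩ := h (insert 0 s) (by
      intro i hi
      rcases Finset.mem_insert.1 hi with rfl | hi
      · exact h0
      · exact hs hi)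
    refine ⟨x, ?_⟩
    simp only [Finset.coe_image, sInter_image, mem_iInter]
    exact fun i hi => ⟨hx, hxs i (Finset.mem_insert_of_mem hi)⟩)
  have hB : ∀ i < μ.ord, ∀ᶠ x in 𝒰, x ∈ B i := fun i hi => h𝒰 ⟨i, hi, rfl⟩
  exact ⟨𝒰, (hB 0 h0).mono fun x hx => hx.1, fun i hi => (hB i hi).mono fun x hx => hx.2.1,
    fun i hi => ⟨c i, (hB i hi).mono fun x hx => hx.2.2⟩⟩

/-- The form used in applications, for functions that need only be regressive almost everywhere. The
family is reindexed along an injection into `μ`, and a value outside `x` is replaced by the index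
`j`, which keeps the new function regressive at every `x` containing `j`. -/
theorem HasNormalUltrafilters.exists_of_family {κ μ : Cardinal.{u}}
    (h : HasNormalUltrafilters κ μ) {ι : Type (u + 1)} (hι : #ι ≤ Cardinal.lift.{u + 1} μ)
    (G : ι → Set Ordinal.{u} → Ordinal.{u}) :
    ∃ 𝒰 : Ultrafilter (Set Ordinal.{u}), (∀ᶠ x in 𝒰, IsSmallSubset κ μ x) ∧
      (∀ α < μ.ord, ∀ᶠ x : Set Ordinal.{u} in 𝒰, α ∈ x) ∧
        ∀ i, (∀ᶠ x in 𝒰, G i x ∈ x) → ∃ v < μ.ord, ∀ᶠ x in 𝒰, G i x = v := by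
  classical
  have hι' : #ι ≤ #(Iio μ.ord) := by simpa [Cardinal.mk_Iio_ordinal] using hι
  obtain ⟨e⟩ := hι'
  let F : Ordinal.{u} → Set Ordinal.{u} → Ordinal.{u} := fun j x =>
    if hj : ∃ i, (e i : Ordinal) = j ∧ G i x ∈ x then G hj.choose x else j
  obtain ⟨𝒰, h1, h2, h3⟩ := h F (by
    intro j x hj
    by_cases hi : ∃ i, (e i : Ordinal) = j ∧ G i x ∈ x
    · simp only [F, dif_pos hi]
      exact hi.choose_spec.2
    · simpa only [F, dif_neg hi] using hj)
  refine ⟨𝒰, h1, h2, fun i hi => ?_⟩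
  obtain ⟨v, hv⟩ := h3 (e i) (e i).2
  have key : ∀ᶠ x in 𝒰, G i x = v ∧ v < μ.ord := by
    filter_upwards [hv, hi, h1] with x hx hix hsm
    have hex : ∃ i', (e i' : Ordinal) = e i ∧ G i' x ∈ x := ⟨i, rfl, hix⟩
    have hch : hex.choose = i := e.injective (Subtype.ext hex.choose_spec.1)
    have : F (e i) x = G i x := by
      simp only [F, dif_pos hex]
      rw [hch]
    have h' : G i x = v := this ▸ hx
    exact ⟨h', h' ▸ hsm.1 hix⟩
  obtain ⟨x, hx⟩ := key.exists
  exact ⟨v, hx.2, key.mono fun x hx => hx.1⟩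

/-- Otherwise small sets are finite, so `x ↦ max x` is regressive and almost everywhere equal to
some `v`; but fineness puts `v + 1` into almost every `x`. -/
theorem HasNormalUltrafilters.aleph0_lt {κ μ : Cardinal.{u}}
    (h : HasNormalUltrafilters κ μ) (hμ : ℵ₀ ≤ μ) : ℵ₀ < κ := by
  classical
  by_contra! hκ
  obtain ⟨𝒰, h1, h2, h3⟩ := h.exists_of_family (ι := PUnit) (by
      have : (1 : Cardinal.{u}) ≤ μ := one_le_aleph0.trans hμ
      simpa using this)
    (fun _ x => if hx : ∃ m ∈ x, ∀ y ∈ x, y ≤ m then hx.choose else 0)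
  have h0 : 0 < μ.ord := by
    have : 0 < μ := aleph0_pos.trans_le hμ
    simpa using this
  have key : ∀ᶠ x : Set Ordinal.{u} in 𝒰, ∃ m ∈ x, ∀ y ∈ x, y ≤ m := by
    filter_upwards [h1, h2 0 h0] with x hx hx0
    have hfin : x.Finite := by
      rw [← Cardinal.lt_aleph0_iff_set_finite]
      exact hx.2.1.trans_le (by simpa using hκ)
    obtain ⟨m, hm, hmax⟩ := hfin.exists_maximal ⟨0, hx0⟩
    exact ⟨m, hm, fun y hy => (le_total y m).elim id fun hle => hmax hy hle⟩
  obtain ⟨v, hv, hc⟩ := h3 PUnit.unit (by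
    filter_upwards [key] with x hx
    rw [dif_pos hx]
    exact hx.choose_spec.1)
  have hv' : v + 1 < μ.ord := by
    have := (Cardinal.isSuccLimit_ord hμ).succ_lt hv
    simpa using this
  obtain ⟨x, hx, hx1, hxv⟩ := (key.and ((h2 _ hv').and hc)).exists
  rw [dif_pos hx] at hxv
  have := hx.choose_spec.2 _ hx1
  rw [hxv] at this
  exact absurd this (by simp)


/-! ### Reflection yields normal fine ultrafilters -/

/-- Function symbols for operations on finite conditions. -/
inductive CondFun : ℕ → Type u
  | cat : CondFun 2
  | lev : CondFun 2

/-- A relation symbol for consistency of finite conditions. -/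
inductive CondRel : ℕ → Type u
  | ne : CondRel 1

/-- The language of finite conditions. -/
def condLang : FirstOrder.Language.{u, u} := ⟨CondFun, CondRel⟩

theorem condLang_card_lt {κ : Cardinal.{u}} (hκ : ℵ₀ ≤ κ) : condLang.{u}.card < κ := by
  have hs : Function.Surjective (fun i : Fin 3 => (![Sum.inl ⟨2, CondFun.cat⟩,
      Sum.inl ⟨2, CondFun.lev⟩, Sum.inr ⟨1, CondRel.ne⟩] i : condLang.{u}.Symbols)) := by
    rintro (⟨n, f⟩ | ⟨n, r⟩)
    · cases f
      · exact ⟨0, rfl⟩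
      · exact ⟨1, rfl⟩
    · cases r
      exact ⟨2, rfl⟩
  have : Finite condLang.{u}.Symbols := Finite.of_surjective _ hs
  exact (Cardinal.mk_lt_aleph0_iff.2 this).trans_le hκ

/-- The language of finite conditions with one unary predicate variable. -/
abbrev condLangVar : FirstOrder.Language.{u, u} := condLang.{u}.sum (varLang (n := 1) fun _ => 1)

/-- The symbol for the predicate variable. -/
def condVar : condLangVar.{u}.Relations 1 := Sum.inr ⟨0, rfl⟩

/-- The symbol for consistency. -/
def condNe : condLangVar.{u}.Relations 1 := Sum.inl CondRel.ne

/-- The symbol for concatenation. -/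
def condCat : condLangVar.{u}.Functions 2 := Sum.inl CondFun.cat

/-- The symbol for the basic conditions. -/
def condLev : condLangVar.{u}.Functions 2 := Sum.inl CondFun.lev

/-- The sentence saying that the predicate variable is a consistent filter of conditions that
decides every function. -/
def genericSentence : condLangVar.{u}.Sentence :=
  (∀' ∀' (condVar.boundedFormula₁ (&0) ⟹ (condVar.boundedFormula₁ (&1) ⟹
      condVar.boundedFormula₁ (condCat.apply₂ (&0) (&1))))) ⊓
    (∀' ∃' condVar.boundedFormula₁ (condLev.apply₂ (&0) (&1))) ⊓
    (∀' (condVar.boundedFormula₁ (&0) ⟹ condNe.boundedFormula₁ (&0)))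

theorem realize_genericSentence {D : Type w} [condLangVar.{u}.Structure D] :
    genericSentence.{u}.Realize D ↔
      (∀ a b : D, RelMap condVar.{u} ![a] → RelMap condVar.{u} ![b] →
        RelMap condVar.{u} ![funMap condCat.{u} ![a, b] ]) ∧
      (∀ i : D, ∃ v : D, RelMap condVar.{u} ![funMap condLev.{u} ![i, v] ]) ∧
      ∀ a : D, RelMap condVar.{u} ![a] → RelMap condNe.{u} ![a] := by
  simp only [Sentence.Realize, Formula.Realize, genericSentence,
      BoundedFormula.realize_inf, BoundedFormula.realize_all, BoundedFormula.realize_ex,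
      BoundedFormula.realize_imp, BoundedFormula.realize_rel₁, Term.realize_functions_apply₂]
  simp [Fin.snoc, and_assoc]

/-- The assertion that no set of conditions is a consistent filter that decides every function. -/
def noGeneric : PiOneOneSentence condLang.{u} where
  numVars := 1
  arity := fun _ => 1
  matrix := ∼genericSentence

theorem realize_noGeneric {D : Type w} [condLang.{u}.Structure D] :
    noGeneric.{u}.Realize D ↔ ∀ U : Set D,
      ¬((∀ a b, a ∈ U → b ∈ U → (funMap (L := condLang.{u}) CondFun.cat ![a, b] : D) ∈ U) ∧
        (∀ i, ∃ v, (funMap (L := condLang.{u}) CondFun.lev ![i, v] : D) ∈ U) ∧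
        ∀ a ∈ U, RelMap (L := condLang.{u}) CondRel.ne ![a]) := by
  have key : ∀ X : (i : Fin 1) → Set (Fin 1 → D),
      (letI : (varLang (n := 1) fun _ => 1).Structure D := varStructure (arity := fun _ => 1) X
      Sentence.Realize (L := condLangVar.{u}) D (∼genericSentence)) ↔
      ¬((∀ a b, ![a] ∈ X 0 → ![b] ∈ X 0 →
          ![(funMap (L := condLang.{u}) CondFun.cat ![a, b] : D)] ∈ X 0) ∧
        (∀ i, ∃ v, ![(funMap (L := condLang.{u}) CondFun.lev ![i, v] : D)] ∈ X 0) ∧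
        ∀ a, ![a] ∈ X 0 → RelMap (L := condLang.{u}) CondRel.ne ![a]) := by
    intro X
    let _ : (varLang (n := 1) fun _ => 1).Structure D := varStructure (arity := fun _ => 1) X
    exact not_congr (realize_genericSentence (D := D))
  constructor
  · intro h U
    have := (key fun _ => {w | w (0 : Fin 1) ∈ U}).1 (h fun _ => {w | w (0 : Fin 1) ∈ U})
    simpa using this
  · intro h X
    refine (key X).2 ?_
    exact h {a | ![a] ∈ X (0 : Fin 1)}

theorem toZFSet_rank_of_mem {o : Ordinal.{u}} {x : ZFSet.{u}} (hx : x ∈ o.toZFSet) :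
    x.rank < o ∧ x.rank.toZFSet = x := by
  obtain ⟨a, ha, rfl⟩ := Ordinal.mem_toZFSet_iff.1 hx
  simpa using ha

theorem mk_toZFSet_ord (μ : Cardinal.{u}) : #(μ.ord.toZFSet) = Cardinal.lift.{u + 1} μ := by
  rw [ZFSet.cardinalMk_coe_sort]
  simp

/-- An element of the structure codes a finite list of pairs `(i, v)`, read as the demands `i ∈ x`
and `F i x = v`; it is consistent if some small `x` meets them. A filter of consistent conditions
deciding every `i` would yield the ultrafilter, so `noGeneric` holds in the whole structure when
there is none. -/
theorem IsPiOneOneReflective.hasNormalUltrafilters {κ μ : Cardinal.{u}} (hκ : ℵ₀ ≤ κ)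
    (hκμ : κ ≤ μ) (h : IsPiOneOneReflective κ μ) : HasNormalUltrafilters κ μ := by
  intro F hF
  by_contra hno
  have hμ : ℵ₀ ≤ μ := hκ.trans hκμ
  have hD : #(μ.ord.toZFSet) = Cardinal.lift.{u + 1} μ := mk_toZFSet_ord μ
  have hinf : Infinite μ.ord.toZFSet := by
    rw [Cardinal.infinite_iff, hD]
    simpa using hμ
  let val : μ.ord.toZFSet → Ordinal.{u} := fun d => (d : ZFSet).rank
  have hval : ∀ d, val d < μ.ord ∧ (val d).toZFSet = d := fun d => toZFSet_rank_of_mem d.2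
  obtain ⟨E⟩ : Nonempty (List (μ.ord.toZFSet × μ.ord.toZFSet) ≃ μ.ord.toZFSet) := by
    rw [← Cardinal.eq, Cardinal.mk_list_eq_mk]
    simp
  let Meets : List (μ.ord.toZFSet × μ.ord.toZFSet) → Set Ordinal.{u} → Prop := fun l x =>
    ∀ p ∈ l, val p.1 ∈ x ∧ F (val p.1) x = val p.2
  let _ : condLang.{u}.Structure μ.ord.toZFSet :=
    { funMap := fun {n} f => match n, f with
        | _, CondFun.cat => fun v => E (E.symm (v 0) ++ E.symm (v 1))
        | _, CondFun.lev => fun v => E [(v 0, v 1)]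
      RelMap := fun {n} r => match n, r with
        | _, CondRel.ne => fun v => ∃ x, IsSmallSubset κ μ x ∧ Meets (E.symm (v 0)) x }
  have hcat : ∀ a b : μ.ord.toZFSet, funMap (L := condLang.{u}) CondFun.cat ![a, b] =
    E (E.symm a ++ E.symm b) := fun a b => rfl
  have hlev : ∀ a b : μ.ord.toZFSet, funMap (L := condLang.{u}) CondFun.lev ![a, b] =
    E [(a, b)] := fun a b => rfl
  have hne : ∀ a : μ.ord.toZFSet, RelMap (L := condLang.{u}) CondRel.ne ![a] ↔
    ∃ x, IsSmallSubset κ μ x ∧ Meets (E.symm a) x := fun a => Iff.rfl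
  have hφ : noGeneric.{u}.Realize μ.ord.toZFSet := by
    rw [realize_noGeneric]
    rintro U ⟨h1, h2, h3⟩
    simp only [hcat, hlev, hne] at h1 h2 h3
    apply hno
    choose c hc using h2
    have h0 : (0 : Ordinal.{u}) < μ.ord := by
      have : 0 < μ := aleph0_pos.trans_le hμ
      simpa using this
    have hmem : ∀ {i}, i < μ.ord → i.toZFSet ∈ μ.ord.toZFSet :=
      fun hi => Ordinal.toZFSet_mem_toZFSet_iff.2 hi
    refine exists_ultrafilter_of_finite (aleph0_pos.trans_le hμ) F
      (fun i => if hi : i < μ.ord then val (c ⟨i.toZFSet, hmem hi⟩) else 0) ?_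
    intro s hs
    -- Closure under concatenation merges finitely many basic conditions into a single one, whose
    -- consistency provides one `x` for all of them.
    have : ∃ a ∈ U, ∀ i ∈ s, ∀ hi : i < μ.ord,
        ((⟨i.toZFSet, hmem hi⟩, c ⟨i.toZFSet, hmem hi⟩) : μ.ord.toZFSet × μ.ord.toZFSet) ∈
          E.symm a := by
      clear hs
      classical
      induction s using Finset.induction_on with
      | empty => exact ⟨_, hc ⟨_, hmem h0⟩, by simp⟩
      | insert i s _ ih =>
        obtain ⟨a, ha, has⟩ := ih
        by_cases hi : i < μ.ord
        · refine ⟨_, h1 _ _ ha (hc ⟨_, hmem hi⟩), fun j hj hj' => ?_⟩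
          rcases Finset.mem_insert.1 hj with rfl | hj
          · simp
          · simp [has j hj hj']
        · refine ⟨a, ha, fun j hj hj' => ?_⟩
          rcases Finset.mem_insert.1 hj with rfl | hj
          · exact absurd hj' hi
          · exact has j hj hj'
    obtain ⟨a, ha, has⟩ := this
    obtain ⟨x, hx, hxa⟩ := h3 a ha
    refine ⟨x, hx, fun i hi => ?_⟩
    have := hxa _ (has i hi (hs i hi))
    simpa [val, dif_pos (hs i hi)] using this
  obtain ⟨m, hm, ⟨δ, hδ, hmδ⟩, hmφ⟩ := h condLang.{u} (condLang_card_lt hκ) μ.ord.toZFSet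
    (Ordinal.toZFSet_subset_toZFSet_iff.2 (by simpa using hκμ)) (by simp) noGeneric hφ
  let p : Set Ordinal.{u} := val '' (m : Set μ.ord.toZFSet)
  have hp : IsSmallSubset κ μ p := by
    refine ⟨?_, Cardinal.mk_image_le.trans_lt hm, δ, hδ, ?_⟩
    · rintro _ ⟨d, -, rfl⟩
      exact (hval d).1
    · ext α
      have := congrArg (α.toZFSet ∈ ·) hmδ
      simp only [Set.mem_inter_iff, Set.mem_image, SetLike.mem_coe,
        Ordinal.toZFSet_mem_toZFSet_iff, eq_iff_iff] at this
      rw [mem_Iio, ← this, Set.mem_inter_iff, mem_Iio]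
      refine and_congr_left fun _ => exists_congr fun d => and_congr_right fun _ => ?_
      rw [← (hval d).2]
      exact Ordinal.toZFSet_injective.eq_iff.symm
  rw [realize_noGeneric] at hmφ
  -- The conditions met by `p`, the set of ordinals of `m`, contradict the reflected sentence. They
  -- are consistent because `p` is small, and they decide each `i` inside `m` because `F i p ∈ p`.
  refine hmφ {a | Meets (E.symm (a : μ.ord.toZFSet)) p} ⟨?_, ?_, ?_⟩
  · intro a b ha hb
    have hab : ((funMap (L := condLang.{u}) CondFun.cat ![a, b] : m) : μ.ord.toZFSet) =
        E (E.symm (a : μ.ord.toZFSet) ++ E.symm (b : μ.ord.toZFSet)) := rfl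
    rw [Set.mem_ofPred_eq, hab, E.symm_apply_apply]
    intro q hq
    rcases List.mem_append.1 hq with hq | hq
    · exact ha q hq
    · exact hb q hq
  · intro i
    have hi : val i ∈ p := ⟨i, i.2, rfl⟩
    obtain ⟨v, hv, hvF⟩ := hF _ _ hi
    refine ⟨⟨v, hv⟩, ?_⟩
    have hab : ((funMap (L := condLang.{u}) CondFun.lev ![i, ⟨v, hv⟩] : m) : μ.ord.toZFSet) =
        E [((i : μ.ord.toZFSet), v)] := rfl
    rw [Set.mem_ofPred_eq, hab, E.symm_apply_apply]
    intro q hq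
    obtain rfl := List.mem_singleton.1 hq
    exact ⟨hi, hvF.symm⟩
  · intro a ha
    exact ⟨p, hp, ha⟩


/-! ### A theorem of Łoś for subsets of a fixed domain -/

section Los

variable {L : FirstOrder.Language.{u, v}} {I : Type*} {D : Type w} [L.Structure D]
  {𝒰 : Ultrafilter I} {m : I → Set D} [∀ x, L.Structure (m x)]

theorem eventually_realize_term_eq
    (hf : ∀ {n} (f : L.Functions n) (a : Fin n → D),
      ∀ᶠ x in 𝒰, ∀ a' : Fin n → m x, (∀ i, (a' i : D) = a i) → ((funMap f a' : m x) : D) = funMap f a)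
    {n : ℕ} (t : L.Term (Empty ⊕ Fin n)) (a : Fin n → D) :
    ∀ᶠ x in 𝒰, ∀ a' : Fin n → m x, (∀ i, (a' i : D) = a i) →
      ((t.realize (Sum.elim default a') : m x) : D) = t.realize (Sum.elim default a) := by
  induction t with
  | var i =>
    rcases i with i | i
    · exact i.elim
    · exact .of_forall fun x a' ha => ha i
  | func f ts ih =>
    filter_upwards [hf f fun i => (ts i).realize (Sum.elim default a), eventually_all.2 ih]
      with x hx hts a' ha
    exact hx _ fun i => hts i a' ha

/-- All structures live on subsets of one domain `D`, so `D` takes the place of the ultraproduct,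
each `d` standing for the constant function. The only obstacle is the quantifier step, where
counterexamples chosen in each `m x` must be almost everywhere the same element of `D`. This is the
assumption `hn`, later supplied by normality. -/
theorem realize_iff_eventually_realize (hm : ∀ d, ∀ᶠ x in 𝒰, d ∈ m x)
    (hf : ∀ {n} (f : L.Functions n) (a : Fin n → D),
      ∀ᶠ x in 𝒰, ∀ a' : Fin n → m x, (∀ i, (a' i : D) = a i) → ((funMap f a' : m x) : D) = funMap f a)
    (hr : ∀ {n} (r : L.Relations n) (a : Fin n → D),
      RelMap r a ↔ ∀ᶠ x in 𝒰, ∃ a' : Fin n → m x, (∀ i, (a' i : D) = a i) ∧ RelMap r a')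
    (hn : ∀ {n} (θ : L.BoundedFormula Empty (n + 1)) (a : Fin n → D),
      (∀ᶠ x in 𝒰, ∃ a' : Fin n → m x, (∀ i, (a' i : D) = a i) ∧
        ∃ y : m x, ¬ θ.Realize default (Fin.snoc a' y : Fin (n + 1) → m x)) →
      ∃ d, ∀ᶠ x in 𝒰, ∃ a' : Fin n → m x, (∀ i, (a' i : D) = a i) ∧
        ∃ y : m x, (y : D) = d ∧ ¬ θ.Realize default (Fin.snoc a' y : Fin (n + 1) → m x))
    {n : ℕ} (θ : L.BoundedFormula Empty n) (a : Fin n → D) :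
    θ.Realize default a ↔
      ∀ᶠ x in 𝒰, ∃ a' : Fin n → m x, (∀ i, (a' i : D) = a i) ∧ θ.Realize default a' := by
  have hex : ∀ {n} (a : Fin n → D), ∀ᶠ x in 𝒰, ∃ a' : Fin n → m x, ∀ i, (a' i : D) = a i := by
    intro n a
    filter_upwards [eventually_all.2 fun i => hm (a i)] with x hx
    exact ⟨fun i => ⟨a i, hx i⟩, fun i => rfl⟩
  have huniq : ∀ {n x} {a : Fin n → D} {a' b' : Fin n → m x}, (∀ i, (a' i : D) = a i) →
      (∀ i, (b' i : D) = a i) → a' = b' := fun h1 h2 =>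
    funext fun i => Subtype.ext ((h1 i).trans (h2 i).symm)
  induction θ with
  | falsum => simp [BoundedFormula.Realize, Ultrafilter.neBot 𝒰 |>.ne]
  | equal t₁ t₂ =>
    have h1 := eventually_realize_term_eq hf t₁ a
    have h2 := eventually_realize_term_eq hf t₂ a
    constructor
    · intro h
      filter_upwards [h1, h2, hex a] with x h1 h2 ⟨a', ha'⟩
      exact ⟨a', ha', Subtype.ext ((h1 a' ha').trans (Eq.trans h (h2 a' ha').symm))⟩
    · intro h
      obtain ⟨x, ⟨a', ha', h⟩, h1, h2⟩ := (h.and (h1.and h2)).exists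
      exact (h1 a' ha').symm.trans ((congrArg Subtype.val h).trans (h2 a' ha'))
  | rel r ts =>
    refine (hr r fun i => (ts i).realize (Sum.elim default a)).trans ?_
    have hts := eventually_all.2 fun i => eventually_realize_term_eq hf (ts i) a
    refine eventually_congr ?_
    filter_upwards [hts, hex a] with x hts ⟨a', ha'⟩
    constructor
    · rintro ⟨b', hb', hb⟩
      refine ⟨a', ha', ?_⟩
      rwa [huniq hb' fun i => hts i a' ha'] at hb
    · rintro ⟨b', hb', hb⟩
      exact ⟨_, fun i => hts i b' hb', hb⟩
  | imp θ₁ θ₂ ih₁ ih₂ =>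
    refine (imp_congr (ih₁ a) (ih₂ a)).trans (Ultrafilter.eventually_imp.symm.trans ?_)
    refine eventually_congr ?_
    filter_upwards [hex a] with x ⟨a', ha'⟩
    constructor
    · intro h
      refine ⟨a', ha', fun h1 => ?_⟩
      obtain ⟨b', hb', hb⟩ := h ⟨a', ha', h1⟩
      rwa [huniq ha' hb']
    · rintro ⟨b', hb', hb⟩ ⟨c', hc', hc⟩
      rw [huniq hc' hb'] at hc
      exact ⟨b', hb', hb hc⟩
  | @all n θ ih =>
    rw [BoundedFormula.realize_all]
    constructor
    · intro h
      by_contra hcon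
      rw [← Ultrafilter.eventually_not] at hcon
      obtain ⟨d, hd⟩ := hn θ a (by
        filter_upwards [hcon, hex a] with x hx ⟨a', ha'⟩
        refine ⟨a', ha', ?_⟩
        by_contra! hall
        exact hx ⟨a', ha', BoundedFormula.realize_all.2 hall⟩)
      obtain ⟨x, ⟨a', ha', y, hy, hθ⟩, b', hb', hb⟩ := (hd.and ((ih _).1 (h d))).exists
      refine hθ ?_
      convert! hb
      refine huniq (a := Fin.snoc a d) (fun i => ?_) hb'
      refine Fin.lastCases ?_ (fun i => ?_) i
      · simpa using hy
      · simpa using ha' i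
    · intro h d
      refine (ih _).2 ?_
      filter_upwards [h, hm d] with x ⟨a', ha', hx⟩ hd
      refine ⟨Fin.snoc a' ⟨d, hd⟩, fun i => ?_, BoundedFormula.realize_all.1 hx _⟩
      refine Fin.lastCases ?_ (fun i => ?_) i
      · simp
      · simpa using ha' i

end Los


/-! ### Normal fine ultrafilters yield reflection -/

/-- The function `g` is constant almost everywhere if it is regressive. -/
def IsNormalAt (𝒰 : Ultrafilter (Set Ordinal.{u})) (g : Set Ordinal.{u} → Ordinal.{u}) : Prop :=
  (∀ᶠ x in 𝒰, g x ∈ x) → ∃ v, ∀ᶠ x in 𝒰, g x = v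

/-- The ultrafilter `𝒰` is a fine ultrafilter on the small subsets of `μ`. -/
structure IsFine (κ μ : Cardinal.{u}) (𝒰 : Ultrafilter (Set Ordinal.{u})) : Prop where
  small : ∀ᶠ x in 𝒰, IsSmallSubset κ μ x
  mem : ∀ α < μ.ord, ∀ᶠ x : Set Ordinal.{u} in 𝒰, α ∈ x

/-- Almost every `x` contains `γ` and meets `κ` in an ordinal. Hence any function with values below
a fixed `γ < κ` is regressive almost everywhere, which replaces an appeal to `κ`-completeness. -/
theorem IsFine.Iio_subset {κ μ : Cardinal.{u}} {𝒰 : Ultrafilter (Set Ordinal.{u})}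
    (h : IsFine κ μ 𝒰) (hκμ : κ ≤ μ) {γ : Ordinal.{u}} (hγ : γ < κ.ord) :
    ∀ᶠ x in 𝒰, Iio γ ⊆ x := by
  filter_upwards [h.small, h.mem γ (hγ.trans_le (by simpa using hκμ))] with x hx hγx
  obtain ⟨δ, hδ, hxδ⟩ := hx.2.2
  intro β hβ
  have h1 : γ ∈ Iio δ := hxδ ▸ ⟨hγx, hγ⟩
  have h2 : β ∈ x ∩ Iio κ.ord := hxδ ▸ (lt_trans hβ h1 : β < δ)
  exact h2.1

/-- Needed because the bijection of a domain with `μ` need not fix the ordinals below `κ`. If `α` is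
a chosen failure at `x`, then `α` or `b α` lies in `x`, so `g₁` or `b ∘ g₁` is regressive. By
injectivity `α` is constant in either case, and fineness at `α` and `b α` refutes the failure. -/
theorem exists_normal_preserving {κ μ : Cardinal.{u}} (hκμ : κ ≤ μ)
    (b : Ordinal.{u} → Ordinal.{u}) (hb : ∀ α < κ.ord, b α < μ.ord)
    (hinj : InjOn b (Iio κ.ord)) :
    ∃ g₁ g₂ : Set Ordinal.{u} → Ordinal.{u}, ∀ 𝒰, IsFine κ μ 𝒰 → IsNormalAt 𝒰 g₁ →
      IsNormalAt 𝒰 g₂ → ∀ᶠ x : Set Ordinal.{u} in 𝒰, ∀ α < κ.ord, α ∈ x ↔ b α ∈ x := by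
  classical
  let bad : Set Ordinal.{u} → Prop := fun x => ∃ α < κ.ord, ¬ (α ∈ x ↔ b α ∈ x)
  let g₁ : Set Ordinal.{u} → Ordinal.{u} := fun x => if h : bad x then h.choose else 0
  refine ⟨g₁, fun x => b (g₁ x), fun 𝒰 hf h₁ h₂ => ?_⟩
  by_contra hcon
  rw [← Ultrafilter.eventually_not] at hcon
  have hbad : ∀ᶠ x in 𝒰, g₁ x < κ.ord ∧ ¬ (g₁ x ∈ x ↔ b (g₁ x) ∈ x) := by
    filter_upwards [hcon] with x hx
    have hx : bad x := by simpa [bad] using hx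
    have hg : g₁ x = hx.choose := dif_pos hx
    rw [hg]
    exact hx.choose_spec
  have hor : (∀ᶠ x in 𝒰, g₁ x ∈ x) ∨ ∀ᶠ x in 𝒰, b (g₁ x) ∈ x := by
    rw [← Ultrafilter.eventually_or]
    filter_upwards [hbad] with x hx
    tauto
  have hconst : ∃ α < κ.ord, ∀ᶠ x in 𝒰, g₁ x = α := by
    rcases hor with h | h
    · obtain ⟨v, hv⟩ := h₁ h
      obtain ⟨x, hx, hxv⟩ := (hbad.and hv).exists
      exact ⟨v, hxv ▸ hx.1, hv⟩
    · obtain ⟨v, hv⟩ := h₂ h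
      obtain ⟨x, hx, hxv⟩ := (hbad.and hv).exists
      refine ⟨g₁ x, hx.1, ?_⟩
      filter_upwards [hbad, hv] with y hy hyv
      exact hinj hy.1 hx.1 (hyv.trans hxv.symm)
  obtain ⟨α, hα, hc⟩ := hconst
  obtain ⟨x, hx, hxα, h1, h2⟩ := (hbad.and (hc.and ((hf.mem α
    (hα.trans_le (by simpa using hκμ))).and (hf.mem _ (hb α hα))))).exists
  rw [hxα] at hx
  exact hx.2 ⟨fun _ => h2, fun _ => h1⟩

/-- The Tarski-Vaught test for a set in place of a substructure. -/
theorem exists_elementarySubstructure_of_set {L : FirstOrder.Language.{u, v}} {D : Type w}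
    [L.Structure D] (m : Set D)
    (h : ∀ n (θ : L.BoundedFormula Empty (n + 1)) (a : Fin n → D), (∀ i, a i ∈ m) →
      (∃ y, θ.Realize default (Fin.snoc a y : Fin (n + 1) → D)) →
      ∃ y ∈ m, θ.Realize default (Fin.snoc a y : Fin (n + 1) → D)) :
    ∃ M : L.ElementarySubstructure D, (M : Set D) = m := by
  let S : L.Substructure D :=
    { carrier := m
      fun_mem := by
        intro n f a ha
        -- The test applied to `f a = y` gives closure under the function symbols.
        let θ : L.BoundedFormula Empty (n + 1) :=
          Term.bdEqual (Term.func f fun i => Term.var (Sum.inr i.castSucc))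
            (Term.var (Sum.inr (Fin.last n)))
        have hθ : ∀ y, θ.Realize default (Fin.snoc a y : Fin (n + 1) → D) ↔ funMap f a = y := by
          intro y
          simp [θ]
        obtain ⟨y, hy, hyθ⟩ := h n θ a ha ⟨_, (hθ _).2 rfl⟩
        rw [hθ] at hyθ
        rwa [hyθ] }
  refine ⟨S.toElementarySubstructure fun n φ x a ha => ?_, rfl⟩
  obtain ⟨y, hy, hyφ⟩ := h n φ _ (fun i => (x i).2) ⟨a, ha⟩
  exact ⟨⟨y, hy⟩, hyφ⟩

theorem card_boundedFormula_le (L : FirstOrder.Language.{u, v}) :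
    #(Σ n, L.BoundedFormula Empty (n + 1)) ≤ max ℵ₀ (L.card) := by
  have hinj : Function.Injective (fun p : Σ n, L.BoundedFormula Empty (n + 1) =>
      (⟨p.1 + 1, p.2⟩ : Σ n, L.BoundedFormula Empty n)) := by
    rintro ⟨n, φ⟩ ⟨k, ψ⟩ h
    simp only [Sigma.mk.injEq, add_left_inj] at h
    obtain ⟨rfl, h⟩ := h
    exact Sigma.ext rfl h
  refine (Cardinal.mk_le_of_injective hinj).trans (BoundedFormula.card_le.trans ?_)
  simp

/-- Normality turns failures of the Tarski-Vaught test at almost every `x` into a failure of one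
fixed formula with fixed parameters. That formula has a witness in `D`, and fineness puts the
witness into almost every `x`. -/
theorem exists_normal_elementary {κ μ : Cardinal.{u}} (hκ : ℵ₀ < κ) (hκμ : κ ≤ μ)
    {L : FirstOrder.Language.{u, u}} (hL : L.card < κ) {D : Type (u + 1)} [L.Structure D]
    (e : D ≃ Iio μ.ord) :
    ∃ S : Option ℕ → Set Ordinal.{u} → Ordinal.{u}, ∀ 𝒰, IsFine κ μ 𝒰 →
      (∀ k, IsNormalAt 𝒰 (S k)) →
      ∀ᶠ x : Set Ordinal.{u} in 𝒰, ∃ M : L.ElementarySubstructure D, (M : Set D) = {d | (e d : Ordinal) ∈ x} := by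
  classical
  have hμ : ℵ₀ ≤ μ := hκ.le.trans hκμ
  let T := Σ n, L.BoundedFormula Empty (n + 1)
  have hT : #T < κ := (card_boundedFormula_le L).trans_lt (max_lt hκ (by simpa using hL))
  obtain ⟨c⟩ : Nonempty (ULift.{u + 1} T ↪ Iio (#T).ord) := by
    rw [← Cardinal.le_def, Cardinal.mk_Iio_ordinal, Cardinal.mk_uLift]
    simp
  let W := Σ t : T, (Fin t.1 → D)
  let bad : Set Ordinal.{u} → W → Prop := fun x p =>
    (∀ i, (e (p.2 i) : Ordinal) ∈ x) ∧
      (∃ y, p.1.2.Realize default (Fin.snoc p.2 y : Fin (p.1.1 + 1) → D)) ∧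
      ∀ y, (e y : Ordinal) ∈ x → ¬ p.1.2.Realize default (Fin.snoc p.2 y : Fin (p.1.1 + 1) → D)
  obtain ⟨d0⟩ : Nonempty D := by
    have h0 : 0 < μ.ord := by
      have : 0 < μ := aleph0_pos.trans_le hμ
      simpa using this
    exact ⟨e.symm ⟨0, h0⟩⟩
  let w : Set Ordinal.{u} → W := fun x =>
    if h : ∃ p, bad x p then h.choose else ⟨⟨0, ⊥⟩, Fin.elim0⟩
  have hw : ∀ x, (∃ p, bad x p) → bad x (w x) := by
    intro x h
    simp only [w, dif_pos h]
    exact h.choose_spec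
  -- The failing formula is recorded as an ordinal below `(#T).ord < κ`, and `some k` records its
  -- `k`-th parameter. The former is regressive by `IsFine.Iio_subset`, the latter because the
  -- parameters come from `x`.
  let S : Option ℕ → Set Ordinal.{u} → Ordinal.{u} := fun k x => match k with
    | none => c ⟨(w x).1⟩
    | some k => if hk : k < (w x).1.1 then e ((w x).2 ⟨k, hk⟩) else 0
  refine ⟨S, fun 𝒰 hf hn => ?_⟩
  by_contra hcon
  rw [← Ultrafilter.eventually_not] at hcon
  have hbad : ∀ᶠ x in 𝒰, bad x (w x) := by
    filter_upwards [hcon] with x hx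
    refine hw x ?_
    by_contra! hnb
    refine hx (exists_elementarySubstructure_of_set _ ?_)
    intro n θ a ha hy
    by_contra! hno
    exact hnb ⟨⟨n, θ⟩, a⟩ ⟨ha, hy, hno⟩
  have hγ : (#T).ord < κ.ord := by simpa using hT
  obtain ⟨t, ht⟩ : ∃ t : T, ∀ᶠ x in 𝒰, (w x).1 = t := by
    obtain ⟨v, hv⟩ := hn none (by
      filter_upwards [hf.Iio_subset hκμ hγ] with x hx
      exact hx (c ⟨(w x).1⟩).2)
    obtain ⟨x, hx⟩ := hv.exists
    refine ⟨(w x).1, ?_⟩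
    filter_upwards [hv] with y hy
    have : c ⟨(w y).1⟩ = c ⟨(w x).1⟩ := Subtype.ext (hy.trans hx.symm)
    exact ULift.up_injective (c.injective this)
  have ha : ∀ k : Fin t.1, ∃ d : D, ∀ᶠ x in 𝒰, ∀ h : (w x).1 = t, (w x).2 (h ▸ k) = d := by
    intro k
    have hval : ∀ x (h : (w x).1 = t), S (some k) x = e ((w x).2 (h ▸ k)) := by
      intro x h
      have hk : (k : ℕ) < (w x).1.1 := by rw [h]; exact k.2
      simp only [S, dif_pos hk]
      have hcast : ∀ (t' : T) (h : t' = t) (hk : (k : ℕ) < t'.1), (⟨k, hk⟩ : Fin t'.1) = h ▸ k := by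
        rintro t' rfl _
        rfl
      rw [hcast _ h hk]
    obtain ⟨v, hv⟩ := hn (some k) (by
      filter_upwards [ht, hbad] with x hx hb
      rw [hval x hx]
      exact hb.1 _)
    obtain ⟨x, hx, hxt⟩ := (hv.and ht).exists
    refine ⟨(w x).2 (hxt ▸ k), ?_⟩
    filter_upwards [hv] with y hy h
    refine e.injective (Subtype.ext ?_)
    rw [← hval y h, ← hval x hxt, hx, hy]
  choose a ha using ha
  have hwa : ∀ᶠ x in 𝒰, w x = ⟨t, a⟩ := by
    filter_upwards [ht, eventually_all.2 ha] with x hx hxa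
    generalize w x = p at hx hxa
    obtain ⟨t', a'⟩ := p
    subst hx
    exact Sigma.ext rfl (heq_of_eq (funext fun k => hxa k rfl))
  obtain ⟨x, hb, hx⟩ := (hbad.and hwa).exists
  rw [hx] at hb
  obtain ⟨y, hy⟩ := hb.2.1
  obtain ⟨x, hb, hx, hyx⟩ := (hbad.and (hwa.and (hf.mem _ (e y).2))).exists
  rw [hx] at hb
  exact hb.2.2 y hyx hy


theorem mk_sigma_prod_le {μ : Cardinal.{u}} (hμ : ℵ₀ ≤ μ) {T : ℕ → Type v}
    (hT : Cardinal.lift.{u} #(Σ n, T n) ≤ Cardinal.lift.{v} μ) {D : Type (u + 1)}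
    (hD : #D ≤ Cardinal.lift.{u + 1} μ) :
    #(Σ n, T n × (Fin n → D)) ≤ Cardinal.lift.{max (u + 1) v} μ := by
  have hinj : Function.Injective (fun p : Σ n, T n × (Fin n → D) =>
      ((⟨p.1, p.2.1⟩, List.ofFn p.2.2) : (Σ n, T n) × List D)) := by
    rintro ⟨n, φ, a⟩ ⟨k, ψ, b⟩ h
    simp only [Prod.mk.injEq, Sigma.mk.injEq] at h
    obtain ⟨⟨rfl, h1⟩, h2⟩ := h
    rw [eq_of_heq h1, List.ofFn_injective h2]
  refine (Cardinal.mk_le_of_injective hinj).trans ?_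
  have h1 : Cardinal.lift.{u + 1} #(Σ n, T n) ≤ Cardinal.lift.{max (u + 1) v} μ := by
    have := Cardinal.lift_le.{u + 1}.2 hT
    simpa using this
  have h2 : Cardinal.lift.{v} #(List D) ≤ Cardinal.lift.{max (u + 1) v} μ := by
    have := Cardinal.lift_le.{v}.2 ((Cardinal.mk_list_le_max D).trans
      (max_le (by simpa using hμ) hD))
    simpa using this
  rw [Cardinal.mk_prod]
  exact (mul_le_mul' h1 h2).trans (Cardinal.mul_eq_self (by simpa using hμ)).le

theorem card_varLang_le {n : ℕ} (arity : Fin n → ℕ) : (varLang arity).card ≤ ℵ₀ := by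
  have h1 : IsEmpty (Σ l, (varLang arity).Functions l) := ⟨fun x => nomatch x.2⟩
  have h2 : Countable (Σ l, (varLang arity).Relations l) :=
    inferInstanceAs (Countable (Σ l, {i : Fin n // arity i = l}))
  have : Countable (varLang arity).Symbols := inferInstanceAs (Countable (_ ⊕ _))
  exact Cardinal.mk_le_aleph0_iff.2 this

/-- If reflection fails, almost every `x` carries an elementary substructure `M x` and relations `X
x` violating the matrix. The relations are averaged along the ultrafilter to violate the matrix in
`D`. -/
theorem HasNormalUltrafilters.isPiOneOneReflective {κ μ : Cardinal.{u}}
    (h : HasNormalUltrafilters κ μ) (hμ : ℵ₀ ≤ μ) (hκμ : κ ≤ μ) : IsPiOneOneReflective κ μ := by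
  classical
  have hκ : ℵ₀ < κ := h.aleph0_lt hμ
  intro L hL D _ hκD hD φ hφ
  by_contra! hno
  obtain ⟨e⟩ : Nonempty (D ≃ Iio μ.ord) := by
    rw [← Cardinal.eq, ZFSet.cardinalMk_coe_sort, hD, Cardinal.mk_Iio_ordinal]
    simp
  have hmem : ∀ {α}, α < κ.ord → α.toZFSet ∈ D := fun hα =>
    hκD (Ordinal.toZFSet_mem_toZFSet_iff.2 hα)
  obtain ⟨g₁, g₂, hg⟩ := exists_normal_preserving hκμ
    (fun α => if hα : α.toZFSet ∈ D then e ⟨_, hα⟩ else 0)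
    (fun α hα => by
      simp only [dif_pos (hmem hα)]
      exact (e ⟨_, hmem hα⟩).2)
    (fun α hα β hβ hαβ => by
      simp only [dif_pos (hmem hα), dif_pos (hmem hβ)] at hαβ
      exact Ordinal.toZFSet_injective (congrArg Subtype.val (e.injective (Subtype.ext hαβ))))
  obtain ⟨S, hS⟩ := exists_normal_elementary hκ hκμ hL e
  let bad : Set Ordinal.{u} → Prop := fun x =>
    ∃ M : L.ElementarySubstructure D, (M : Set D) = {d | (e d : Ordinal) ∈ x} ∧ ¬ φ.Realize M
  have hch : ∀ x, ∃ (M : L.ElementarySubstructure D)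
      (X : (i : Fin φ.numVars) → Set (Fin (φ.arity i) → M)), bad x →
        (M : Set D) = {d | (e d : Ordinal) ∈ x} ∧
        letI : (varLang φ.arity).Structure M := varStructure X
        ¬ Sentence.Realize (L := L.sum (varLang φ.arity)) M φ.matrix := by
    intro x
    by_cases hx : bad x
    · obtain ⟨M, hM, hφM⟩ := hx
      simp only [PiOneOneSentence.Realize, not_forall] at hφM
      obtain ⟨X, hX⟩ := hφM
      exact ⟨M, X, fun _ => ⟨hM, hX⟩⟩
    · exact ⟨⊤, fun _ => ∅, fun h => absurd h hx⟩
  choose M X hMX using hch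
  let L' := L.sum (varLang φ.arity)
  let instM : ∀ x, L'.Structure ((M x : Set D) : Type (u + 1)) := fun x =>
    @sumStructure L (varLang φ.arity) (M x) _ (varStructure (X x))
  let B := Σ n, L'.BoundedFormula Empty (n + 1) × (Fin n → D)
  -- A chosen counterexample in `M x` to a universal statement with parameters from `D`. It is
  -- regressive when `M x` corresponds to `x`, and there are only `μ` many such statements, so one
  -- ultrafilter serves them all.
  let G : B → Set Ordinal.{u} → Ordinal.{u} := fun p x =>
    if hx : ∃ y : (M x : Set D), ∃ a' : Fin p.1 → (M x : Set D), (∀ i, (a' i : D) = p.2.2 i) ∧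
      ¬ p.2.1.Realize default (Fin.snoc a' y : Fin (p.1 + 1) → (M x : Set D))
    then e hx.choose else 0
  have hB : #(B ⊕ (Bool ⊕ Option ℕ)) ≤ Cardinal.lift.{u + 1} μ := by
    have hμ' : ℵ₀ ≤ Cardinal.lift.{u + 1} μ := by simpa using hμ
    have hL' : L'.card ≤ μ := by
      rw [Language.card_sum]
      refine (add_le_add (by simpa using hL.le.trans hκμ) ?_).trans (Cardinal.add_eq_self hμ).le
      exact (Cardinal.lift_le.2 (card_varLang_le φ.arity)).trans (by simpa using hμ)
    have h1 : #B ≤ Cardinal.lift.{u + 1} μ :=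
      mk_sigma_prod_le (T := fun n => L'.BoundedFormula Empty (n + 1)) hμ
        (Cardinal.lift_le.2 ((card_boundedFormula_le L').trans (max_le hμ hL')))
        (by rw [ZFSet.cardinalMk_coe_sort, hD])
    have h2 : #(Bool ⊕ Option ℕ) ≤ ℵ₀ := Cardinal.mk_le_aleph0
    rw [Cardinal.mk_sum]
    refine (add_le_add ?_ ?_).trans (Cardinal.add_eq_self hμ').le
    · simpa using h1
    · exact (Cardinal.lift_le.2 h2).trans (by simpa using hμ)
  obtain ⟨𝒰, h1, h2, h3⟩ := h.exists_of_family hB (Sum.elim G (Sum.elim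
    (fun t => cond t g₁ g₂) S))
  have hfine : IsFine κ μ 𝒰 := ⟨h1, h2⟩
  have hn : ∀ i, IsNormalAt 𝒰 ((Sum.elim G (Sum.elim (fun t => cond t g₁ g₂) S)) i) :=
    fun i hi => (h3 i hi).imp fun v hv => hv.2
  have hnG : ∀ p, IsNormalAt 𝒰 (G p) := fun p => hn (Sum.inl p)
  have hpres := hg 𝒰 hfine (hn (Sum.inr (Sum.inl true))) (hn (Sum.inr (Sum.inl false)))
  have helem := hS 𝒰 hfine fun k => hn (Sum.inr (Sum.inr k))
  have hbad : ∀ᶠ x in 𝒰, bad x := by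
    filter_upwards [h1, hpres, helem] with x hx hpx ⟨N, hN⟩
    refine ⟨N, hN, hno N ?_ ?_⟩
    · have : #N = #(N : Set D) := rfl
      rw [this, hN]
      refine lt_of_le_of_lt ?_ hx.2.1
      refine Cardinal.mk_le_of_injective (f := fun d : {d | (e d : Ordinal) ∈ x} =>
        (⟨e d, d.2⟩ : x)) ?_
      intro d d' hdd
      exact Subtype.ext (e.injective (Subtype.ext (congrArg (fun z : x => (z : Ordinal.{u})) hdd)))
    · obtain ⟨δ, hδ, hxδ⟩ := hx.2.2
      refine ⟨δ, hδ, ?_⟩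
      rw [hN]
      ext z
      constructor
      · rintro ⟨⟨d, hd, rfl⟩, hz⟩
        obtain ⟨α, hα, hαd⟩ := Ordinal.mem_toZFSet_iff.1 hz
        have hαx : α ∈ x := by
          rw [hpx α hα, dif_pos (hmem hα)]
          obtain rfl : ⟨_, hmem hα⟩ = d := Subtype.ext hαd
          exact hd
        have : α ∈ Iio δ := hxδ ▸ ⟨hαx, hα⟩
        rw [← hαd]
        exact Ordinal.toZFSet_mem_toZFSet_iff.2 this
      · intro hz
        obtain ⟨α, hα, rfl⟩ := Ordinal.mem_toZFSet_iff.1 hz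
        have hαx : α ∈ x ∩ Iio κ.ord := hxδ ▸ (hα : α ∈ Iio δ)
        refine ⟨⟨⟨_, hmem hαx.2⟩, ?_, rfl⟩, Ordinal.toZFSet_mem_toZFSet_iff.2 hαx.2⟩
        have := (hpx α hαx.2).1 hαx.1
        rwa [dif_pos (hmem hαx.2)] at this
  -- The averaged relations. With this choice the atomic case of the theorem of Łoś holds by
  -- definition for the second-order variables.
  let Xs : (i : Fin φ.numVars) → Set (Fin (φ.arity i) → D) := fun i =>
    {a | ∀ᶠ x in 𝒰, ∃ a' : Fin (φ.arity i) → M x, (∀ j, (a' j : D) = a j) ∧ a' ∈ X x i}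
  let instD : (varLang φ.arity).Structure D := varStructure Xs
  have hMx : ∀ᶠ x in 𝒰, (M x : Set D) = {d | (e d : Ordinal) ∈ x} := by
    filter_upwards [hbad] with x hx
    exact (hMX x hx).1
  have hmM : ∀ d, ∀ᶠ x in 𝒰, d ∈ (M x : Set D) := by
    intro d
    filter_upwards [hMx, h2 _ (e d).2] with x hx hd
    rw [hx]
    exact hd
  have hlos := realize_iff_eventually_realize (L := L') (𝒰 := 𝒰) (m := fun x => (M x : Set D))
    (n := 0) hmM (by
      intro n f a
      refine .of_forall fun x a' ha => ?_
      rcases f with f | f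
      · have : a = fun i => (a' i : D) := funext fun i => (ha i).symm
        subst this
        rfl
      · exact nomatch f) (by
      intro n r a
      rcases r with r | r
      · have hr : ∀ x, ∀ a' : Fin n → M x, (∀ i, (a' i : D) = a i) →
            (RelMap r a' ↔ RelMap r a) := by
          intro x a' ha
          have : a = fun i => (a' i : D) := funext fun i => (ha i).symm
          subst this
          rfl
        constructor
        · intro ha
          filter_upwards [eventually_all.2 fun i => hmM (a i)] with x hx
          exact ⟨fun i => ⟨a i, hx i⟩, fun i => rfl, (hr x (fun i => ⟨a i, hx i⟩) fun i => rfl).2 ha⟩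
        · intro hx
          obtain ⟨x, a', ha, hra⟩ := hx.exists
          exact (hr x a' ha).1 hra
      · obtain ⟨i, rfl⟩ := r
        exact Iff.rfl) (by
      intro n θ a hx
      have hG : ∀ᶠ x in 𝒰, ∃ y : (M x : Set D), G ⟨n, θ, a⟩ x = e y ∧ 
          ∃ a' : Fin n → (M x : Set D), (∀ i, (a' i : D) = a i) ∧
          ¬ θ.Realize default (Fin.snoc a' y : Fin (n + 1) → (M x : Set D)) := by
        filter_upwards [hx] with x ⟨a', ha', y, hy⟩
        have hex : ∃ y : (M x : Set D), ∃ a' : Fin n → (M x : Set D), (∀ i, (a' i : D) = a i) ∧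
          ¬ θ.Realize default (Fin.snoc a' y : Fin (n + 1) → (M x : Set D)) := ⟨y, a', ha', hy⟩
        exact ⟨hex.choose, dif_pos hex, hex.choose_spec⟩
      obtain ⟨v, hv⟩ := hnG ⟨n, θ, a⟩ (by
        filter_upwards [hG, hMx] with x ⟨y, hy, _⟩ hx
        rw [hy]
        exact (Set.ext_iff.1 hx y).1 y.2)
      obtain ⟨x, hxv, ⟨d, hd⟩, hGx, _⟩ := (hv.and hG).exists
      refine ⟨d, ?_⟩
      filter_upwards [hv, hG] with x' hx'v ⟨y, hy, a', ha', hθ⟩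
      refine ⟨a', ha', y, ?_, hθ⟩
      refine e.injective (Subtype.ext ?_)
      rw [← hy, hx'v, ← hxv, hGx])
  have hψ : Sentence.Realize (L := L') D φ.matrix := hφ Xs
  have := (hlos φ.matrix default).1 hψ
  obtain ⟨x, hx, a', -, hxψ⟩ := (hbad.and this).exists
  refine (hMX x hx).2 ?_
  have hdef : a' = default := Subsingleton.elim _ _
  rw [hdef] at hxψ
  exact hxψ


/-! ### Structures for the language of set theory -/

theorem relMap_mem_iff {M : Type v} [setLang.Structure M] (x : Fin 2 → M) :
    RelMap (L := setLang) MemRel.mem x ↔ Mem (x 0) (x 1) := by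
  have : x = ![x 0, x 1] := by
    funext i
    fin_cases i <;> rfl
  conv_lhs => rw [this]
  exact Iff.rfl

/-- An injection that preserves membership in both directions is an embedding. -/
def memEmbedding {X : Type v} {Y : Type w} [setLang.Structure X] [setLang.Structure Y]
    (f : X → Y) (hf : Function.Injective f) (hmem : ∀ a b, Mem (f a) (f b) ↔ Mem a b) :
    X ↪[setLang] Y where
  toFun := f
  inj' := hf
  map_fun' g _ := nomatch g
  map_rel' := by
    intro n r x
    cases r
    rw [relMap_mem_iff, relMap_mem_iff]
    exact hmem _ _

/-- An injection that preserves membership and satisfies the Tarski-Vaught test is elementary. -/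
theorem realize_formula_of_tarskiVaught {X : Type v} {Y : Type w} [setLang.Structure X]
    [setLang.Structure Y] (f : X → Y) (hf : Function.Injective f)
    (hmem : ∀ a b, Mem (f a) (f b) ↔ Mem a b)
    (htv : ∀ (n : ℕ) (φ : setLang.BoundedFormula Empty (n + 1)) (x : Fin n → X) (a : Y),
      φ.Realize default (Fin.snoc (f ∘ x) a : Fin (n + 1) → Y) →
        ∃ b : X, φ.Realize default (Fin.snoc (f ∘ x) (f b) : Fin (n + 1) → Y))
    {n : ℕ} (φ : setLang.Formula (Fin n)) (x : Fin n → X) :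
    φ.Realize (f ∘ x) ↔ φ.Realize x :=
  (memEmbedding f hf hmem).isElementary_of_exists htv φ x

section Transitive

variable {M : ZFSet.{u}}

theorem isPair_iff (hM : M.IsTransitive) (p x y : M) :
    IsPair p x y ↔ (p : ZFSet) = ZFSet.pair x y := by
  have hset : ∀ {s : M} {P : ZFSet → Prop}, (∀ z : M, Mem z s ↔ P z) → (∀ z, P z → z ∈ M) →
      ∀ z, z ∈ (s : ZFSet) ↔ P z := by
    intro s P h hP z
    constructor
    · intro hz
      exact (h ⟨z, hM.subset_of_mem s.2 hz⟩).1 hz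
    · intro hz
      exact (h ⟨z, hP z hz⟩).2 hz
  constructor
  · rintro ⟨s, t, hs, ht, hp⟩
    have hs' : (s : ZFSet) = {(x : ZFSet)} := by
      ext z
      rw [ZFSet.mem_singleton]
      exact hset (P := fun z => z = x) (fun z => (hs z).trans Subtype.ext_iff)
        (fun z hz => hz ▸ x.2) z
    have ht' : (t : ZFSet) = {(x : ZFSet), (y : ZFSet)} := by
      ext z
      rw [ZFSet.mem_pair]
      exact hset (P := fun z => z = x ∨ z = y)
        (fun z => (ht z).trans (or_congr Subtype.ext_iff Subtype.ext_iff))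
        (fun z hz => hz.elim (fun hz => hz ▸ x.2) fun hz => hz ▸ y.2) z
    ext z
    rw [ZFSet.pair, ZFSet.mem_pair, ← hs', ← ht']
    exact hset (P := fun z => z = s ∨ z = t)
        (fun z => (hp z).trans (or_congr Subtype.ext_iff Subtype.ext_iff))
        (fun z hz => hz.elim (fun hz => hz ▸ s.2) fun hz => hz ▸ t.2) z
  · intro h
    have hs : ({(x : ZFSet)} : ZFSet) ∈ (p : ZFSet) := by
      rw [h, ZFSet.pair, ZFSet.mem_pair]
      exact Or.inl rfl
    have ht : ({(x : ZFSet), (y : ZFSet)} : ZFSet) ∈ (p : ZFSet) := by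
      rw [h, ZFSet.pair, ZFSet.mem_pair]
      exact Or.inr rfl
    refine ⟨⟨_, hM.subset_of_mem p.2 hs⟩, ⟨_, hM.subset_of_mem p.2 ht⟩, fun z => ?_, fun z => ?_,
      fun z => ?_⟩
    · rw [mem_iff, ZFSet.mem_singleton, Subtype.ext_iff]
    · rw [mem_iff, ZFSet.mem_pair, Subtype.ext_iff, Subtype.ext_iff]
    · have hp : ∀ w : ZFSet, w ∈ (p : ZFSet) ↔ w = {(x : ZFSet)} ∨ w = {(x : ZFSet), (y : ZFSet)} := by
        intro w
        rw [h, ZFSet.pair, ZFSet.mem_pair]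
      refine (hp z).trans (or_congr ?_ ?_) <;> exact ⟨fun h => Subtype.ext h, fun h => congrArg Subtype.val h⟩

theorem pairMem_iff (hM : M.IsTransitive) (r x y : M) :
    PairMem r x y ↔ ZFSet.pair x y ∈ (r : ZFSet) := by
  constructor
  · rintro ⟨p, hp, hpr⟩
    rw [isPair_iff hM] at hp
    rw [← hp]
    exact hpr
  · intro h
    exact ⟨⟨_, hM.subset_of_mem r.2 h⟩, (isPair_iff hM _ _ _).2 rfl, h⟩

end Transitive

/-! ### Closing a set under operations of small arity -/

/-- The closure is the image of the well-founded trees whose nodes are operations and whose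
branching is given by the arities. The bounds `θ ^ #(Ar o) ≤ θ` leave at most `θ` trees, so infinite
arities need no transfinite iteration. -/
theorem exists_closed_set {H : Type w} {θ : Cardinal.{w}} {O : Type w} (Ar : O → Type w)
    (hθ : ℵ₀ ≤ θ) (hO : #O ≤ θ) (hAr : ∀ o, θ ^ #(Ar o) ≤ θ) (R : ∀ o, (Ar o → H) → H → Prop)
    (hR : ∀ o v, ∃ y, R o v y) :
    ∃ S : Set H, #S ≤ θ ∧ ∀ o v, (∀ i, v i ∈ S) → ∃ y ∈ S, R o v y := by
  choose op hop using hR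
  let f : WType Ar → H := WType.elim H fun p => op p.1 p.2
  refine ⟨Set.range f, Cardinal.mk_range_le.trans (WType.cardinalMk_le_of_le ?_), ?_⟩
  · refine (Cardinal.sum_le_sum _ _ hAr).trans ?_
    rw [Cardinal.sum_const']
    exact (mul_le_mul' hO le_rfl).trans (Cardinal.mul_eq_self hθ).le
  · intro o v hv
    choose t ht using hv
    refine ⟨f ⟨o, t⟩, ⟨_, rfl⟩, ?_⟩
    have : f ⟨o, t⟩ = op o v := by
      have : (fun i => f (t i)) = v := funext ht
      rw [← this]
      rfl
    rw [this]
    exact hop o v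

/-! ### Sets of hereditary size at most `μ` -/

/-- The sets of hereditary size at most `μ`. -/
abbrev HSet (μ : Cardinal.{u}) : Type (u + 1) :=
  {x : ZFSet.{u} // x.Hereditarily fun y => y.card ≤ μ}

instance hsetStructure (μ : Cardinal.{u}) : setLang.Structure (HSet μ) where
  funMap f _ := nomatch f
  RelMap r x := match r, x with
    | MemRel.mem, x => (x 0 : ZFSet.{u}) ∈ (x 1 : ZFSet.{u})

theorem mem_hset_iff {μ : Cardinal.{u}} (x y : HSet μ) :
    Mem x y ↔ (x : ZFSet.{u}) ∈ (y : ZFSet.{u}) :=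
  Iff.rfl

theorem card_range_le_of_mk_le {μ : Cardinal.{u}} {α : Type (u + 1)} [Small.{u} α]
    (f : α → ZFSet.{u}) (h : #α ≤ Cardinal.lift.{u + 1} μ) : (ZFSet.range f).card ≤ μ := by
  have := ZFSet.lift_card_range_le (f := f)
  rw [← Cardinal.lift_le.{u + 1}]
  exact this.trans ((Cardinal.lift_id'.{u, u + 1} #α).le.trans h)

theorem HSet.mk_le {μ : Cardinal.{u}} (a : HSet μ) :
    #(a : ZFSet.{u}) ≤ Cardinal.lift.{u + 1} μ := by
  rw [ZFSet.cardinalMk_coe_sort]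
  exact Cardinal.lift_le.2 a.2.self

theorem HSet.exists_range {μ : Cardinal.{u}} {α : Type (u + 1)} [Small.{u} α]
    (f : α → HSet μ) (h : #α ≤ Cardinal.lift.{u + 1} μ) :
    ∃ y : HSet μ, ∀ z, z ∈ (y : ZFSet.{u}) ↔ ∃ i, (f i : ZFSet.{u}) = z := by
  refine ⟨⟨ZFSet.range fun i => (f i : ZFSet.{u}), ?_⟩, fun z => ZFSet.mem_range⟩
  rw [ZFSet.hereditarily_iff]
  refine ⟨card_range_le_of_mk_le _ h, ?_⟩
  intro y hy
  obtain ⟨i, rfl⟩ := ZFSet.mem_range.1 hy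
  exact (f i).2

theorem HSet.exists_sep {μ : Cardinal.{u}} (a : HSet μ) (P : ZFSet.{u} → Prop) :
    ∃ y : HSet μ, ∀ z, z ∈ (y : ZFSet.{u}) ↔ z ∈ (a : ZFSet.{u}) ∧ P z := by
  refine ⟨⟨ZFSet.sep P a, ?_⟩, fun z => ZFSet.mem_sep⟩
  rw [ZFSet.hereditarily_iff]
  refine ⟨(ZFSet.card_mono ZFSet.sep_subset).trans a.2.self, ?_⟩
  intro y hy
  exact a.2.mem (ZFSet.mem_sep.1 hy).1

theorem HSet.exists_sUnion {μ : Cardinal.{u}} (hμ : ℵ₀ ≤ μ) (a : HSet μ) :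
    ∃ y : HSet μ, (y : ZFSet.{u}) = ZFSet.sUnion a := by
  have hsig : #(Σ b : (a : ZFSet.{u}), (b : ZFSet.{u})) ≤ Cardinal.lift.{u + 1} μ := by
    rw [Cardinal.mk_sigma]
    refine (Cardinal.sum_le_sum _ (fun _ => Cardinal.lift.{u + 1} μ) ?_).trans ?_
    · intro b
      exact HSet.mk_le ⟨b, a.2.mem b.2⟩
    · rw [Cardinal.sum_const']
      exact (mul_le_mul' a.mk_le le_rfl).trans (Cardinal.mul_eq_self (by simpa using hμ)).le
  obtain ⟨y, hy⟩ := HSet.exists_range (fun p : Σ b : (a : ZFSet.{u}), (b : ZFSet.{u}) =>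
    (⟨p.2, (a.2.mem p.1.2).mem p.2.2⟩ : HSet μ)) hsig
  refine ⟨y, ?_⟩
  ext z
  rw [hy, ZFSet.mem_sUnion]
  constructor
  · rintro ⟨⟨b, c⟩, rfl⟩
    exact ⟨b, b.2, c.2⟩
  · rintro ⟨b, hb, hz⟩
    exact ⟨⟨⟨b, hb⟩, ⟨z, hz⟩⟩, rfl⟩

theorem HSet.exists_pair {μ : Cardinal.{u}} (hμ : ℵ₀ ≤ μ) (a b : HSet μ) :
    ∃ y : HSet μ, (y : ZFSet.{u}) = ZFSet.pair a b := by
  have key : ∀ c d : HSet μ, ∃ y : HSet μ, (y : ZFSet.{u}) = {(c : ZFSet.{u}), (d : ZFSet.{u})} := by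
    intro c d
    obtain ⟨y, hy⟩ := HSet.exists_range (μ := μ) (α := ULift.{u + 1} (Fin 2))
      (fun i => ![c, d] i.down) (by
        have : #(ULift.{u + 1} (Fin 2)) ≤ ℵ₀ := Cardinal.mk_le_aleph0
        exact this.trans (by simpa using hμ))
    refine ⟨y, ?_⟩
    ext z
    rw [hy, ZFSet.mem_pair]
    constructor
    · rintro ⟨⟨i⟩, rfl⟩
      fin_cases i
      · exact Or.inl rfl
      · exact Or.inr rfl
    · rintro (rfl | rfl)
      · exact ⟨⟨0⟩, rfl⟩
      · exact ⟨⟨1⟩, rfl⟩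
  obtain ⟨s, hs⟩ := key a a
  obtain ⟨t, ht⟩ := key a b
  obtain ⟨y, hy⟩ := key s t
  refine ⟨y, ?_⟩
  rw [hy, hs, ht, ZFSet.pair, ZFSet.pair_eq_singleton]

/-- Every set of hereditary size at most `μ` is well-ordered by such a set. -/
theorem HSet.exists_wellOrder {μ : Cardinal.{u}} (hμ : ℵ₀ ≤ μ) (a : HSet μ) :
    ∃ (y : HSet μ) (lt : ZFSet.{u} → ZFSet.{u} → Prop), IsWellOrder ZFSet.{u} lt ∧
      ∀ z, z ∈ (y : ZFSet.{u}) ↔ ∃ b ∈ (a : ZFSet.{u}), ∃ c ∈ (a : ZFSet.{u}), lt b c ∧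
        z = ZFSet.pair b c := by
  let lt : ZFSet.{u} → ZFSet.{u} → Prop := WellOrderingRel
  have hp : ∀ b c : (a : ZFSet.{u}), ∃ y : HSet μ, (y : ZFSet.{u}) = ZFSet.pair b c := fun b c =>
    HSet.exists_pair hμ ⟨b, a.2.mem b.2⟩ ⟨c, a.2.mem c.2⟩
  choose p hp using hp
  obtain ⟨y, hy⟩ := HSet.exists_range
    (fun q : {q : ↥(a : ZFSet.{u}) × ↥(a : ZFSet.{u}) // lt q.1 q.2} => p q.1.1 q.1.2) (by
      refine (Cardinal.mk_subtype_le _).trans ?_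
      rw [Cardinal.mk_prod, Cardinal.lift_id]
      exact (mul_le_mul' a.mk_le a.mk_le).trans (Cardinal.mul_eq_self (by simpa using hμ)).le)
  refine ⟨y, lt, inferInstanceAs (IsWellOrder _ WellOrderingRel), fun z => ?_⟩
  rw [hy]
  constructor
  · rintro ⟨⟨⟨b, c⟩, hbc⟩, rfl⟩
    exact ⟨b, b.2, c, c.2, hbc, hp b c⟩
  · rintro ⟨b, hb, c, hc, hbc, rfl⟩
    exact ⟨⟨⟨⟨b, hb⟩, ⟨c, hc⟩⟩, hbc⟩, hp _ _⟩

theorem HSet.toZFSet_mem {μ : Cardinal.{u}} {o : Ordinal.{u}} (ho : o ≤ μ.ord) :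
    o.toZFSet.Hereditarily fun y => y.card ≤ μ := by
  induction o using WellFoundedLT.induction with
  | ind o ih =>
    rw [ZFSet.hereditarily_iff]
    refine ⟨?_, ?_⟩
    · rw [Ordinal.card_toZFSet]
      simpa using Ordinal.card_le_card ho
    · intro y hy
      obtain ⟨a, ha, rfl⟩ := Ordinal.mem_toZFSet_iff.1 hy
      exact ih a ha (ha.le.trans ho)

/-- Turns transitivity into closure under `μ` many unary operations. -/
theorem HSet.exists_enumeration (μ : Cardinal.{u}) :
    ∃ s : HSet μ → Iio μ.ord → HSet μ, ∀ a b : HSet μ, Mem b a → ∃ ξ, s a ξ = b := by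
  have : ∀ a : HSet μ, ∃ f : Iio μ.ord → HSet μ, ∀ b : HSet μ, Mem b a → ∃ ξ, f ξ = b := by
    intro a
    by_cases ha : Nonempty (a : ZFSet.{u})
    · have hle : #(a : ZFSet.{u}) ≤ #(Iio μ.ord) := by
        rw [Cardinal.mk_Iio_ordinal]
        simpa using a.mk_le
      obtain ⟨e⟩ := hle
      let g : Iio μ.ord → (a : ZFSet.{u}) := Function.invFun e
      have hg : ∀ b, g (e b) = b := Function.leftInverse_invFun e.injective
      refine ⟨fun ξ => ⟨g ξ, a.2.mem (g ξ).2⟩, fun b hb => ⟨e ⟨b, hb⟩, ?_⟩⟩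
      exact Subtype.ext (congrArg (fun c : (a : ZFSet.{u}) => (c : ZFSet.{u})) (hg ⟨b, hb⟩))
    · exact ⟨fun _ => a, fun b hb => absurd ⟨⟨(b : ZFSet.{u}), hb⟩⟩ ha⟩
  choose s hs using this
  exact ⟨s, hs⟩


/-! ### Transitive models of ZFC⁻ of size `μ` -/

theorem lift_power_le {κ μ : Cardinal.{u}} (hμ : μ = μ ^< κ) {c : Cardinal.{u + 1}}
    (hc : c < Cardinal.lift.{u + 1} κ) :
    Cardinal.lift.{u + 1} μ ^ c ≤ Cardinal.lift.{u + 1} μ := by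
  obtain ⟨c', hcκ, hc'⟩ := Cardinal.lt_lift_iff.1 hc
  rw [← hc', ← Cardinal.lift_power, Cardinal.lift_le]
  calc μ ^ c' ≤ μ ^< κ := Cardinal.le_powerlt μ hcκ
    _ = μ := hμ.symm

instance : Countable setLang.Symbols := by
  have : IsEmpty (Σ l, setLang.Functions l) := ⟨fun x => nomatch x.2⟩
  have : Subsingleton (Σ l, setLang.Relations l) := ⟨by
    rintro ⟨_, ⟨⟩⟩ ⟨_, ⟨⟩⟩
    rfl⟩
  exact inferInstanceAs (Countable (_ ⊕ _))

instance (k : ℕ) : Countable (Σ n, setLang.BoundedFormula Empty (n + k)) := by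
  have hinj : Function.Injective (fun p : Σ n, setLang.BoundedFormula Empty (n + k) =>
      (⟨p.1 + k, p.2⟩ : Σ n, setLang.BoundedFormula Empty n)) := by
    rintro ⟨n, φ⟩ ⟨m, ψ⟩ h
    simp only [Sigma.mk.injEq, add_left_inj] at h
    obtain ⟨rfl, h⟩ := h
    exact Sigma.ext rfl h
  exact hinj.countable

/-- Finitary closure conditions: separation, collection, the Tarski-Vaught test, and finitely many
further conditions. -/
abbrev FinitaryOps : Type :=
  (Σ n : ℕ, setLang.Formula (Fin (n + 1))) ⊕ (Σ n : ℕ, setLang.Formula (Fin (n + 2))) ⊕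
    (Σ n : ℕ, setLang.BoundedFormula Empty (n + 1)) ⊕ Bool ⊕ Bool

/-- The number of arguments of a finitary closure condition. -/
def finitaryArity : FinitaryOps → ℕ
  | .inl p => p.1 + 1
  | .inr (.inl p) => p.1 + 1
  | .inr (.inr (.inl p)) => p.1
  | .inr (.inr (.inr (.inl _))) => 1
  | .inr (.inr (.inr (.inr _))) => 0

/-- What a finitary closure condition demands of the set `y`. -/
def FinitaryReq {μ : Cardinal.{u}} (A : HSet μ) :
    ∀ o : FinitaryOps, (Fin (finitaryArity o) → HSet μ) → HSet μ → Prop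
  | .inl p => fun v y => ∀ x, Mem x y ↔ Mem x (v (0 : Fin (p.1 + 1))) ∧
      p.2.Realize (Fin.cons x (Fin.tail v) : Fin (p.1 + 1) → HSet μ)
  | .inr (.inl p) => fun v y =>
      (∀ x, Mem x (v (0 : Fin (p.1 + 1))) →
        ∃ z, p.2.Realize (Fin.cons x (Fin.cons z (Fin.tail v)) : Fin (p.1 + 2) → HSet μ)) →
      ∀ x, Mem x (v (0 : Fin (p.1 + 1))) → ∃ z, Mem z y ∧
        p.2.Realize (Fin.cons x (Fin.cons z (Fin.tail v)) : Fin (p.1 + 2) → HSet μ)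
  | .inr (.inr (.inl p)) => fun v y =>
      (∃ z, p.2.Realize default (Fin.snoc v z : Fin (p.1 + 1) → HSet μ)) →
        p.2.Realize default (Fin.snoc v y : Fin (p.1 + 1) → HSet μ)
  | .inr (.inr (.inr (.inl true))) => fun v y => (y : ZFSet.{u}) = ZFSet.sUnion (v (0 : Fin 1) : HSet μ)
  | .inr (.inr (.inr (.inl false))) => fun v y =>
      ∃ lt : ZFSet.{u} → ZFSet.{u} → Prop, IsWellOrder ZFSet.{u} lt ∧
        ∀ z, z ∈ (y : ZFSet.{u}) ↔ ∃ b ∈ ((v (0 : Fin 1) : HSet μ) : ZFSet.{u}),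
          ∃ c ∈ ((v (0 : Fin 1) : HSet μ) : ZFSet.{u}), lt b c ∧ z = ZFSet.pair b c
  | .inr (.inr (.inr (.inr true))) => fun _ y => y = A
  | .inr (.inr (.inr (.inr false))) => fun _ y => (y : ZFSet.{u}) = μ.ord.toZFSet

theorem exists_finitaryReq {μ : Cardinal.{u}} (hμ : ℵ₀ ≤ μ) (A : HSet μ) (o : FinitaryOps)
    (v : Fin (finitaryArity o) → HSet μ) : ∃ y, FinitaryReq A o v y := by
  rcases o with p | p | p | (_ | _) | (_ | _)
  · obtain ⟨y, hy⟩ := (v (0 : Fin (p.1 + 1))).exists_sep fun z =>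
      ∃ h : z.Hereditarily fun y => y.card ≤ μ,
        p.2.Realize (Fin.cons ⟨z, h⟩ (Fin.tail v) : Fin (p.1 + 1) → HSet μ)
    refine ⟨y, fun x => (hy x).trans (and_congr_right fun _ => ?_)⟩
    exact ⟨fun ⟨_, h⟩ => h, fun h => ⟨x.2, h⟩⟩
  · let a : HSet μ := v (0 : Fin (p.1 + 1))
    have : Nonempty (HSet μ) := ⟨A⟩
    let f : ↥(a : ZFSet.{u}) → HSet μ := fun x => Classical.epsilon fun z : HSet μ =>
      p.2.Realize (Fin.cons ⟨x, a.2.mem x.2⟩ (Fin.cons z (Fin.tail v)) : Fin (p.1 + 2) → HSet μ)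
    obtain ⟨y, hy⟩ := HSet.exists_range f a.mk_le
    refine ⟨y, fun h x hx => ?_⟩
    exact ⟨f ⟨x, hx⟩, (hy _).2 ⟨_, rfl⟩, Classical.epsilon_spec (h x hx)⟩
  · by_cases h : ∃ z, p.2.Realize default (Fin.snoc v z : Fin (p.1 + 1) → HSet μ)
    · exact ⟨h.choose, fun _ => h.choose_spec⟩
    · exact ⟨A, fun h' => absurd h' h⟩
  · obtain ⟨y, h⟩ := (v (0 : Fin 1)).exists_wellOrder hμ
    exact ⟨y, h⟩
  · exact (v (0 : Fin 1)).exists_sUnion hμ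
  · exact ⟨⟨_, HSet.toZFSet_mem le_rfl⟩, rfl⟩
  · exact ⟨A, rfl⟩

/-- A set of size `μ` satisfying all the closure conditions used to build a model. -/
theorem exists_closed_hset {κ μ : Cardinal.{u}} (hκ : ℵ₀ < κ) (hκμ : κ ≤ μ) (hμ : μ = μ ^< κ)
    (A : HSet μ) :
    ∃ S : Set (HSet μ), #S ≤ Cardinal.lift.{u + 1} μ ∧
      (∀ a ∈ S, ∀ b, Mem b a → b ∈ S) ∧
      (∀ x : HSet μ, (∀ z, Mem z x → z ∈ S) → (x : ZFSet.{u}).card < κ → x ∈ S) ∧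
      ∀ o v, (∀ i, v i ∈ S) → ∃ y ∈ S, FinitaryReq A o v y := by
  have hμ0 : ℵ₀ ≤ μ := hκ.le.trans hκμ
  have hμ' : ℵ₀ ≤ Cardinal.lift.{u + 1} μ := by simpa using hμ0
  obtain ⟨s, hs⟩ := HSet.exists_enumeration μ
  -- An index `ξ < μ` takes the `ξ`-th element of a set and gives transitivity; an index `β < κ`
  -- collects a `β`-sequence into a set and gives closure under small subsets. The second kind is
  -- where `μ ^< κ = μ` is needed.
  let O := Iio μ.ord ⊕ (Iio κ.ord ⊕ ULift.{u + 1} FinitaryOps)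
  let Ar : O → Type (u + 1) := Sum.elim (fun _ => PUnit) (Sum.elim (fun β => Iio β.1)
    fun o => ULift (Fin (finitaryArity o.down)))
  let R : ∀ o : O, (Ar o → HSet μ) → HSet μ → Prop := fun o => match o with
    | .inl ξ => fun v y => y = s (v PUnit.unit) ξ
    | .inr (.inl β) => fun v y => ∀ z, z ∈ (y : ZFSet.{u}) ↔ ∃ i : Iio β.1, (v i : ZFSet.{u}) = z
    | .inr (.inr o) => fun v y => FinitaryReq A o.down (fun i => v ⟨i⟩) y
  obtain ⟨S, hS, hcl⟩ := exists_closed_set (θ := Cardinal.lift.{u + 1} μ) Ar hμ' (by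
      simp only [O, Cardinal.mk_sum, Cardinal.mk_Iio_ordinal, Cardinal.card_ord,
        Cardinal.lift_id, Cardinal.mk_uLift]
      have h1 : #FinitaryOps ≤ ℵ₀ := Cardinal.mk_le_aleph0
      have h2 : Cardinal.lift.{u + 1} #FinitaryOps ≤ Cardinal.lift.{u + 1} μ :=
        (Cardinal.lift_le.2 h1).trans (by simpa using hμ0)
      exact Cardinal.add_le_of_le hμ' le_rfl
        (Cardinal.add_le_of_le hμ' (Cardinal.lift_le.2 hκμ) h2)) (by
      intro o
      refine lift_power_le hμ ?_
      rcases o with ξ | β | o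
      · have : (1 : Cardinal.{u + 1}) < Cardinal.lift.{u + 1} κ :=
          one_lt_aleph0.trans (by simpa using hκ)
        simpa [Ar] using this
      · have : β.1.card < κ := Cardinal.lt_ord.1 β.2
        change #(Iio β.1) < _
        rwa [Cardinal.mk_Iio_ordinal, Cardinal.lift_lt]
      · refine lt_of_lt_of_le ?_ (by simpa using hκ.le : ℵ₀ ≤ Cardinal.lift.{u + 1} κ)
        exact Cardinal.mk_lt_aleph0_iff.2 (inferInstanceAs (Finite (ULift (Fin _))))) R (by
      intro o v
      rcases o with ξ | β | o
      · exact ⟨_, rfl⟩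
      · refine HSet.exists_range (fun i : Iio β.1 => v i) ?_
        rw [Cardinal.mk_Iio_ordinal, Cardinal.lift_le]
        exact (Cardinal.lt_ord.1 β.2).le.trans hκμ
      · exact exists_finitaryReq hμ0 A _ _)
  refine ⟨S, hS, ?_, ?_, ?_⟩
  · intro a ha b hb
    obtain ⟨ξ, rfl⟩ := hs a b hb
    obtain ⟨y, hy, rfl⟩ := hcl (.inl ξ) (fun _ => a) (fun _ => ha)
    exact hy
  · intro x hx hxκ
    have hβ : x.1.card.ord < κ.ord := by simpa using hxκ
    obtain ⟨e⟩ : Nonempty (Iio x.1.card.ord ≃ x.1) := by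
      rw [← Cardinal.eq, Cardinal.mk_Iio_ordinal, ZFSet.cardinalMk_coe_sort]
      simp
    obtain ⟨y, hy, hyx⟩ := hcl (.inr (.inl ⟨_, hβ⟩)) (fun i => ⟨e i, x.2.mem (e i).2⟩)
      (fun i => hx _ (e i).2)
    have : y = x := by
      refine Subtype.ext (ZFSet.ext fun z => (hyx z).trans ?_)
      constructor
      · rintro ⟨i, rfl⟩
        exact (e i).2
      · intro hz
        exact ⟨e.symm ⟨z, hz⟩, by simp⟩
    exact this ▸ hy
  · intro o v hv
    exact hcl (.inr (.inr ⟨o⟩)) (fun i => v i.down) (fun i => hv i.down)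


theorem small_of_mk_le {μ : Cardinal.{u}} {α : Type (u + 1)}
    (h : #α ≤ Cardinal.lift.{u + 1} μ) : Small.{u} α := by
  have h' : #α ≤ #(Iio μ.ord) := by simpa [Cardinal.mk_Iio_ordinal] using h
  obtain ⟨e⟩ := h'
  exact small_of_injective e.injective

/-- A transitive set that contains all its small subsets contains all its short sequences. -/
theorem closedUnderSequences_of_small_subset {κ : Cardinal.{u}} (hκ : ℵ₀ < κ) {M : ZFSet.{u}}
    (hM : M.IsTransitive) (hκM : ∀ β < κ.ord, β.toZFSet ∈ M)
    (hsm : ∀ x : ZFSet.{u}, (∀ z ∈ x, z ∈ M) → x.card < κ → x ∈ M) :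
    ClosedUnderSequences κ M := by
  have hpair2 : ∀ a ∈ M, ∀ b ∈ M, ({a, b} : ZFSet.{u}) ∈ M := by
    intro a ha b hb
    refine hsm _ ?_ ?_
    · intro z hz
      rcases ZFSet.mem_pair.1 hz with rfl | rfl
      · exact ha
      · exact hb
    · refine lt_of_le_of_lt (ZFSet.card_insert_le.trans ?_) hκ
      rw [ZFSet.card_singleton]
      exact (Cardinal.add_lt_aleph0 one_lt_aleph0 one_lt_aleph0).le
  have hpair : ∀ a ∈ M, ∀ b ∈ M, ZFSet.pair a b ∈ M := by
    intro a ha b hb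
    refine hpair2 _ ?_ _ (hpair2 a ha b hb)
    rw [← ZFSet.pair_eq_singleton]
    exact hpair2 a ha a ha
  intro β hβ f hf
  have hmem : ∀ z ∈ f, ∃ a ∈ β.toZFSet, ∃ b ∈ M, z = ZFSet.pair a b := fun z hz =>
    ZFSet.mem_prod.1 (hf.1 hz)
  refine hsm f ?_ ?_
  · intro z hz
    obtain ⟨a, ha, b, hb, rfl⟩ := hmem z hz
    exact hpair a (hM.subset_of_mem (hκM β hβ) ha) b hb
  · have hch : ∀ z : f, ∃ a : β.toZFSet, ∃ b, (z : ZFSet.{u}) = ZFSet.pair a b := by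
      rintro ⟨z, hz⟩
      obtain ⟨a, ha, b, hb, h⟩ := hmem z hz
      exact ⟨⟨a, ha⟩, b, h⟩
    choose g hg using hch
    have hinj : Function.Injective g := by
      intro z z' hzz
      obtain ⟨b, hb⟩ := hg z
      obtain ⟨b', hb'⟩ := hg z'
      have h1 : ZFSet.pair (g z) b ∈ f := hb ▸ z.2
      have h2 : ZFSet.pair (g z) b' ∈ f := by
        rw [hzz, ← hb']
        exact z'.2
      have := (hf.2 (g z) (g z).2).unique h1 h2
      exact Subtype.ext (by rw [hb, hb', hzz, this])
    have := Cardinal.mk_le_of_injective hinj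
    rw [ZFSet.cardinalMk_coe_sort, ZFSet.cardinalMk_coe_sort, Cardinal.lift_le,
      Ordinal.card_toZFSet] at this
    exact this.trans_lt (Cardinal.lt_ord.1 hβ)

/-- The model is a transitive elementary substructure of the sets of hereditary size at most `μ`.
Each closure condition puts into it the set demanded by an axiom, and elementarity shows that this
set is the right one in the sense of the model. -/
theorem exists_model {κ μ : Cardinal.{u}} (hκ : ℵ₀ < κ) (hκμ : κ ≤ μ) (hμ : μ = μ ^< κ)
    {A : ZFSet.{u}} (hA : A ⊆ μ.ord.toZFSet) :
    ∃ M : ZFSet.{u}, M.IsTransitive ∧ ModelsZFCMinus M ∧ ClosedUnderSequences κ M ∧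
      μ.ord.toZFSet ∈ M ∧ A ∈ M ∧ #M ≤ Cardinal.lift.{u + 1} μ ∧
      ∀ x : ZFSet.{u}, (∀ z ∈ x, z ∈ M) → x.card < κ → x ∈ M := by
  have hμ0 : ℵ₀ ≤ μ := hκ.le.trans hκμ
  have hAH : A.Hereditarily fun y => y.card ≤ μ := by
    rw [ZFSet.hereditarily_iff]
    refine ⟨(ZFSet.card_mono hA).trans (by simp), fun y hy => ?_⟩
    exact (HSet.toZFSet_mem le_rfl).mem (hA hy)
  obtain ⟨S, hS, htr, hsm, hfin⟩ := exists_closed_hset hκ hκμ hμ ⟨A, hAH⟩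
  have hsmall : Small.{u} S := small_of_mk_le hS
  let M : ZFSet.{u} := ZFSet.range fun s : S => (s : ZFSet.{u})
  have hMS : ∀ x, x ∈ M ↔ ∃ s ∈ S, (s : ZFSet.{u}) = x := by
    intro x
    rw [ZFSet.mem_range]
    exact ⟨fun ⟨s, hs⟩ => ⟨s, s.2, hs⟩, fun ⟨s, h, hs⟩ => ⟨⟨s, h⟩, hs⟩⟩
  choose i hi using fun x : M => (hMS x).1 x.2
  have hSM : ∀ s ∈ S, (s : ZFSet.{u}) ∈ M := fun s hs => (hMS s).2 ⟨s, hs, rfl⟩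
  have hiS : ∀ s (hs : s ∈ S), i ⟨s, hSM s hs⟩ = s := fun s hs => Subtype.ext (hi _).2
  have hM : M.IsTransitive := by
    intro x hx y hy
    obtain ⟨s, hs, rfl⟩ := (hMS x).1 hx
    exact hSM ⟨y, s.2.mem hy⟩ (htr s hs ⟨y, s.2.mem hy⟩ hy)
  have himem : ∀ x y : M, Mem (i x) (i y) ↔ Mem x y := by
    intro x y
    rw [mem_hset_iff, (hi x).2, (hi y).2, mem_iff]
  have hiinj : Function.Injective i := by
    intro x y hxy
    exact Subtype.ext (by rw [← (hi x).2, ← (hi y).2, hxy])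
  -- The instances of separation and collection were solved with truth in `HSet μ`; this converts
  -- them to truth in `M`.
  have helem : ∀ {n} (φ : setLang.Formula (Fin n)) (x : Fin n → M),
      φ.Realize (i ∘ x) ↔ φ.Realize x :=
    realize_formula_of_tarskiVaught i hiinj himem (by
      intro n φ x a ha
      obtain ⟨y, hy, hyφ⟩ := hfin (.inr (.inr (.inl ⟨n, φ⟩))) (i ∘ x) (fun k => (hi _).1)
      refine ⟨⟨y, hSM y hy⟩, ?_⟩
      rw [hiS y hy]
      exact hyφ ⟨a, ha⟩)
  have hsubM : ∀ x : ZFSet.{u}, (∀ z ∈ x, z ∈ M) → x.card < κ → x ∈ M := by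
    intro x hx hxκ
    have hxH : x.Hereditarily fun y => y.card ≤ μ := by
      rw [ZFSet.hereditarily_iff]
      refine ⟨hxκ.le.trans hκμ, fun y hy => ?_⟩
      obtain ⟨s, hs, rfl⟩ := (hMS y).1 (hx y hy)
      exact s.2
    refine hSM ⟨x, hxH⟩ (hsm _ ?_ hxκ)
    intro z hz
    obtain ⟨s, hs, hsz⟩ := (hMS z).1 (hx z hz)
    rwa [← Subtype.ext (a1 := s) (a2 := z) hsz]
  have hμM : μ.ord.toZFSet ∈ M := by
    obtain ⟨y, hy, hyμ⟩ := hfin (.inr (.inr (.inr (.inr false)))) Fin.elim0 (fun k => k.elim0)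
    exact (hMS _).2 ⟨y, hy, hyμ⟩
  have hAM : A ∈ M := by
    obtain ⟨y, hy, hyA⟩ := hfin (.inr (.inr (.inr (.inr true)))) Fin.elim0 (fun k => k.elim0)
    exact (hMS _).2 ⟨y, hy, congrArg Subtype.val hyA⟩
  have hordM : ∀ β < μ.ord, β.toZFSet ∈ M := fun β hβ =>
    hM.subset_of_mem hμM (Ordinal.toZFSet_mem_toZFSet_iff.2 hβ)
  have hcard : #M ≤ Cardinal.lift.{u + 1} μ := by
    refine (Cardinal.mk_le_of_injective (f := fun x : M => (⟨i x, (hi x).1⟩ : S)) ?_).trans hS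
    intro x y hxy
    exact hiinj (congrArg Subtype.val hxy)
  refine ⟨M, hM, ?_, closedUnderSequences_of_small_subset hκ hM
    (fun β hβ => hordM β (hβ.trans_le (by simpa using hκμ))) hsubM, hμM, hAM, hcard, hsubM⟩
  refine ⟨?_, ?_, ?_, ?_, ?_, ?_, ?_, ?_⟩
  · intro x y h
    refine Subtype.ext (ZFSet.ext fun z => ⟨fun hz => ?_, fun hz => ?_⟩)
    · exact (h ⟨z, hM.subset_of_mem x.2 hz⟩).1 hz
    · exact (h ⟨z, hM.subset_of_mem y.2 hz⟩).2 hz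
  · rintro a ⟨x, hx⟩
    obtain ⟨y, hy, hya⟩ := ZFSet.regularity (a : ZFSet.{u}) (by
      intro h0
      have : (x : ZFSet.{u}) ∈ (∅ : ZFSet.{u}) := h0 ▸ hx
      exact ZFSet.notMem_empty _ this)
    refine ⟨⟨y, hM.subset_of_mem a.2 hy⟩, hy, fun z hz hza => ?_⟩
    have : (z : ZFSet.{u}) ∈ (a : ZFSet.{u}) ∩ y := ZFSet.mem_inter.2 ⟨hza, hz⟩
    rw [hya] at this
    exact ZFSet.notMem_empty _ this
  · intro x y
    refine ⟨⟨{(x : ZFSet.{u}), (y : ZFSet.{u})}, hsubM _ ?_ ?_⟩, fun z => ?_⟩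
    · intro z hz
      rcases ZFSet.mem_pair.1 hz with rfl | rfl
      · exact x.2
      · exact y.2
    · refine lt_of_le_of_lt (ZFSet.card_insert_le.trans ?_) hκ
      rw [ZFSet.card_singleton]
      exact (Cardinal.add_lt_aleph0 one_lt_aleph0 one_lt_aleph0).le
    · rw [mem_iff, ZFSet.mem_pair, Subtype.ext_iff, Subtype.ext_iff]
  · intro a
    obtain ⟨y, hy, hya⟩ := hfin (.inr (.inr (.inr (.inl true)))) (fun _ => i a) (fun _ => (hi a).1)
    have hya : (y : ZFSet.{u}) = ZFSet.sUnion a := hya.trans (by rw [(hi a).2])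
    refine ⟨⟨y, hSM y hy⟩, fun z => ?_⟩
    rw [mem_iff]
    change (z : ZFSet.{u}) ∈ (y : ZFSet.{u}) ↔ _
    rw [hya, ZFSet.mem_sUnion]
    constructor
    · rintro ⟨w, hw, hz⟩
      exact ⟨⟨w, hM.subset_of_mem a.2 hw⟩, hw, hz⟩
    · rintro ⟨w, hw, hz⟩
      exact ⟨w, hw, hz⟩
  · have hω : Ordinal.omega0 < μ.ord := by
      rw [Cardinal.lt_ord]
      simpa using hκ.trans_le hκμ
    refine ⟨⟨Ordinal.omega0.toZFSet, hordM _ hω⟩, ⟨⟨∅, ?_⟩, ?_, ?_⟩, ?_⟩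
    · rw [← Ordinal.toZFSet_zero]
      exact hordM _ (Ordinal.omega0_pos.trans hω)
    · change (∅ : ZFSet.{u}) ∈ Ordinal.omega0.toZFSet
      rw [← Ordinal.toZFSet_zero]
      exact Ordinal.toZFSet_mem_toZFSet_iff.2 Ordinal.omega0_pos
    · exact fun z => ZFSet.notMem_empty _
    · rintro ⟨x, hxM⟩ hx
      obtain ⟨α, hα, rfl⟩ := Ordinal.mem_toZFSet_iff.1 hx
      have hα1 : α + 1 < Ordinal.omega0 := Ordinal.isSuccLimit_omega0.succ_lt hα
      refine ⟨⟨(α + 1).toZFSet, hordM _ (hα1.trans hω)⟩,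
        Ordinal.toZFSet_mem_toZFSet_iff.2 hα1, fun z => ?_⟩
      have : ∀ w : ZFSet.{u}, w ∈ (α + 1).toZFSet ↔ w ∈ α.toZFSet ∨ w = α.toZFSet := by
        intro w
        rw [Ordinal.toZFSet_add_one, ZFSet.mem_insert_iff, or_comm]
      exact (this z).trans (or_congr_right ⟨fun h => Subtype.ext h, fun h => congrArg Subtype.val h⟩)
  · intro n φ p a
    obtain ⟨y, hy, hyφ⟩ := hfin (.inl ⟨n, φ⟩) (Fin.cons (i a) (i ∘ p) : Fin (n + 1) → HSet μ)
      (fun k => by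
        refine Fin.cases ?_ (fun k => ?_) k
        · exact (hi a).1
        · exact (hi _).1)
    refine ⟨⟨y, hSM y hy⟩, fun x => ?_⟩
    have h1 := hyφ (i x)
    have h2 : (Fin.cons (i x) (Fin.tail (Fin.cons (i a) (i ∘ p) : Fin (n + 1) → HSet μ)) :
        Fin (n + 1) → HSet μ) = i ∘ (Fin.cons x p : Fin (n + 1) → M) := by
      rw [Fin.comp_cons, Fin.tail_cons]
    rw [← himem, hiS _ hy, ← helem, ← himem, ← h2]
    exact h1
  · intro n φ p a h
    obtain ⟨y, hy, hyφ⟩ := hfin (.inr (.inl ⟨n, φ⟩))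
      (Fin.cons (i a) (i ∘ p) : Fin (n + 1) → HSet μ)
      (fun k => by
        refine Fin.cases ?_ (fun k => ?_) k
        · exact (hi a).1
        · exact (hi _).1)
    have h2 : ∀ x z : M, (Fin.cons (i x) (Fin.cons (i z)
        (Fin.tail (Fin.cons (i a) (i ∘ p) : Fin (n + 1) → HSet μ))) :
        Fin (n + 2) → HSet μ) = i ∘ (Fin.cons x (Fin.cons z p) : Fin (n + 2) → M) := by
      intro x z
      rw [Fin.comp_cons, Fin.comp_cons, Fin.tail_cons]
    have hin : ∀ x : HSet μ, Mem x (i a) → ∃ x' : M, i x' = x ∧ Mem x' a := by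
      intro x hx
      have hxS := htr _ (hi a).1 x hx
      refine ⟨⟨x, hSM x hxS⟩, hiS x hxS, ?_⟩
      rw [← himem, hiS x hxS]
      exact hx
    have h3 := hyφ (by
      intro x hx
      obtain ⟨x, rfl, hxa⟩ := hin x hx
      obtain ⟨z, hz⟩ := h x hxa
      refine ⟨i z, ?_⟩
      rw [← helem, ← h2] at hz
      exact hz)
    refine ⟨⟨y, hSM y hy⟩, fun x hx => ?_⟩
    obtain ⟨z, hz, hzφ⟩ := h3 (i x) ((himem x a).2 hx)
    have hzS := htr _ hy z hz
    refine ⟨⟨z, hSM z hzS⟩, hz, ?_⟩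
    rw [← helem, ← h2, hiS z hzS]
    exact hzφ
  · intro a
    obtain ⟨y, hy, lt, hlt, hya⟩ := hfin (.inr (.inr (.inr (.inl false)))) (fun _ => i a)
      (fun _ => (hi a).1)
    have hyp : ∀ b c : M, Mem b a → Mem c a →
        (PairMem (⟨y, hSM y hy⟩ : M) b c ↔ lt b c) := by
      intro b c hb hc
      rw [pairMem_iff hM]
      refine (hya _).trans ?_
      constructor
      · rintro ⟨b', -, c', -, h, hp⟩
        obtain ⟨rfl, rfl⟩ := ZFSet.pair_inj.1 hp
        exact h
      · intro h
        rw [(hi a).2]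
        exact ⟨b, hb, c, hc, h, rfl⟩
    refine ⟨⟨y, hSM y hy⟩, ?_, ?_, ?_, ?_⟩
    · intro x hx
      rw [hyp x x hx hx]
      exact irrefl_of lt _
    · intro x z w hx hz hw
      rw [hyp _ _ hx hz, hyp _ _ hz hw, hyp _ _ hx hw]
      exact trans_of lt
    · intro x z hx hz
      rw [hyp _ _ hx hz, hyp _ _ hz hx, Subtype.ext_iff]
      exact trichotomous_of lt _ _
    · rintro b ⟨x, hx⟩ hba
      obtain ⟨m, hm, hmin⟩ := (IsWellFounded.wf (r := lt)).has_min
        {z | z ∈ (b : ZFSet.{u})} ⟨x, hx⟩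
      have hmM : m ∈ M := hM.subset_of_mem b.2 hm
      refine ⟨⟨m, hmM⟩, hm, fun z hz => ?_⟩
      rw [hyp _ _ (hba z hz) (hba ⟨m, hmM⟩ hm)]
      exact hmin z hz


/-! ### First-order properties -/

/-- The property `R` of `n`-tuples is expressed by a single first-order formula in all structures
for the language of set theory. -/
def IsFO (n : ℕ) (R : ∀ (M : Type w) [setLang.Structure M], (Fin n → M) → Prop) : Prop :=
  ∃ φ : setLang.Formula (Fin n), ∀ (M : Type w) [setLang.Structure M] (v : Fin n → M),
    φ.Realize v ↔ R M v

/-- The membership symbol, as a relation symbol of the language of set theory. -/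
def memRel : setLang.Relations 2 := MemRel.mem

namespace IsFO

variable {n : ℕ} {P Q : ∀ (M : Type w) [setLang.Structure M], (Fin n → M) → Prop}

theorem mem (i j : Fin n) : IsFO.{w} n fun _ _ v => Mem (v i) (v j) :=
  ⟨Relations.formula₂ memRel (Term.var i) (Term.var j), fun _ _ _ => Formula.realize_rel₂⟩

theorem eq (i j : Fin n) : IsFO.{w} n fun _ _ v => v i = v j :=
  ⟨Term.equal (Term.var i) (Term.var j), fun M _ v => by simp⟩

theorem not (hP : IsFO.{w} n P) : IsFO.{w} n fun M _ v => ¬ P M v := by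
  obtain ⟨φ, hφ⟩ := hP
  exact ⟨∼φ, fun M _ v => by rw [Formula.realize_not, hφ]⟩

theorem imp (hP : IsFO.{w} n P) (hQ : IsFO.{w} n Q) : IsFO.{w} n fun M _ v => P M v → Q M v := by
  obtain ⟨φ, hφ⟩ := hP
  obtain ⟨ψ, hψ⟩ := hQ
  exact ⟨φ.imp ψ, fun M _ v => by rw [Formula.realize_imp, hφ, hψ]⟩

theorem and (hP : IsFO.{w} n P) (hQ : IsFO.{w} n Q) : IsFO.{w} n fun M _ v => P M v ∧ Q M v := by
  obtain ⟨φ, hφ⟩ := hP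
  obtain ⟨ψ, hψ⟩ := hQ
  exact ⟨φ ⊓ ψ, fun M _ v => by rw [Formula.realize_inf, hφ, hψ]⟩

theorem or (hP : IsFO.{w} n P) (hQ : IsFO.{w} n Q) : IsFO.{w} n fun M _ v => P M v ∨ Q M v := by
  obtain ⟨φ, hφ⟩ := hP
  obtain ⟨ψ, hψ⟩ := hQ
  exact ⟨φ ⊔ ψ, fun M _ v => by rw [Formula.realize_sup, hφ, hψ]⟩

theorem iff (hP : IsFO.{w} n P) (hQ : IsFO.{w} n Q) : IsFO.{w} n fun M _ v => P M v ↔ Q M v := by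
  obtain ⟨φ, hφ⟩ := hP
  obtain ⟨ψ, hψ⟩ := hQ
  exact ⟨φ.iff ψ, fun M _ v => by rw [Formula.realize_iff, hφ, hψ]⟩

theorem ex {Q : ∀ (M : Type w) [setLang.Structure M], (Fin n → M) → M → Prop}
    (hQ : IsFO.{w} (n + 1) fun M _ v => Q M (Fin.tail v) (v 0)) :
    IsFO.{w} n fun M _ v => ∃ z, Q M v z := by
  obtain ⟨φ, hφ⟩ := hQ
  refine ⟨Formula.iExs (Fin 1) (Formula.relabel (Fin.cons (Sum.inr 0) Sum.inl :
    Fin (n + 1) → Fin n ⊕ Fin 1) φ), fun M _ v => ?_⟩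
  rw [Formula.realize_iExs]
  have key : ∀ i : Fin 1 → M, (Formula.relabel (Fin.cons (Sum.inr 0) Sum.inl :
      Fin (n + 1) → Fin n ⊕ Fin 1) φ).Realize (Sum.elim v i) ↔ Q M v (i 0) := by
    intro i
    rw [Formula.realize_relabel, hφ]
    rfl
  exact ⟨fun ⟨i, hi⟩ => ⟨i 0, (key i).1 hi⟩, fun ⟨z, hz⟩ => ⟨fun _ => z, (key _).2 hz⟩⟩

theorem all {Q : ∀ (M : Type w) [setLang.Structure M], (Fin n → M) → M → Prop}
    (hQ : IsFO.{w} (n + 1) fun M _ v => Q M (Fin.tail v) (v 0)) :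
    IsFO.{w} n fun M _ v => ∀ z, Q M v z := by
  obtain ⟨φ, hφ⟩ := (ex (Q := fun M _ v z => ¬ Q M v z) hQ.not).not
  exact ⟨φ, fun M _ v => (hφ M v).trans (by push Not; rfl)⟩

theorem forall_fin {k : ℕ} {Q : Fin k → ∀ (M : Type w) [setLang.Structure M], (Fin n → M) → Prop}
    (hQ : ∀ i, IsFO.{w} n (Q i)) : IsFO.{w} n fun M _ v => ∀ i, Q i M v := by
  choose φ hφ using hQ
  refine ⟨Formula.iInf φ, fun M _ v => ?_⟩
  rw [Formula.realize_iInf]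
  exact forall_congr' fun i => hφ i M v

theorem isPair (i j k : Fin n) : IsFO.{w} n fun _ _ v => IsPair (v i) (v j) (v k) := by
  refine ex (ex (and (all ?_) (and (all ?_) (all ?_))))
  · exact iff (mem _ _) (eq _ _)
  · exact iff (mem _ _) (or (eq _ _) (eq _ _))
  · exact iff (mem _ _) (or (eq _ _) (eq _ _))

theorem pairMem (i j k : Fin n) : IsFO.{w} n fun _ _ v => PairMem (v i) (v j) (v k) :=
  ex (and (isPair _ _ _) (mem _ _))

/-- The reason for demanding one formula for all structures: the same formula is read in `M` and in
`N`. -/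
theorem map_iff {R : ∀ (M : Type w) [setLang.Structure M], (Fin n → M) → Prop} (hR : IsFO.{w} n R)
    {M N : Type w} [setLang.Structure M] [setLang.Structure N] (j : M ↪ₑ[setLang] N)
    (v : Fin n → M) : R N (j ∘ v) ↔ R M v := by
  obtain ⟨φ, hφ⟩ := hR
  rw [← hφ, ← hφ]
  exact j.map_formula φ v

end IsFO

/-! ### Transitive collapse -/

theorem exists_transitive_collapse {S : Type w} [setLang.Structure S] [Small.{u} S]
    (hext : ∀ x y : S, (∀ z, Mem z x ↔ Mem z y) → x = y)
    (hwf : WellFounded (Mem : S → S → Prop)) :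
    ∃ (N : ZFSet.{u}) (π : S ≃ N), N.IsTransitive ∧ ∀ a b, Mem (π a) (π b) ↔ Mem a b := by
  let π : S → ZFSet.{u} := hwf.fix fun x ih =>
    ZFSet.range fun y : Shrink.{u} {y // Mem y x} => ih ((equivShrink _).symm y).1
      ((equivShrink _).symm y).2
  have hπ : ∀ x z, z ∈ π x ↔ ∃ y, Mem y x ∧ π y = z := by
    intro x z
    have : π x = ZFSet.range fun y : Shrink.{u} {y // Mem y x} => π ((equivShrink _).symm y).1 :=
      hwf.fix_eq _ x
    rw [this, ZFSet.mem_range]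
    constructor
    · rintro ⟨y, rfl⟩
      exact ⟨_, ((equivShrink _).symm y).2, rfl⟩
    · rintro ⟨y, hy, rfl⟩
      exact ⟨equivShrink _ ⟨y, hy⟩, by simp⟩
  have hinj : ∀ x y, π x = π y → x = y := by
    intro x
    induction x using hwf.induction with
    | _ x ih =>
      intro y hxy
      refine hext x y fun z => ⟨fun hz => ?_, fun hz => ?_⟩
      · obtain ⟨z', hz', hzz⟩ := (hπ y (π z)).1 (hxy ▸ (hπ x _).2 ⟨z, hz, rfl⟩)
        rwa [ih z hz z' hzz.symm]
      · obtain ⟨z', hz', hzz⟩ := (hπ x (π z)).1 (hxy ▸ (hπ y _).2 ⟨z, hz, rfl⟩)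
        rwa [← ih z' hz' z hzz]
  let N : ZFSet.{u} := ZFSet.range fun y : Shrink.{u} S => π ((equivShrink _).symm y)
  have hN : ∀ z, z ∈ N ↔ ∃ x, π x = z := by
    intro z
    rw [ZFSet.mem_range]
    exact ⟨fun ⟨y, hy⟩ => ⟨_, hy⟩, fun ⟨x, hx⟩ => ⟨equivShrink _ x, by simpa using hx⟩⟩
  refine ⟨N, Equiv.ofBijective (fun x => ⟨π x, (hN _).2 ⟨x, rfl⟩⟩) ⟨?_, ?_⟩, ?_, ?_⟩
  · intro x y hxy
    exact hinj x y (congrArg Subtype.val hxy)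
  · rintro ⟨z, hz⟩
    obtain ⟨x, rfl⟩ := (hN z).1 hz
    exact ⟨x, rfl⟩
  · intro z hz w hw
    obtain ⟨x, rfl⟩ := (hN z).1 hz
    obtain ⟨y, -, rfl⟩ := (hπ x w).1 hw
    exact (hN _).2 ⟨y, rfl⟩
  · intro a b
    refine (hπ b (π a)).trans ⟨?_, fun h => ⟨a, h, rfl⟩⟩
    rintro ⟨y, hy, hya⟩
    rwa [← hinj y a hya]

/-! ### Order types of sets of ordinals -/

/-- The order type of `x ∩ α`. -/
noncomputable def collapse (x : Set Ordinal.{u}) (α : Ordinal.{u}) : Ordinal.{u} :=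
  ⨆ β : {β : Iio α // β.1 ∈ x}, Order.succ (collapse x β.1.1)
termination_by α
decreasing_by exact β.1.2

theorem collapse_lt {x : Set Ordinal.{u}} {α β : Ordinal.{u}} (hβ : β ∈ x) (h : β < α) :
    collapse x β < collapse x α := by
  rw [collapse.eq_1 x α]
  refine (Order.lt_succ _).trans_le ?_
  exact Ordinal.le_iSup (fun β : {β : Iio α // β.1 ∈ x} => Order.succ (collapse x β.1.1))
    ⟨⟨β, h⟩, hβ⟩

theorem exists_of_lt_collapse {x : Set Ordinal.{u}} {α γ : Ordinal.{u}} (h : γ < collapse x α) :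
    ∃ β ∈ x, β < α ∧ collapse x β = γ := by
  induction α using WellFoundedLT.induction with
  | ind α ih =>
    rw [collapse.eq_1 x α, Ordinal.lt_iSup_iff] at h
    obtain ⟨⟨⟨β, hβα⟩, hβ⟩, h⟩ := h
    rcases (Order.lt_succ_iff.1 h).lt_or_eq with h | h
    · obtain ⟨δ, hδ, hδβ, h⟩ := ih β hβα h
      exact ⟨δ, hδ, hδβ.trans hβα, h⟩
    · exact ⟨β, hβ, hβα, h.symm⟩

theorem collapse_injOn (x : Set Ordinal.{u}) : InjOn (collapse x) x := by
  intro α hα β hβ h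
  rcases lt_trichotomy α β with hlt | rfl | hlt
  · exact absurd h (collapse_lt hα hlt).ne
  · rfl
  · exact absurd h (collapse_lt hβ hlt).ne'

theorem collapse_lt_iff {x : Set Ordinal.{u}} {α β : Ordinal.{u}} (hα : α ∈ x) (hβ : β ∈ x) :
    collapse x α < collapse x β ↔ α < β := by
  refine ⟨fun h => ?_, collapse_lt hα⟩
  by_contra! hle
  rcases hle.lt_or_eq with hlt | rfl
  · exact lt_asymm h (collapse_lt hβ hlt)
  · exact lt_irrefl _ h

theorem collapse_lt_ord {κ : Cardinal.{u}} {x : Set Ordinal.{u}}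
    (hx : #x < Cardinal.lift.{u + 1} κ) (α : Ordinal.{u}) : collapse x α < κ.ord := by
  choose f hf using fun γ : Iio (collapse x α) => exists_of_lt_collapse γ.2
  have hinj : Function.Injective (fun γ => (⟨f γ, (hf γ).1⟩ : x)) := by
    intro γ γ' h
    refine Subtype.ext ?_
    rw [← (hf γ).2.2, ← (hf γ').2.2]
    exact congrArg (fun z : x => collapse x z) h
  have := (Cardinal.mk_le_of_injective hinj).trans_lt hx
  rwa [Cardinal.mk_Iio_ordinal, Cardinal.lift_lt, ← Cardinal.lt_ord] at this


/-! ### Ultrapowers by a restricted family of functions -/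

theorem isFO_extensional :
    IsFO.{w} 0 fun M _ _ => ∀ x y : M, (∀ z, Mem z x ↔ Mem z y) → x = y := by
  refine IsFO.all (Q := fun M _ _ x => ∀ y : M, (∀ z, Mem z x ↔ Mem z y) → x = y) ?_
  refine IsFO.all (Q := fun M _ v y => (∀ z, Mem z (v 0) ↔ Mem z y) → v 0 = y) ?_
  exact .imp (.all (.iff (.mem _ _) (.mem _ _))) (.eq _ _)

/-- The transitive collapse of an ultrapower formed with a family of functions that is closed under
Skolem functions. -/
theorem exists_collapsed_ultrapower {I : Type (u + 1)} (𝒰 : Ultrafilter I) {M : Type (u + 1)}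
    [setLang.Structure M] [Nonempty M] (𝓕 : Set (I → M)) [Small.{u} 𝓕]
    (hext : ∀ x y : M, (∀ z, Mem z x ↔ Mem z y) → x = y)
    (hsk : ∀ (n : ℕ) (φ : setLang.BoundedFormula Empty (n + 1)) (v : Fin n → I → M),
      (∀ i, v i ∈ 𝓕) → ∃ y ∈ 𝓕, ∀ x,
        (∃ z, φ.Realize default (Fin.snoc (fun i => v i x) z : Fin (n + 1) → M)) →
          φ.Realize default (Fin.snoc (fun i => v i x) (y x) : Fin (n + 1) → M))
    (hwf : ∀ s : ℕ → I → M, (∀ n, s n ∈ 𝓕) → ¬ ∀ n, ∀ᶠ x in 𝒰, Mem (s (n + 1) x) (s n x)) :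
    ∃ (N : ZFSet.{u}) (p : 𝓕 → N), N.IsTransitive ∧ Function.Surjective p ∧
      ∀ (n : ℕ) (φ : setLang.Formula (Fin n)) (f : Fin n → 𝓕),
        φ.Realize (p ∘ f) ↔ ∀ᶠ x in 𝒰, φ.Realize fun k => (f k).1 x := by
  let V := (𝒰 : Filter I).Product (fun _ => M)
  let q : (I → M) → V := fun f => (f : (𝒰 : Filter I).Product (fun _ => M))
  let S := {a : V // ∃ f ∈ 𝓕, q f = a}
  let strS : setLang.Structure S :=
    { funMap := fun f _ => nomatch f
      RelMap := fun r x => RelMap (L := setLang) (M := V) r fun i => (x i).1 }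
  let r : 𝓕 → S := fun f => ⟨q f, f, f.2, rfl⟩
  have hr : Function.Surjective r := by
    rintro ⟨_, f, hf, rfl⟩
    exact ⟨⟨f, hf⟩, rfl⟩
  have hsmall : Small.{u} S := small_of_surjective hr
  have hval : ∀ a b : S, Mem a.1 b.1 ↔ Mem a b := by
    intro a b
    have : (fun i => (![a, b] i).1) = ![a.1, b.1] := by
      funext i
      fin_cases i <;> rfl
    change _ ↔ RelMap (L := setLang) (M := V) MemRel.mem (fun i => (![a, b] i).1)
    rw [this]
    rfl
  -- The classes of members of `𝓕` form an elementary substructure of the full ultrapower: given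
  -- representatives in `𝓕`, a Skolem function in `𝓕` satisfies the formula wherever any function
  -- does. Thus the theorem of Łoś survives the restriction to `𝓕`.
  have helem : ∀ {n : ℕ} (φ : setLang.Formula (Fin n)) (x : Fin n → S),
      φ.Realize (fun k => (x k).1) ↔ φ.Realize x :=
    realize_formula_of_tarskiVaught Subtype.val Subtype.val_injective hval (by
      intro n φ x a ha
      choose f hf hfx using fun k => (x k).2
      obtain ⟨g, rfl⟩ : ∃ g : I → M, q g = a := Quotient.exists_rep a
      obtain ⟨y, hy, hyx⟩ := hsk n φ f hf
      refine ⟨⟨q y, y, hy, rfl⟩, ?_⟩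
      have h1 : ∀ g : I → M, (Fin.snoc (Subtype.val ∘ x) (q g) : Fin (n + 1) → V) =
          fun i => q ((Fin.snoc f g : Fin (n + 1) → I → M) i) := by
        intro g
        funext i
        refine Fin.lastCases ?_ (fun i => ?_) i
        · simp only [Fin.snoc_last]
        · simp only [Fin.snoc_castSucc, Function.comp_apply, hfx]
      have h2 : ∀ (g : I → M) (x : I), (fun i => (Fin.snoc f g : Fin (n + 1) → I → M) i x) =
          (Fin.snoc (fun i => f i x) (g x) : Fin (n + 1) → M) := by
        intro g x
        funext i
        refine Fin.lastCases ?_ (fun i => ?_) i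
        · simp only [Fin.snoc_last]
        · simp only [Fin.snoc_castSucc]
      have h3 : ∀ g : I → M, φ.Realize default (Fin.snoc (Subtype.val ∘ x) (q g) :
          Fin (n + 1) → V) ↔ ∀ᶠ x in 𝒰, φ.Realize default
            (Fin.snoc (fun i => f i x) (g x) : Fin (n + 1) → M) := by
        intro g
        have := Ultraproduct.boundedFormula_realize_cast (u := 𝒰) (M := fun _ : I => M) φ default
          (Fin.snoc f g : Fin (n + 1) → I → M)
        refine Iff.trans (iff_of_eq ?_) (this.trans
          (eventually_congr (Eventually.of_forall fun x => iff_of_eq ?_)))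
        · exact congrArg₂ φ.Realize (Subsingleton.elim _ _) (h1 g)
        · exact congrArg₂ φ.Realize (Subsingleton.elim _ _) (h2 g x)
      rw [h3] at ha ⊢
      exact ha.mono fun x hx => hyx x ⟨_, hx⟩)
  have hlos : ∀ (n : ℕ) (φ : setLang.Formula (Fin n)) (f : Fin n → 𝓕),
      φ.Realize (r ∘ f) ↔ ∀ᶠ x in 𝒰, φ.Realize fun k => (f k).1 x := by
    intro n φ f
    rw [← helem]
    exact Ultraproduct.realize_formula_cast (u := 𝒰) (M := fun _ : I => M) φ fun k => (f k).1
  have hmem : ∀ f g : 𝓕, Mem (r f) (r g) ↔ ∀ᶠ x in 𝒰, Mem (f.1 x) (g.1 x) := by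
    intro f g
    obtain ⟨φ, hφ⟩ := IsFO.mem.{u + 1} (n := 2) 0 1
    have := hlos 2 φ ![f, g]
    simp only [hφ] at this
    exact this
  have hextS : ∀ x y : S, (∀ z, Mem z x ↔ Mem z y) → x = y := by
    obtain ⟨φ, hφ⟩ := isFO_extensional.{u + 1}
    refine (hφ S (r ∘ Fin.elim0)).1 ((hlos 0 φ Fin.elim0).2 (Eventually.of_forall fun x => ?_))
    exact (hφ M _).2 hext
  have hwfS : WellFounded (Mem : S → S → Prop) := by
    rw [wellFounded_iff_isEmpty_descending_chain]
    refine ⟨fun ⟨s, hs⟩ => ?_⟩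
    choose f hf using fun n => hr (s n)
    refine hwf (fun n => (f n).1) (fun n => (f n).2) fun n => ?_
    rw [← hmem, hf, hf]
    exact hs n
  obtain ⟨N, π, hN, hπ⟩ := exists_transitive_collapse.{u, u + 1} hextS hwfS
  refine ⟨N, π ∘ r, hN, π.surjective.comp hr, fun n φ f => ?_⟩
  rw [← hlos]
  exact realize_formula_of_tarskiVaught π π.injective hπ
    (fun n φ x a ha => ⟨π.symm a, by simpa using ha⟩) φ (r ∘ f)


/-- A family of `μ` many functions closed under Skolem functions. -/
theorem exists_skolem_closed_family {μ : Cardinal.{u}} (hμ : ℵ₀ ≤ μ) {I M G : Type (u + 1)}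
    [setLang.Structure M] [Nonempty M] (hG : #G ≤ Cardinal.lift.{u + 1} μ) (g : G → I → M) :
    ∃ 𝓕 : Set (I → M), #𝓕 ≤ Cardinal.lift.{u + 1} μ ∧ (∀ i, g i ∈ 𝓕) ∧
      ∀ (n : ℕ) (φ : setLang.BoundedFormula Empty (n + 1)) (v : Fin n → I → M),
      (∀ i, v i ∈ 𝓕) → ∃ y ∈ 𝓕, ∀ x,
        (∃ z, φ.Realize default (Fin.snoc (fun i => v i x) z : Fin (n + 1) → M)) →
          φ.Realize default (Fin.snoc (fun i => v i x) (y x) : Fin (n + 1) → M) := by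
  have hμ' : ℵ₀ ≤ Cardinal.lift.{u + 1} μ := by simpa using hμ
  let O := G ⊕ ULift.{u + 1} (Σ n, setLang.BoundedFormula Empty (n + 1))
  let Ar : O → Type (u + 1) := Sum.elim (fun _ => PEmpty) fun o => ULift (Fin o.down.1)
  let R : ∀ o : O, (Ar o → I → M) → (I → M) → Prop := fun o => match o with
    | .inl i => fun _ y => y = g i
    | .inr o => fun v y => ∀ x,
        (∃ z, o.down.2.Realize default
          (Fin.snoc (fun i => v ⟨i⟩ x) z : Fin (o.down.1 + 1) → M)) →
        o.down.2.Realize default (Fin.snoc (fun i => v ⟨i⟩ x) (y x) : Fin (o.down.1 + 1) → M)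
  obtain ⟨𝓕, h𝓕, hcl⟩ := exists_closed_set (θ := Cardinal.lift.{u + 1} μ) Ar hμ' (by
      simp only [O, Cardinal.mk_sum, Cardinal.lift_id, Cardinal.mk_uLift]
      have h1 : #(Σ n, setLang.BoundedFormula Empty (n + 1)) ≤ ℵ₀ := Cardinal.mk_le_aleph0
      exact Cardinal.add_le_of_le hμ' hG
        ((Cardinal.lift_le.2 h1).trans (by simpa using hμ))) (by
      rintro (i | o)
      · simp only [Ar, Sum.elim_inl, Cardinal.mk_pempty, Cardinal.power_zero]
        exact one_le_aleph0.trans hμ'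
      · refine Cardinal.pow_le hμ' ?_
        exact Cardinal.mk_lt_aleph0_iff.2 (inferInstanceAs (Finite (ULift (Fin _))))) R (by
      rintro (i | o) v
      · exact ⟨_, rfl⟩
      · exact ⟨fun x => Classical.epsilon fun z => o.down.2.Realize default
          (Fin.snoc (fun i => v ⟨i⟩ x) z : Fin (o.down.1 + 1) → M),
          fun x hx => Classical.epsilon_spec hx⟩)
  refine ⟨𝓕, h𝓕, fun i => ?_, fun n φ v hv => ?_⟩
  · obtain ⟨y, hy, rfl⟩ := hcl (.inl i) (fun k => k.elim) (fun k => k.elim)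
    exact hy
  · exact hcl (.inr ⟨⟨n, φ⟩⟩) (fun k => v k.down) (fun k => hv k.down)

/-! ### Normal fine ultrafilters yield near supercompactness -/

/-- The von Neumann counterpart of a set of ordinals below `μ`. -/
noncomputable def ordSet (μ : Cardinal.{u}) (x : Set Ordinal.{u}) : ZFSet.{u} :=
  ZFSet.sep (fun z => ∃ α ∈ x, α.toZFSet = z) μ.ord.toZFSet

theorem mem_ordSet_iff {μ : Cardinal.{u}} {x : Set Ordinal.{u}} (hx : x ⊆ Iio μ.ord)
    {z : ZFSet.{u}} : z ∈ ordSet μ x ↔ ∃ α ∈ x, α.toZFSet = z := by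
  rw [ordSet, ZFSet.mem_sep]
  refine ⟨fun h => h.2, fun h => ⟨?_, h⟩⟩
  obtain ⟨α, hα, rfl⟩ := h
  exact Ordinal.toZFSet_mem_toZFSet_iff.2 (hx hα)

theorem toZFSet_mem_ordSet_iff {μ : Cardinal.{u}} {x : Set Ordinal.{u}} (hx : x ⊆ Iio μ.ord)
    {α : Ordinal.{u}} : α.toZFSet ∈ ordSet μ x ↔ α ∈ x := by
  rw [mem_ordSet_iff hx]
  refine ⟨?_, fun h => ⟨α, h, rfl⟩⟩
  rintro ⟨β, hβ, h⟩
  rwa [← Ordinal.toZFSet_injective h]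

theorem lift_card_ordSet {μ : Cardinal.{u}} {x : Set Ordinal.{u}} (hx : x ⊆ Iio μ.ord) :
    Cardinal.lift.{u + 1} (ordSet μ x).card = #x := by
  rw [← ZFSet.cardinalMk_coe_sort]
  refine (Cardinal.mk_congr (Equiv.ofBijective (fun α : x =>
    (⟨α.1.toZFSet, (toZFSet_mem_ordSet_iff hx).2 α.2⟩ : ordSet μ x)) ⟨?_, ?_⟩)).symm
  · intro α β h
    exact Subtype.ext (Ordinal.toZFSet_injective (congrArg Subtype.val h))
  · rintro ⟨z, hz⟩
    obtain ⟨α, hα, rfl⟩ := (mem_ordSet_iff hx).1 hz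
    exact ⟨⟨α, hα⟩, rfl⟩

/-- The embedding sends `a` to the class of the constant function. The family `𝓕` has only `μ`
members, so normality can be arranged for all functions that matter, and the identity then
represents `j '' μ`. -/
theorem HasNormalUltrafilters.isNearlySupercompact {κ μ : Cardinal.{u}}
    (h : HasNormalUltrafilters κ μ) (hμ0 : ℵ₀ ≤ μ) (hκμ : κ ≤ μ) (hμ : μ = μ ^< κ) :
    IsNearlySupercompact κ μ := by
  classical
  intro A hA
  have hκ : ℵ₀ < κ := h.aleph0_lt hμ0
  have hμ' : ℵ₀ ≤ Cardinal.lift.{u + 1} μ := by simpa using hμ0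
  have hκμ' : κ.ord ≤ μ.ord := by simpa using hκμ
  obtain ⟨M, hM, hMZ, hMcl, hμM, hAM, hMcard, hsub⟩ := exists_model hκ hκμ hμ hA
  have hord : ∀ α ≤ μ.ord, α.toZFSet ∈ M := by
    intro α hα
    rcases hα.lt_or_eq with hα | rfl
    · exact hM.subset_of_mem hμM (Ordinal.toZFSet_mem_toZFSet_iff.2 hα)
    · exact hμM
  have hne : Nonempty M := ⟨⟨A, hAM⟩⟩
  -- The identity and the functions `x ↦ otp (x ∩ α)`, with values in `M`. On small `x` both values
  -- do lie in `M`, so the default `A` occurs only on a null set.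
  let hat : Set Ordinal.{u} → M := fun x => if hx : ordSet μ x ∈ M then ⟨_, hx⟩ else ⟨A, hAM⟩
  let o : Ordinal.{u} → Set Ordinal.{u} → M := fun α x =>
    if hx : (collapse x α).toZFSet ∈ M then ⟨_, hx⟩ else ⟨A, hAM⟩
  have hhat : ∀ x, IsSmallSubset κ μ x → (hat x : ZFSet.{u}) = ordSet μ x := by
    intro x hx
    have : ordSet μ x ∈ M := by
      refine hsub _ ?_ ?_
      · intro z hz
        obtain ⟨α, hα, rfl⟩ := (mem_ordSet_iff hx.1).1 hz
        exact hord α (le_of_lt (hx.1 hα))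
      · rw [← Cardinal.lift_lt.{u, u + 1}, lift_card_ordSet hx.1]
        exact hx.2.1
    simp only [hat, dif_pos this]
  have ho : ∀ α x, IsSmallSubset κ μ x → (o α x : ZFSet.{u}) = (collapse x α).toZFSet := by
    intro α x hx
    have : (collapse x α).toZFSet ∈ M := hord _ ((collapse_lt_ord hx.2.1 α).le.trans hκμ')
    simp only [o, dif_pos this]
  obtain ⟨𝓕, h𝓕, hgen, hsk⟩ := exists_skolem_closed_family (I := Set Ordinal.{u}) (M := M)
    (G := M ⊕ PUnit.{u + 2} ⊕ Iio (Order.succ μ.ord)) hμ0 (by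
      simp only [Cardinal.mk_sum, Cardinal.lift_id, Cardinal.mk_punit, Cardinal.mk_Iio_ordinal]
      refine Cardinal.add_le_of_le hμ' hMcard (Cardinal.add_le_of_le hμ'
        (one_le_aleph0.trans hμ') (Cardinal.lift_le.2 ?_))
      rw [Order.succ_eq_add_one, Ordinal.card_add_one, Cardinal.card_ord, Cardinal.add_one_eq hμ0])
    (Sum.elim (fun a _ => a) (Sum.elim (fun _ => hat) fun α => o α.1))
  have hconst : ∀ a : M, (fun _ => a) ∈ 𝓕 := fun a => hgen (.inl a)
  have hhat𝓕 : hat ∈ 𝓕 := hgen (.inr (.inl PUnit.unit))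
  have ho𝓕 : ∀ α ≤ μ.ord, o α ∈ 𝓕 := fun α hα =>
    hgen (.inr (.inr ⟨α, Order.lt_succ_iff.2 hα⟩))
  have h𝓕small : Small.{u} 𝓕 := small_of_mk_le h𝓕
  -- Three kinds of functions are made constant. Ranks identify ordinals represented below the
  -- identity; the least `β ∈ x` of given order type identifies ordinals below `otp (x ∩ α)`; the
  -- first place where a sequence of functions stops descending yields well-foundedness. There are
  -- at most `μ` sequences since `ℵ₀ < κ` and `μ ^< κ = μ`.
  obtain ⟨𝒰, h1, h2, h3⟩ := h.exists_of_family (ι := 𝓕 ⊕ 𝓕 ⊕ (ULift.{u + 1} ℕ → 𝓕)) (by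
      simp only [Cardinal.mk_sum, Cardinal.lift_id]
      refine Cardinal.add_le_of_le hμ' h𝓕 (Cardinal.add_le_of_le hμ' h𝓕 ?_)
      rw [← Cardinal.power_def]
      refine (Cardinal.power_le_power_right h𝓕).trans (lift_power_le hμ ?_)
      simpa using hκ)
    (Sum.elim (fun f x => ZFSet.rank (f.1 x : ZFSet.{u}))
      (Sum.elim (fun f x => sInf {β | β ∈ x ∧ (collapse x β).toZFSet = (f.1 x : ZFSet.{u})})
        fun s x => ((sInf {n : ℕ | ¬ Mem ((s ⟨n + 1⟩).1 x) ((s ⟨n⟩).1 x)} : ℕ) : Ordinal.{u})))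
  have hfine : IsFine κ μ 𝒰 := ⟨h1, h2⟩
  obtain ⟨N, p, hN, hp, hlos⟩ := exists_collapsed_ultrapower.{u} 𝒰 (M := M) 𝓕 hMZ.extensionality
    hsk (by
      intro s hs hcon
      have hdesc : ∀ x, ∃ n : ℕ, ¬ Mem (s (n + 1) x) (s n x) := by
        intro x
        by_contra! hx
        have := wellFounded_iff_isEmpty_descending_chain.1 ZFSet.mem_wf.{u}
        exact this.false ⟨fun n => s n x, hx⟩
      obtain ⟨v, -, hv⟩ := h3 (.inr (.inr fun n => ⟨s n.down, hs _⟩)) (by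
        filter_upwards [hfine.Iio_subset hκμ (γ := Ordinal.omega0) (by
          rw [Cardinal.lt_ord]
          simpa using hκ)] with x hx
        exact hx (Ordinal.natCast_lt_omega0 _))
      obtain ⟨x₀, hx₀⟩ := hv.exists
      obtain ⟨x, hx, hx'⟩ := (hv.and (hcon (sInf {n : ℕ | ¬ Mem (s (n + 1) x₀) (s n x₀)}))).exists
      have h4 : sInf {n : ℕ | ¬ Mem (s (n + 1) x) (s n x)} ∈
          {n : ℕ | ¬ Mem (s (n + 1) x) (s n x)} := Nat.sInf_mem (hdesc x)
      have h5 := hx.trans hx₀.symm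
      simp only [Sum.elim_inr, Nat.cast_inj] at h5
      rw [h5] at h4
      exact h4 hx')
  have hmem : ∀ f g : 𝓕, (p f : ZFSet.{u}) ∈ (p g : ZFSet.{u}) ↔
      ∀ᶠ x in 𝒰, (f.1 x : ZFSet.{u}) ∈ (g.1 x : ZFSet.{u}) := by
    intro f g
    obtain ⟨φ, hφ⟩ := IsFO.mem.{u + 1} (n := 2) 0 1
    have := hlos 2 φ ![f, g]
    simp only [hφ] at this
    exact this
  have heq : ∀ f g : 𝓕, (∀ᶠ x in 𝒰, f.1 x = g.1 x) → p f = p g := by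
    intro f g
    obtain ⟨φ, hφ⟩ := IsFO.eq.{u + 1} (n := 2) 0 1
    have := hlos 2 φ ![f, g]
    simp only [hφ] at this
    exact this.2
  have hmem' : ∀ (f : 𝓕) (z : ZFSet.{u}), z ∈ (p f : ZFSet.{u}) ↔
      ∃ g : 𝓕, (p g : ZFSet.{u}) = z ∧ ∀ᶠ x in 𝒰, (g.1 x : ZFSet.{u}) ∈ (f.1 x : ZFSet.{u}) := by
    intro f z
    constructor
    · intro hz
      obtain ⟨g, hg⟩ := hp ⟨z, hN.subset_of_mem (p f).2 hz⟩
      have hg' : (p g : ZFSet.{u}) = z := congrArg Subtype.val hg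
      exact ⟨g, hg', (hmem _ _).1 (hg' ▸ hz)⟩
    · rintro ⟨g, rfl, hg⟩
      exact (hmem _ _).2 hg
  let j : M ↪ₑ[setLang] N :=
    { toFun := fun a => p ⟨fun _ => a, hconst a⟩
      map_formula' := by
        intro n φ x
        refine (hlos n φ fun k => ⟨fun _ => x k, hconst _⟩).trans ?_
        simp }
  -- Normality as it is used: a function choosing an ordinal from `y x ⊆ x` represents some `j v`.
  -- The constant `y` with value `Iio α` gives that `j` fixes `α < κ`, and `y = id` computes `j ''
  -- μ`.
  have hrank : ∀ f : 𝓕, ∀ y : Set Ordinal.{u} → Set Ordinal.{u}, (∀ᶠ x in 𝒰, y x ⊆ x) →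
      (∀ᶠ x in 𝒰, ∃ α ∈ y x, α.toZFSet = (f.1 x : ZFSet.{u})) →
      ∃ v, ∃ hv : v < μ.ord, (p f = j ⟨v.toZFSet, hord v hv.le⟩) ∧ ∀ᶠ x in 𝒰, v ∈ y x := by
    intro f y hy hf
    obtain ⟨v, hv, hv'⟩ := h3 (.inl f) (by
      filter_upwards [hy, hf] with x hx ⟨α, hα, hfα⟩
      rw [Sum.elim_inl, ← hfα, Ordinal.rank_toZFSet]
      exact hx hα)
    refine ⟨v, hv, heq _ _ ?_, ?_⟩
    · filter_upwards [hf, hv'] with x ⟨α, hα, hfα⟩ hx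
      rw [Sum.elim_inl, ← hfα, Ordinal.rank_toZFSet] at hx
      exact Subtype.ext (by rw [← hfα, hx])
    · filter_upwards [hf, hv'] with x ⟨α, hα, hfα⟩ hx
      rw [Sum.elim_inl, ← hfα, Ordinal.rank_toZFSet] at hx
      exact hx ▸ hα
  have hcrit : ∀ α (hα : α < κ.ord),
      (j ⟨α.toZFSet, hord α (hα.le.trans hκμ')⟩ : ZFSet.{u}) = α.toZFSet := by
    intro α
    induction α using WellFoundedLT.induction with
    | ind α ih =>
      intro hα
      ext z
      refine (hmem' _ z).trans ?_
      rw [Ordinal.mem_toZFSet_iff]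
      constructor
      · rintro ⟨g, rfl, hg⟩
        obtain ⟨v, hv, hgv, hvα⟩ := hrank g (fun _ => Iio α) (hfine.Iio_subset hκμ hα) (by
          filter_upwards [hg] with x hx
          exact Ordinal.mem_toZFSet_iff.1 hx)
        obtain ⟨-, hvα⟩ := hvα.exists
        exact ⟨v, hvα, by rw [hgv, ih v hvα (lt_trans hvα hα)]⟩
      · rintro ⟨β, hβ, rfl⟩
        refine ⟨⟨fun _ => ⟨β.toZFSet, hord β ((hβ.trans hα).le.trans hκμ')⟩, hconst _⟩,
          ih β hβ (hβ.trans hα), Eventually.of_forall fun _ => ?_⟩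
        exact Ordinal.toZFSet_mem_toZFSet_iff.2 hβ
  -- By induction, `x ↦ otp (x ∩ α)` represents `α`. Anything below it is almost everywhere `otp (x
  -- ∩ β)` with `β ∈ x` and `β < α`; as a function of `x` this `β` is regressive, hence constant.
  have hdiag : ∀ α (hα : α ≤ μ.ord), (p ⟨o α, ho𝓕 α hα⟩ : ZFSet.{u}) = α.toZFSet := by
    intro α
    induction α using WellFoundedLT.induction with
    | ind α ih =>
      intro hα
      ext z
      refine (hmem' _ z).trans ?_
      rw [Ordinal.mem_toZFSet_iff]
      constructor
      · rintro ⟨g, rfl, hg⟩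
        have hg' : ∀ᶠ x in 𝒰, ∃ β, β ∈ x ∧ β < α ∧ (collapse x β).toZFSet = (g.1 x : ZFSet.{u}) := by
          filter_upwards [hg, h1] with x hx hxs
          rw [ho α x hxs, Ordinal.mem_toZFSet_iff] at hx
          obtain ⟨γ, hγ, hgγ⟩ := hx
          obtain ⟨β, hβ, hβα, rfl⟩ := exists_of_lt_collapse hγ
          exact ⟨β, hβ, hβα, hgγ⟩
        have hinf : ∀ᶠ x in 𝒰, sInf {β | β ∈ x ∧ (collapse x β).toZFSet = (g.1 x : ZFSet.{u})} ∈
            {β | β ∈ x ∧ (collapse x β).toZFSet = (g.1 x : ZFSet.{u})} := by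
          filter_upwards [hg'] with x ⟨β, hβ, _, hβg⟩
          exact csInf_mem (s := {β | β ∈ x ∧ (collapse x β).toZFSet = (g.1 x : ZFSet.{u})})
            ⟨β, hβ, hβg⟩
        obtain ⟨v, hv, hvx⟩ := h3 (.inr (.inl g)) (by
          filter_upwards [hinf] with x hx
          exact hx.1)
        have hvα : v < α := by
          obtain ⟨x, ⟨β, hβ, hβα, hβg⟩, hx, hvx⟩ := (hg'.and (hinf.and hvx)).exists
          have hvx' : sInf {β | β ∈ x ∧ (collapse x β).toZFSet = (g.1 x : ZFSet.{u})} = v := hvx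
          rw [hvx'] at hx
          rwa [collapse_injOn x hx.1 hβ (Ordinal.toZFSet_injective (hx.2.trans hβg.symm))]
        refine ⟨v, hvα, ?_⟩
        rw [← ih v hvα hv.le]
        refine congrArg Subtype.val (heq _ _ ?_)
        filter_upwards [hinf, hvx, h1] with x hx hvx hxs
        have hvx' : sInf {β | β ∈ x ∧ (collapse x β).toZFSet = (g.1 x : ZFSet.{u})} = v := hvx
        rw [hvx'] at hx
        exact Subtype.ext ((ho v x hxs).trans hx.2)
      · rintro ⟨β, hβ, rfl⟩
        refine ⟨⟨o β, ho𝓕 β (hβ.le.trans hα)⟩, ih β hβ (hβ.le.trans hα), ?_⟩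
        filter_upwards [h1, h2 β (hβ.trans_le hα)] with x hx hβx
        rw [ho _ x hx, ho _ x hx, Ordinal.toZFSet_mem_toZFSet_iff]
        exact collapse_lt hβx hβ
  -- Small sets have order type below `κ`, and `x ↦ otp (x ∩ μ)` represents `μ`.
  have hμκ : μ.ord.toZFSet ∈ (j ⟨κ.ord.toZFSet, hord _ hκμ'⟩ : ZFSet.{u}) := by
    refine (hmem' _ _).2 ⟨⟨o μ.ord, ho𝓕 _ le_rfl⟩, hdiag _ le_rfl, ?_⟩
    filter_upwards [h1] with x hx
    rw [ho _ x hx]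
    exact Ordinal.toZFSet_mem_toZFSet_iff.2 (collapse_lt_ord hx.2.1 _)
  refine ⟨M, N, hM, hN, hMZ, hMcl, hμM, hAM, j, ⟨⟨⟨κ.ord.toZFSet, hord _ hκμ'⟩, rfl, ?_⟩, ?_⟩,
    ⟨⟨κ.ord.toZFSet, hord _ hκμ'⟩, rfl, hμκ⟩, p ⟨hat, hhat𝓕⟩, (p _).2, fun z => ?_⟩
  · intro hcon
    rw [hcon, Ordinal.toZFSet_mem_toZFSet_iff] at hμκ
    exact hκμ'.not_gt hμκ
  · rintro α hα ⟨a, ha⟩ rfl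
    exact hcrit α hα
  · refine (hmem' _ z).trans ?_
    constructor
    · rintro ⟨g, rfl, hg⟩
      obtain ⟨v, hv, hgv, -⟩ := hrank g id (Eventually.of_forall fun x => subset_rfl) (by
        filter_upwards [hg, h1] with x hx hxs
        rw [hhat x hxs] at hx
        exact (mem_ordSet_iff hxs.1).1 hx)
      exact ⟨⟨v.toZFSet, hord v hv.le⟩, Ordinal.toZFSet_mem_toZFSet_iff.2 hv,
        congrArg Subtype.val hgv.symm⟩
    · rintro ⟨⟨a, ha⟩, haμ, rfl⟩
      obtain ⟨α, hα, rfl⟩ := Ordinal.mem_toZFSet_iff.1 haμ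
      refine ⟨⟨fun _ => ⟨α.toZFSet, ha⟩, hconst _⟩, rfl, ?_⟩
      filter_upwards [h1, h2 α hα] with x hx hαx
      rw [hhat x hx]
      exact (mem_ordSet_iff hx.1).2 ⟨α, hαx, rfl⟩


/-! ### Coding a family of sets of ordinals into a single set of ordinals -/

/-- By König's theorem `μ < μ ^ cof μ`, so `μ ^< κ = μ` forces `cof μ ≥ κ`. -/
theorem exists_bound_of_mk_lt {κ μ : Cardinal.{u}} (hμ0 : ℵ₀ ≤ μ) (hμ : μ = μ ^< κ)
    {x : Set Ordinal.{u}} (hx : x ⊆ Iio μ.ord) (hxκ : #x < Cardinal.lift.{u + 1} κ) :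
    ∃ η < μ.ord, x ⊆ Iio η := by
  have hcof : κ ≤ μ.ord.cof := by
    by_contra! h
    have h1 := Cardinal.lt_power_cof_ord hμ0
    have h2 : μ ^ μ.ord.cof ≤ μ := (Cardinal.le_powerlt μ h).trans hμ.symm.le
    exact h1.not_ge h2
  have hlt : #x < (Ordinal.lift.{u + 1} μ.ord).cof := by
    rw [← Ordinal.lift_cof]
    exact hxκ.trans_le (Cardinal.lift_le.2 hcof)
  refine ⟨_, Ordinal.sSup_add_one_lt_of_lt_cof hlt hx, fun α hα => ?_⟩
  refine (Order.lt_add_one_iff.2 (le_refl α)).trans_le (le_csSup ?_ (mem_image_of_mem (· + 1) hα))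
  refine ⟨μ.ord, ?_⟩
  rintro _ ⟨β, hβ, rfl⟩
  exact Order.add_one_le_iff.2 (hx hβ)

/-- Each such set is the range of a function from an ordinal below `κ` into `μ`, and `κ · μ ^< κ =
μ`. -/
theorem mk_smallSubsets_le {κ μ : Cardinal.{u}} (hμ0 : ℵ₀ ≤ μ) (hκμ : κ ≤ μ) (hμ : μ = μ ^< κ) :
    #{x : Set Ordinal.{u} // x ⊆ Iio μ.ord ∧ #x < Cardinal.lift.{u + 1} κ} ≤
      Cardinal.lift.{u + 1} μ := by
  have hμ' : ℵ₀ ≤ Cardinal.lift.{u + 1} μ := by simpa using hμ0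
  let f : (Σ β : Iio κ.ord, (Iio β.1 → Iio μ.ord)) → Set Ordinal.{u} :=
    fun p => range fun γ => (p.2 γ : Ordinal.{u})
  have hf : ∀ x : {x : Set Ordinal.{u} // x ⊆ Iio μ.ord ∧ #x < Cardinal.lift.{u + 1} κ},
      ∃ p, f p = x.1 := by
    rintro ⟨x, hx, hxκ⟩
    obtain ⟨c, hc, hcx⟩ := Cardinal.lt_lift_iff.1 hxκ
    have hcκ : c.ord < κ.ord := by simpa using hc
    obtain ⟨e⟩ : Nonempty (Iio c.ord ≃ x) := by
      rw [← Cardinal.eq, Cardinal.mk_Iio_ordinal, Cardinal.card_ord, hcx]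
    refine ⟨⟨⟨c.ord, hcκ⟩, fun γ => ⟨e γ, hx (e γ).2⟩⟩, ?_⟩
    change range (fun γ => (e γ : Ordinal.{u})) = x
    rw [range_comp' Subtype.val e, e.surjective.range_eq, image_univ, Subtype.range_coe]
  choose g hg using hf
  have hinj : Function.Injective g := fun x y h => Subtype.ext (by rw [← hg x, ← hg y, h])
  refine (Cardinal.mk_le_of_injective hinj).trans ?_
  rw [Cardinal.mk_sigma]
  refine (Cardinal.sum_le_sum _ (fun _ => Cardinal.lift.{u + 1} μ) fun β => ?_).trans ?_
  · rw [← Cardinal.power_def, Cardinal.mk_Iio_ordinal, Cardinal.mk_Iio_ordinal, Cardinal.card_ord]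
    exact lift_power_le hμ (Cardinal.lift_lt.2 (Cardinal.lt_ord.1 β.2))
  · rw [Cardinal.sum_const', Cardinal.mk_Iio_ordinal, Cardinal.card_ord]
    exact (mul_le_mul' (Cardinal.lift_le.2 hκμ) le_rfl).trans (Cardinal.mul_eq_self hμ').le

/-- The set `A` has a block coding the set `x` and the ordinals `i` and `v`. -/
def IsCode (A x : Set Ordinal.{u}) (i v : Ordinal.{u}) : Prop :=
  ∃ c, c + c + c + c ∈ A ∧ x ⊆ Iio c ∧ (∀ α < c, α ∈ x ↔ c + α ∈ A) ∧
    (i < c ∧ c + c + i ∈ A) ∧ v < c ∧ c + c + c + v ∈ A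

/-- The block at `c` that codes the set `x` and the ordinals `i` and `v`. -/
def block (c : Ordinal.{u}) (x : Set Ordinal.{u}) (i v : Ordinal.{u}) : Set Ordinal.{u} :=
  {γ | (∃ α ∈ x, γ = c + α) ∨ γ = c + c + i ∨ γ = c + c + c + v ∨ γ = c + c + c + c}

section Block

variable {c i v : Ordinal.{u}} {x : Set Ordinal.{u}}

theorem le_of_mem_block {γ : Ordinal.{u}} (h : γ ∈ block c x i v) : c ≤ γ := by
  rcases h with ⟨α, -, rfl⟩ | rfl | rfl | rfl
  · exact le_self_add
  all_goals
    simp only [add_assoc]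
    exact le_self_add

theorem add_mem_block_iff {α : Ordinal.{u}} (hα : α < c) : c + α ∈ block c x i v ↔ α ∈ x := by
  constructor
  · rintro (⟨β, hβ, h⟩ | h | h | h)
    · rwa [add_left_cancel h]
    all_goals
      simp only [add_assoc, add_right_inj] at h
      exact absurd (h ▸ le_self_add) hα.not_ge
  · exact fun h => Or.inl ⟨α, h, rfl⟩

theorem add_add_mem_block_iff (hx : x ⊆ Iio c) {α : Ordinal.{u}} (hα : α < c) :
    c + c + α ∈ block c x i v ↔ α = i := by
  constructor
  · rintro (⟨β, hβ, h⟩ | h | h | h)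
    · simp only [add_assoc, add_right_inj] at h
      exact absurd (h ▸ le_self_add) (hx hβ : β < c).not_ge
    · exact add_left_cancel h
    all_goals
      simp only [add_assoc, add_right_inj] at h
      exact absurd (h ▸ le_self_add) hα.not_ge
  · exact fun h => Or.inr (Or.inl (h ▸ rfl))

theorem add_add_add_mem_block_iff (hx : x ⊆ Iio c) (hi : i < c) {α : Ordinal.{u}} (hα : α < c) :
    c + c + c + α ∈ block c x i v ↔ α = v := by
  constructor
  · rintro (⟨β, hβ, h⟩ | h | h | h)
    · simp only [add_assoc, add_right_inj] at h
      exact absurd (h ▸ le_self_add) (hx hβ : β < c).not_ge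
    · simp only [add_assoc, add_right_inj] at h
      exact absurd (h ▸ le_self_add) hi.not_ge
    · exact add_left_cancel h
    · simp only [add_assoc, add_right_inj] at h
      exact absurd h.ge hα.not_ge
  · exact fun h => Or.inr (Or.inr (Or.inl (h ▸ rfl)))

theorem mem_block_le {γ : Ordinal.{u}} (hx : x ⊆ Iio c) (hi : i < c) (hv : v < c)
    (h : γ ∈ block c x i v) : γ ≤ c + c + c + c := by
  rcases h with ⟨α, hα, rfl⟩ | rfl | rfl | rfl
  · simp only [add_assoc]
    exact add_le_add le_rfl ((hx hα : α < c).le.trans le_self_add)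
  · simp only [add_assoc]
    exact add_le_add le_rfl (add_le_add le_rfl (hi.le.trans le_self_add))
  · exact add_le_add le_rfl hv.le
  · exact le_rfl

/-- The top point of a block marks its base: nothing in the block exceeds four times `c`, while four
times a larger `d` does. -/
theorem eq_of_four_mul_mem_block {d : Ordinal.{u}} (hd : c ≤ d) (hx : x ⊆ Iio c) (hi : i < c)
    (hv : v < c) (h : d + d + d + d ∈ block c x i v) : d = c := by
  by_contra hne
  have hlt : c < d := lt_of_le_of_ne hd (Ne.symm hne)
  have h1 : c + c + c + c < d + d + d + d :=
    (add_le_add (add_le_add (add_le_add hd hd) hd) le_rfl).trans_lt (by gcongr)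
  exact h1.not_ge (mem_block_le hx hi hv h)

end Block

/-- The bases are distinct powers of `ω`. These are closed under addition, so four times a base
stays below the next one and blocks do not overlap. Each triple receives `μ` many bases, so some
base exceeds all its ordinals; only such bases are used, and repeated codes of a triple are
harmless. -/
theorem exists_coding_set {μ : Cardinal.{u}} (hμ : ℵ₀ < μ)
    (T : Set (Set Ordinal.{u} × Ordinal.{u} × Ordinal.{u}))
    (hT : #T ≤ Cardinal.lift.{u + 1} μ)
    (hb : ∀ t ∈ T, ∃ η < μ.ord, t.1 ⊆ Iio η ∧ t.2.1 < η ∧ t.2.2 < η) :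
    ∃ A ⊆ Iio μ.ord, ∀ x i v, IsCode A x i v ↔ (x, i, v) ∈ T := by
  have hμ' : ℵ₀ ≤ Cardinal.lift.{u + 1} μ := by simpa using hμ.le
  obtain ⟨e⟩ : #(T × Iio μ.ord) ≤ #(Iio μ.ord) := by
    rw [Cardinal.mk_prod, Cardinal.lift_id, Cardinal.lift_id, Cardinal.mk_Iio_ordinal,
      Cardinal.card_ord]
    exact (mul_le_mul' hT le_rfl).trans (Cardinal.mul_eq_self hμ').le
  let b : T → Iio μ.ord → Ordinal.{u} := fun t ξ => Ordinal.omega0 ^ (e (t, ξ) : Ordinal.{u})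
  let ok : T → Iio μ.ord → Prop := fun t ξ =>
    t.1.1 ⊆ Iio (b t ξ) ∧ t.1.2.1 < b t ξ ∧ t.1.2.2 < b t ξ
  have hbadd : ∀ t ξ α β, α < b t ξ → β < b t ξ → α + β < b t ξ := fun t ξ α β hα hβ =>
    Ordinal.isPrincipal_add_omega0_opow _ hα hβ
  have hb4 : ∀ t ξ α, α < b t ξ → α + α + α + α < b t ξ := fun t ξ α h =>
    hbadd _ _ _ _ (hbadd _ _ _ _ (hbadd _ _ _ _ h h) h) h
  have hbμ : ∀ t ξ, b t ξ < μ.ord := fun t ξ =>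
    Ordinal.isPrincipal_opow_ord hμ.le (by rw [Cardinal.lt_ord]; simpa using hμ) (e (t, ξ)).2
  let A : Set Ordinal.{u} := {γ | ∃ t ξ, ok t ξ ∧ γ ∈ block (b t ξ) t.1.1 t.1.2.1 t.1.2.2}
  have huniq : ∀ t ξ t' ξ' γ, b t ξ ≤ γ → γ ≤ b t ξ + b t ξ + b t ξ + b t ξ → b t' ξ' ≤ γ →
      γ ≤ b t' ξ' + b t' ξ' + b t' ξ' + b t' ξ' → t = t' ∧ ξ = ξ' := by
    intro t ξ t' ξ' γ h1 h2 h3 h4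
    have hb : b t ξ = b t' ξ' := by
      rcases lt_trichotomy (b t ξ) (b t' ξ') with h | h | h
      · exact absurd (h3.trans h2) (hb4 _ _ _ h).not_ge
      · exact h
      · exact absurd (h1.trans h4) (hb4 _ _ _ h).not_ge
    have he := e.injective (Subtype.ext
      ((Ordinal.opow_right_inj Ordinal.one_lt_omega0).1 hb))
    exact ⟨congrArg Prod.fst he, congrArg Prod.snd he⟩
  have hmem : ∀ t ξ γ, ok t ξ → b t ξ ≤ γ → γ ≤ b t ξ + b t ξ + b t ξ + b t ξ →
      (γ ∈ A ↔ γ ∈ block (b t ξ) t.1.1 t.1.2.1 t.1.2.2) := by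
    intro t ξ γ hok h1 h2
    refine ⟨?_, fun h => ⟨t, ξ, hok, h⟩⟩
    rintro ⟨t', ξ', hok', h⟩
    obtain ⟨rfl, rfl⟩ := huniq t ξ t' ξ' γ h1 h2 (le_of_mem_block h)
      (mem_block_le hok'.1 hok'.2.1 hok'.2.2 h)
    exact h
  have hpos : ∀ t ξ, 0 < b t ξ := fun t ξ => Ordinal.opow_pos _ Ordinal.omega0_pos
  have hrange1 : ∀ (c α : Ordinal.{u}), α < c → c ≤ c + α ∧ c + α ≤ c + c + c + c := by
    intro c α h
    refine ⟨le_self_add, ?_⟩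
    simp only [add_assoc]
    exact add_le_add le_rfl (h.le.trans le_self_add)
  have hrange2 : ∀ (c α : Ordinal.{u}), α < c → c ≤ c + c + α ∧ c + c + α ≤ c + c + c + c := by
    intro c α h
    simp only [add_assoc]
    exact ⟨le_self_add, add_le_add le_rfl (add_le_add le_rfl (h.le.trans le_self_add))⟩
  have hrange3 : ∀ (c α : Ordinal.{u}), α ≤ c →
      c ≤ c + c + c + α ∧ c + c + c + α ≤ c + c + c + c := by
    intro c α h
    refine ⟨?_, add_le_add le_rfl h⟩
    simp only [add_assoc]
    exact le_self_add
  refine ⟨A, ?_, fun x i v => ⟨?_, fun ht => ?_⟩⟩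
  · rintro γ ⟨t, ξ, hok, h⟩
    have hadd := Ordinal.isPrincipal_add_ord hμ.le
    exact (mem_block_le hok.1 hok.2.1 hok.2.2 h).trans_lt
      (hadd (hadd (hadd (hbμ t ξ) (hbμ t ξ)) (hbμ t ξ)) (hbμ t ξ))
  · rintro ⟨c, h4, hxc, hx, ⟨hic, hi⟩, hvc, hv⟩
    obtain ⟨t, ξ, hok, h⟩ := h4
    -- If `c` were below the base, so would be four times `c`, which lies in the block.
    have hle : b t ξ ≤ c := by
      by_contra! hlt
      exact (hb4 _ _ _ hlt).not_ge (le_of_mem_block h)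
    obtain rfl := eq_of_four_mul_mem_block hle hok.1 hok.2.1 hok.2.2 h
    have hxt : x = t.1.1 := by
      ext α
      constructor
      · intro hα
        have hαc : α < b t ξ := hxc hα
        have := (hx α hαc).1 hα
        rwa [hmem t ξ _ hok (hrange1 _ _ hαc).1 (hrange1 _ _ hαc).2, add_mem_block_iff hαc] at this
      · intro hα
        have hαc : α < b t ξ := hok.1 hα
        rwa [hx α hαc, hmem t ξ _ hok (hrange1 _ _ hαc).1 (hrange1 _ _ hαc).2,
          add_mem_block_iff hαc]
    rw [hmem t ξ _ hok (hrange2 _ _ hic).1 (hrange2 _ _ hic).2,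
      add_add_mem_block_iff hok.1 hic] at hi
    rw [hmem t ξ _ hok (hrange3 _ _ hvc.le).1 (hrange3 _ _ hvc.le).2,
      add_add_add_mem_block_iff hok.1 hok.2.1 hvc] at hv
    rw [hxt, hi, hv]
    exact t.2
  · obtain ⟨η, hη, hxη, hiη, hvη⟩ := hb _ ht
    let t : T := ⟨(x, i, v), ht⟩
    obtain ⟨ξ, hξ⟩ : ∃ ξ, η ≤ (e (t, ξ) : Ordinal.{u}) := by
      by_contra! hcon
      have hinj : Function.Injective (fun ξ => (⟨e (t, ξ), hcon ξ⟩ : Iio η)) := by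
        intro ξ ξ' h
        exact congrArg Prod.snd (e.injective (Subtype.ext (congrArg (fun z : Iio η => z.1) h)))
      have := Cardinal.mk_le_of_injective hinj
      rw [Cardinal.mk_Iio_ordinal, Cardinal.mk_Iio_ordinal, Cardinal.card_ord,
        Cardinal.lift_le] at this
      exact this.not_gt (Cardinal.lt_ord.1 hη)
    have hηb : η ≤ b t ξ := hξ.trans (Ordinal.right_le_opow _ Ordinal.one_lt_omega0)
    have hok : ok t ξ := ⟨hxη.trans (Iio_subset_Iio hηb), hiη.trans_le hηb, hvη.trans_le hηb⟩
    refine ⟨b t ξ, ?_, hok.1, fun α hα => ?_, ⟨hok.2.1, ?_⟩, hok.2.2, ?_⟩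
    · exact ⟨t, ξ, hok, Or.inr (Or.inr (Or.inr rfl))⟩
    · rw [hmem t ξ _ hok (hrange1 _ _ hα).1 (hrange1 _ _ hα).2, add_mem_block_iff hα]
    · exact ⟨t, ξ, hok, Or.inr (Or.inl rfl)⟩
    · exact ⟨t, ξ, hok, Or.inr (Or.inr (Or.inl rfl))⟩


/-! ### Order types in models of ZFC⁻ -/

theorem lt_collapse_iff {x : Set Ordinal.{u}} {α γ : Ordinal.{u}} :
    γ < collapse x α ↔ ∃ β ∈ x, β < α ∧ collapse x β = γ :=
  ⟨exists_of_lt_collapse, fun ⟨_, hβ, hβα, h⟩ => h ▸ collapse_lt hβ hβα⟩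

theorem collapse_congr {x y : Set Ordinal.{u}} {α : Ordinal.{u}}
    (h : ∀ β < α, β ∈ x ↔ β ∈ y) : collapse x α = collapse y α := by
  induction α using WellFoundedLT.induction with
  | ind α ih =>
    refine eq_of_forall_lt_iff fun γ => ?_
    rw [lt_collapse_iff, lt_collapse_iff]
    constructor
    · rintro ⟨β, hβ, hβα, rfl⟩
      exact ⟨β, (h β hβα).1 hβ, hβα, (ih β hβα fun δ hδ => h δ (hδ.trans hβα)).symm⟩
    · rintro ⟨β, hβ, hβα, rfl⟩
      exact ⟨β, (h β hβα).2 hβ, hβα, ih β hβα fun δ hδ => h δ (hδ.trans hβα)⟩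

/-- Applied to the translation `γ ↦ c + γ`, for ordinal addition, and to `j` on the ordinals below
`μ`, for the order type of `j '' μ`. -/
theorem collapse_image {e : Ordinal.{u} → Ordinal.{u}} {η θ : Ordinal.{u}}
    (he : StrictMonoOn e (Iio η)) (hθ : ∀ α < η, e α < θ) : collapse (e '' Iio η) θ = η := by
  have key : ∀ α < η, collapse (e '' Iio η) (e α) = α := by
    intro α
    induction α using WellFoundedLT.induction with
    | ind α ih =>
      intro hα
      refine eq_of_forall_lt_iff fun γ => ?_
      rw [lt_collapse_iff]
      constructor
      · rintro ⟨_, ⟨β, hβ, rfl⟩, hβα, rfl⟩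
        have hβα' : β < α := (he.lt_iff_lt hβ hα).1 hβα
        rwa [ih β hβα' hβ]
      · intro hγ
        exact ⟨e γ, ⟨γ, hγ.trans hα, rfl⟩, he (hγ.trans hα) hα hγ, ih γ hγ (hγ.trans hα)⟩
  refine eq_of_forall_lt_iff fun γ => ?_
  rw [lt_collapse_iff]
  constructor
  · rintro ⟨_, ⟨β, hβ, rfl⟩, -, rfl⟩
    rwa [key β hβ]
  · exact fun hγ => ⟨e γ, ⟨γ, hγ, rfl⟩, hθ γ hγ, key γ hγ⟩

section Definitions

variable {M : Type v} [setLang.Structure M]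

/-- In the structure `M`, the relation `g` is an isomorphism from `(β, ∈)` to `(x, ∈)`. -/
def IsIso (g β x : M) : Prop :=
  (∀ a, Mem a β → ∃ b, Mem b x ∧ PairMem g a b) ∧ (∀ b, Mem b x → ∃ a, Mem a β ∧ PairMem g a b) ∧
    ∀ a a' b b', Mem a β → Mem a' β → Mem b x → Mem b' x → PairMem g a b → PairMem g a' b' →
      (Mem a a' ↔ Mem b b')

/-- In the structure `M`, the set `β` is transitive. -/
def IsTrans (β : M) : Prop :=
  ∀ a, Mem a β → ∀ b, Mem b a → Mem b β

/-- In the structure `M`, the transitive set `β` is isomorphic to `x`. -/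
def IsOtp (β x : M) : Prop :=
  IsTrans β ∧ ∃ g, IsIso g β x

/-- In the structure `M`, the ordinal `γ` is the sum of `c` and `α`. -/
def AddRel (c α γ : M) : Prop :=
  (c = γ ∨ Mem c γ) ∧ ∃ x, (∀ z, Mem z x ↔ Mem z γ ∧ ¬ Mem z c) ∧ IsOtp α x

/-- In the structure `M`, the subset `A` of the ordinal `m` has a block coding the set `x` and the
ordinals `i` and `v`. -/
def Codes (m A x i v : M) : Prop :=
  ∃ c d₂ d₃ d₄ : M, (Mem c m ∧ Mem d₂ m ∧ Mem d₃ m ∧ Mem d₄ m) ∧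
    (AddRel c c d₂ ∧ AddRel d₂ c d₃ ∧ AddRel d₃ c d₄) ∧ Mem d₄ A ∧ (∀ z, Mem z x → Mem z c) ∧
    (∀ α, Mem α c → (Mem α x ↔ ∃ γ, Mem γ A ∧ AddRel c α γ)) ∧
    (Mem i c ∧ ∃ γ, Mem γ A ∧ AddRel d₂ i γ) ∧ Mem v c ∧ ∃ γ, Mem γ A ∧ AddRel d₃ v γ

end Definitions

namespace IsFO

variable {n : ℕ}

theorem isIso (i j k : Fin n) : IsFO.{w} n fun _ _ v => IsIso (v i) (v j) (v k) := by
  refine and (all (imp (mem _ _) (ex (and (mem _ _) (pairMem _ _ _)))))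
    (and (all (imp (mem _ _) (ex (and (mem _ _) (pairMem _ _ _))))) ?_)
  exact all (all (all (all (imp (mem _ _) (imp (mem _ _) (imp (mem _ _) (imp (mem _ _)
    (imp (pairMem _ _ _) (imp (pairMem _ _ _) (iff (mem _ _) (mem _ _)))))))))))

theorem isTrans (i : Fin n) : IsFO.{w} n fun _ _ v => IsTrans (v i) :=
  all (imp (mem _ _) (all (imp (mem _ _) (mem _ _))))

theorem isOtp (i j : Fin n) : IsFO.{w} n fun _ _ v => IsOtp (v i) (v j) :=
  and (isTrans _) (ex (isIso _ _ _))

theorem addRel (i j k : Fin n) : IsFO.{w} n fun _ _ v => AddRel (v i) (v j) (v k) :=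
  and (or (eq _ _) (mem _ _))
    (ex (and (all (iff (mem _ _) (and (mem _ _) (not (mem _ _))))) (isOtp _ _)))

theorem codes (i j k l m : Fin n) :
    IsFO.{w} n fun _ _ v => Codes (v i) (v j) (v k) (v l) (v m) := by
  refine ex (ex (ex (ex (and (and (mem _ _) (and (mem _ _) (and (mem _ _) (mem _ _))))
    (and (and (addRel _ _ _) (and (addRel _ _ _) (addRel _ _ _))) (and (mem _ _)
      (and (all (imp (mem _ _) (mem _ _))) (and ?_ (and ?_ ?_)))))))))
  · exact all (imp (mem _ _) (iff (mem _ _) (ex (and (mem _ _) (addRel _ _ _)))))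
  · exact and (mem _ _) (ex (and (mem _ _) (addRel _ _ _)))
  · exact and (mem _ _) (ex (and (mem _ _) (addRel _ _ _)))

end IsFO

namespace ModelsZFCMinus

variable {M : Type w} [setLang.Structure M]

theorem exists_sep (hM : ModelsZFCMinus M) {R : ∀ (M : Type w) [setLang.Structure M],
    M → M → M → Prop} (hR : IsFO.{w} 3 fun M _ v => R M (v 0) (v 1) (v 2)) (a p q : M) :
    ∃ b, ∀ y, Mem y b ↔ Mem y a ∧ R M y p q := by
  obtain ⟨φ, hφ⟩ := hR
  obtain ⟨b, hb⟩ := hM.separation 2 φ ![p, q] a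
  exact ⟨b, fun y => (hb y).trans (and_congr_right fun _ => hφ M _)⟩

/-- Collection bounds the values and separation cuts out the exact image. The relation must be
first-order in arbitrary variables because separation uses it under a further quantifier. -/
theorem exists_replacement (hM : ModelsZFCMinus M) {R : ∀ (M : Type w) [setLang.Structure M],
    M → M → M → Prop} (hR : ∀ {n} (i j k : Fin n), IsFO.{w} n fun M _ v => R M (v i) (v j) (v k))
    (a q : M) (h : ∀ x, Mem x a → ∃ y, R M x y q ∧ ∀ z, R M x z q → z = y) :
    ∃ b, ∀ y, Mem y b ↔ ∃ x, Mem x a ∧ R M x y q := by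
  obtain ⟨φ, hφ⟩ := hR (n := 3) 0 1 2
  obtain ⟨c, hc⟩ := hM.collection 1 φ ![q] a (by
    intro x hx
    obtain ⟨y, hy, -⟩ := h x hx
    exact ⟨y, (hφ M _).2 hy⟩)
  obtain ⟨b, hb⟩ := hM.exists_sep (R := fun M _ y a q => ∃ x, Mem x a ∧ R M x y q)
    (.ex (.and (.mem _ _) (hR _ _ _))) c a q
  refine ⟨b, fun y => (hb y).trans ⟨fun h => h.2, fun hy => ⟨?_, hy⟩⟩⟩
  obtain ⟨x, hx, hxy⟩ := hy
  obtain ⟨z, hz, hxz⟩ := hc x hx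
  obtain ⟨y', -, hy'⟩ := h x hx
  have hxz' : R M x z q := (hφ M _).1 hxz
  rwa [hy' y hxy, ← hy' z hxz']

end ModelsZFCMinus

section Transitive

variable {M : ZFSet.{u}}

/-- The set `x` consists of the von Neumann ordinals that correspond to the elements of `X`. -/
def Represents (x : ZFSet.{u}) (X : Set Ordinal.{u}) : Prop :=
  ∀ z, z ∈ x ↔ ∃ α ∈ X, α.toZFSet = z

theorem Represents.toZFSet_mem_iff {x : ZFSet.{u}} {X : Set Ordinal.{u}} (h : Represents x X)
    {α : Ordinal.{u}} : α.toZFSet ∈ x ↔ α ∈ X := by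
  rw [h]
  refine ⟨?_, fun hα => ⟨α, hα, rfl⟩⟩
  rintro ⟨β, hβ, hβα⟩
  rwa [← Ordinal.toZFSet_injective hβα]

/-- An isomorphism inside the transitive `M` is a genuine one, and induction along `X` shows that it
pairs each `α ∈ X` with the order type of `X ∩ α`. -/
theorem isOtp_eq (hM : M.IsTransitive) {β x : M} {X : Set Ordinal.{u}} {θ : Ordinal.{u}}
    (hx : Represents x X) (hX : X ⊆ Iio θ) (h : IsOtp β x) :
    (β : ZFSet.{u}) = (collapse X θ).toZFSet := by
  obtain ⟨htr, g, hg1, hg2, hg3⟩ := h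
  have hin : ∀ {α}, α ∈ X → α.toZFSet ∈ M := fun hα =>
    hM.subset_of_mem x.2 (hx.toZFSet_mem_iff.2 hα)
  have hxm : ∀ {α} (hα : α ∈ X), Mem (⟨α.toZFSet, hin hα⟩ : M) x := fun hα =>
    hx.toZFSet_mem_iff.2 hα
  have key : ∀ α (hα : α ∈ X) (a : M), Mem a β → PairMem g a ⟨α.toZFSet, hin hα⟩ →
      (a : ZFSet.{u}) = (collapse X α).toZFSet := by
    intro α
    induction α using WellFoundedLT.induction with
    | ind α ih =>
      intro hα a ha hga
      ext z
      rw [Ordinal.mem_toZFSet_iff]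
      constructor
      · intro hz
        let z' : M := ⟨z, hM.subset_of_mem a.2 hz⟩
        have hzβ : Mem z' β := htr a ha z' hz
        obtain ⟨b, hb, hgb⟩ := hg1 z' hzβ
        obtain ⟨γ, hγ, hγb⟩ := (hx b).1 hb
        obtain rfl : b = ⟨γ.toZFSet, hin hγ⟩ := Subtype.ext hγb.symm
        have hγα : γ < α := Ordinal.toZFSet_mem_toZFSet_iff.1
          ((hg3 _ _ _ _ hzβ ha hb (hxm hα) hgb hga).1 hz)
        exact ⟨_, collapse_lt hγ hγα, (ih γ hγα hγ z' hzβ hgb).symm⟩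
      · rintro ⟨δ, hδ, rfl⟩
        obtain ⟨γ, hγ, hγα, rfl⟩ := exists_of_lt_collapse hδ
        obtain ⟨z', hz', hgz⟩ := hg2 ⟨γ.toZFSet, hin hγ⟩ (hxm hγ)
        rw [← ih γ hγα hγ z' hz' hgz]
        exact (hg3 _ _ _ _ hz' ha (hxm hγ) (hxm hα) hgz hga).2
          (Ordinal.toZFSet_mem_toZFSet_iff.2 hγα)
  ext z
  rw [Ordinal.mem_toZFSet_iff]
  constructor
  · intro hz
    let z' : M := ⟨z, hM.subset_of_mem β.2 hz⟩
    obtain ⟨b, hb, hgb⟩ := hg1 z' hz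
    obtain ⟨γ, hγ, hγb⟩ := (hx b).1 hb
    obtain rfl : b = ⟨γ.toZFSet, hin hγ⟩ := Subtype.ext hγb.symm
    exact ⟨_, collapse_lt hγ (hX hγ), (key γ hγ z' hz hgb).symm⟩
  · rintro ⟨δ, hδ, rfl⟩
    obtain ⟨γ, hγ, -, rfl⟩ := exists_of_lt_collapse hδ
    obtain ⟨z', hz', hgz⟩ := hg2 ⟨γ.toZFSet, hin hγ⟩ (hxm hγ)
    rw [← key γ hγ z' hz' hgz]
    exact hz'

theorem exists_pair (hM : M.IsTransitive) (hZ : ModelsZFCMinus M) (x y : M) :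
    ZFSet.pair x y ∈ M := by
  have hpair : ∀ x y : M, ∃ a : M, (a : ZFSet.{u}) = {(x : ZFSet.{u}), (y : ZFSet.{u})} := by
    intro x y
    obtain ⟨a, ha⟩ := hZ.pairing x y
    refine ⟨a, ZFSet.ext fun z => ?_⟩
    rw [ZFSet.mem_pair]
    constructor
    · intro hz
      exact ((ha ⟨z, hM.subset_of_mem a.2 hz⟩).1 hz).imp (congrArg Subtype.val)
        (congrArg Subtype.val)
    · rintro (rfl | rfl)
      · exact (ha x).2 (Or.inl rfl)
      · exact (ha y).2 (Or.inr rfl)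
  obtain ⟨s, hs⟩ := hpair x x
  obtain ⟨t, ht⟩ := hpair x y
  obtain ⟨p, hp⟩ := hpair s t
  have : ZFSet.pair x y = p := by
    rw [hp, hs, ht, ZFSet.pair, ZFSet.pair_eq_singleton]
  exact this ▸ p.2

/-- Induction on the bound `θ`: the initial segments of `X` below its members have order types in
`M`. Replacement collects these into `β`, and their pairs with the elements of `x` into the
isomorphism. -/
theorem exists_isOtp (hM : M.IsTransitive) (hZ : ModelsZFCMinus M) {θ : Ordinal.{u}} :
    ∀ {x : M} {X : Set Ordinal.{u}}, Represents x X → X ⊆ Iio θ → ∃ β : M, IsOtp β x := by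
  induction θ using WellFoundedLT.induction with
  | ind θ ih =>
    intro x X hx hX
    have hin : ∀ {α}, α ∈ X → α.toZFSet ∈ M := fun hα =>
      hM.subset_of_mem x.2 (hx.toZFSet_mem_iff.2 hα)
    have hcut : ∀ α (hα : α ∈ X) (y : M),
        (∀ z, Mem z y ↔ Mem z x ∧ Mem z ⟨α.toZFSet, hin hα⟩) →
          Represents y (X ∩ Iio α) := by
      intro α hα y hy z
      constructor
      · intro hz
        obtain ⟨h1, h2⟩ := (hy ⟨z, hM.subset_of_mem y.2 hz⟩).1 hz
        obtain ⟨γ, hγ, rfl⟩ := (hx z).1 h1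
        exact ⟨γ, ⟨hγ, Ordinal.toZFSet_mem_toZFSet_iff.1 h2⟩, rfl⟩
      · rintro ⟨γ, ⟨hγ, hγα⟩, rfl⟩
        exact (hy ⟨γ.toZFSet, hin hγ⟩).2 ⟨hx.toZFSet_mem_iff.2 hγ,
          Ordinal.toZFSet_mem_toZFSet_iff.2 hγα⟩
    have hotp : ∀ α (hα : α ∈ X) (β : M), (∃ y, (∀ z, Mem z y ↔ Mem z x ∧
        Mem z ⟨α.toZFSet, hin hα⟩) ∧ IsOtp β y) ↔ (β : ZFSet.{u}) = (collapse X α).toZFSet := by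
      intro α hα β
      have heq : ∀ (β y : M), (∀ z, Mem z y ↔ Mem z x ∧ Mem z ⟨α.toZFSet, hin hα⟩) → IsOtp β y →
          (β : ZFSet.{u}) = (collapse X α).toZFSet := by
        intro β y hy hβ
        rw [isOtp_eq hM (hcut α hα y hy) inter_subset_right hβ]
        exact congrArg _ (collapse_congr fun γ hγ => ⟨fun h => h.1, fun h => ⟨h, hγ⟩⟩)
      constructor
      · rintro ⟨y, hy, hβ⟩
        exact heq β y hy hβ
      · intro hβ
        obtain ⟨y, hy⟩ := hZ.exists_sep (R := fun _ _ z a _ => Mem z a) (.mem _ _) x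
          ⟨α.toZFSet, hin hα⟩ x
        obtain ⟨β', hβ'⟩ := ih α (hX hα) (hcut α hα y hy) inter_subset_right
        have : β = β' := Subtype.ext (hβ.trans (heq β' y hy hβ').symm)
        exact ⟨y, hy, this ▸ hβ'⟩
    have hcol : ∀ α (hα : α ∈ X), (collapse X α).toZFSet ∈ M := by
      intro α hα
      obtain ⟨y, hy⟩ := hZ.exists_sep (R := fun _ _ z a _ => Mem z a) (.mem _ _) x
        ⟨α.toZFSet, hin hα⟩ x
      obtain ⟨β, hβ⟩ := ih α (hX hα) (hcut α hα y hy) inter_subset_right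
      rw [← (hotp α hα β).1 ⟨y, hy, hβ⟩]
      exact β.2
    have hX' : ∀ a : M, Mem a x → ∃ α, ∃ hα : α ∈ X, a = ⟨α.toZFSet, hin hα⟩ := by
      intro a ha
      obtain ⟨α, hα, hαa⟩ := (hx a).1 ha
      exact ⟨α, hα, Subtype.ext hαa.symm⟩
    obtain ⟨β, hβ⟩ := hZ.exists_replacement
      (R := fun M _ (a b q : M) => ∃ y, (∀ z, Mem z y ↔ Mem z q ∧ Mem z a) ∧ IsOtp b y)
      (fun i j k => .ex (.and (.all (.iff (.mem _ _) (.and (.mem _ _) (.mem _ _))))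
        (.isOtp _ _))) x x (by
      intro a ha
      obtain ⟨α, hα, rfl⟩ := hX' a ha
      refine ⟨⟨(collapse X α).toZFSet, hcol α hα⟩, (hotp α hα _).2 rfl, fun z hz => ?_⟩
      exact Subtype.ext ((hotp α hα z).1 hz))
    obtain ⟨g, hg⟩ := hZ.exists_replacement
      (R := fun M _ (a p q : M) => ∃ b, IsPair p b a ∧
        ∃ y, (∀ z, Mem z y ↔ Mem z q ∧ Mem z a) ∧ IsOtp b y)
      (fun i j k => .ex (.and (.isPair _ _ _) (.ex (.and (.all (.iff (.mem _ _)
        (.and (.mem _ _) (.mem _ _)))) (.isOtp _ _))))) x x (by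
      intro a ha
      obtain ⟨α, hα, rfl⟩ := hX' a ha
      refine ⟨⟨_, exists_pair hM hZ ⟨(collapse X α).toZFSet, hcol α hα⟩ ⟨α.toZFSet, hin hα⟩⟩,
        ⟨⟨(collapse X α).toZFSet, hcol α hα⟩, (isPair_iff hM _ _ _).2 rfl,
          (hotp α hα _).2 rfl⟩, ?_⟩
      rintro p ⟨b, hp, hb⟩
      refine Subtype.ext ?_
      rw [(isPair_iff hM _ _ _).1 hp, (hotp α hα b).1 hb])
    have hβ' : ∀ z, z ∈ (β : ZFSet.{u}) ↔ ∃ α ∈ X, (collapse X α).toZFSet = z := by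
      intro z
      constructor
      · intro hz
        obtain ⟨a, ha, h⟩ := (hβ ⟨z, hM.subset_of_mem β.2 hz⟩).1 hz
        obtain ⟨α, hα, rfl⟩ := hX' a ha
        exact ⟨α, hα, ((hotp α hα _).1 h).symm⟩
      · rintro ⟨α, hα, rfl⟩
        exact (hβ ⟨_, hcol α hα⟩).2 ⟨⟨α.toZFSet, hin hα⟩, hx.toZFSet_mem_iff.2 hα,
          (hotp α hα _).2 rfl⟩
    have hg' : ∀ a b : M, PairMem g a b ↔ ∃ α ∈ X, (a : ZFSet.{u}) = (collapse X α).toZFSet ∧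
        (b : ZFSet.{u}) = α.toZFSet := by
      intro a b
      constructor
      · rintro ⟨p, hp, hpg⟩
        obtain ⟨c, hc, d, hd, h⟩ := (hg p).1 hpg
        obtain ⟨α, hα, rfl⟩ := hX' c hc
        rw [isPair_iff hM] at hp hd
        obtain ⟨h1, h2⟩ := ZFSet.pair_inj.1 (hp.symm.trans hd)
        exact ⟨α, hα, h1.trans ((hotp α hα d).1 h), h2⟩
      · rintro ⟨α, hα, ha, hb⟩
        refine ⟨⟨_, exists_pair hM hZ a b⟩, (isPair_iff hM _ _ _).2 rfl, (hg _).2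
          ⟨b, ?_, a, (isPair_iff hM _ _ _).2 rfl, ?_⟩⟩
        · rw [mem_iff, hb]
          exact hx.toZFSet_mem_iff.2 hα
        · obtain rfl : b = ⟨α.toZFSet, hin hα⟩ := Subtype.ext hb
          exact (hotp α hα a).2 ha
    refine ⟨β, ?_, g, ?_, ?_, ?_⟩
    · intro a ha b hb
      obtain ⟨α, hα, hαa⟩ := (hβ' a).1 ha
      have hb' : (b : ZFSet.{u}) ∈ (collapse X α).toZFSet := hαa ▸ hb
      obtain ⟨γ, hγ, hγb⟩ := Ordinal.mem_toZFSet_iff.1 hb'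
      obtain ⟨δ, hδ, -, rfl⟩ := exists_of_lt_collapse hγ
      exact (hβ' b).2 ⟨δ, hδ, hγb⟩
    · intro a ha
      obtain ⟨α, hα, hαa⟩ := (hβ' a).1 ha
      exact ⟨⟨α.toZFSet, hin hα⟩, hx.toZFSet_mem_iff.2 hα, (hg' _ _).2 ⟨α, hα, hαa.symm, rfl⟩⟩
    · intro b hb
      obtain ⟨α, hα, rfl⟩ := hX' b hb
      exact ⟨⟨_, hcol α hα⟩, (hβ' _).2 ⟨α, hα, rfl⟩, (hg' _ _).2 ⟨α, hα, rfl, rfl⟩⟩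
    · intro a a' b b' _ _ _ _ h h'
      obtain ⟨α, hα, ha, hb⟩ := (hg' a b).1 h
      obtain ⟨α', hα', ha', hb'⟩ := (hg' a' b').1 h'
      rw [mem_iff, mem_iff, ha, ha', hb, hb', Ordinal.toZFSet_mem_toZFSet_iff,
        Ordinal.toZFSet_mem_toZFSet_iff, collapse_lt_iff hα hα']

theorem collapse_Ico (c α : Ordinal.{u}) : collapse (Ico c (c + α)) (c + α) = α := by
  have : Ico c (c + α) = (c + ·) '' Iio α := by
    ext γ
    constructor
    · rintro ⟨h1, h2⟩
      obtain ⟨δ, rfl⟩ := le_iff_exists_add.1 h1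
      exact ⟨δ, (add_lt_add_iff_left c).1 h2, rfl⟩
    · rintro ⟨δ, hδ, rfl⟩
      exact ⟨le_self_add, (add_lt_add_iff_left c).2 hδ⟩
  rw [this]
  exact collapse_image (fun a _ b _ hab => (add_lt_add_iff_left c).2 hab)
    fun δ hδ => (add_lt_add_iff_left c).2 hδ

/-- The difference of `γ` and `c` has order type `α` exactly when `γ = c + α`, so ordinal addition
is first-order without recursion. -/
theorem addRel_iff (hM : M.IsTransitive) (hZ : ModelsZFCMinus M) {c α γ : M}
    {c' α' γ' : Ordinal.{u}} (hc : (c : ZFSet.{u}) = c'.toZFSet) (hα : (α : ZFSet.{u}) = α'.toZFSet)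
    (hγ : (γ : ZFSet.{u}) = γ'.toZFSet) : AddRel c α γ ↔ c' + α' = γ' := by
  have hle : c = γ ∨ Mem c γ ↔ c' ≤ γ' := by
    rw [mem_iff, Subtype.ext_iff, hc, hγ, Ordinal.toZFSet_mem_toZFSet_iff, le_iff_eq_or_lt,
      Ordinal.toZFSet_injective.eq_iff]
  have hrep : ∀ x : M, (∀ z, Mem z x ↔ Mem z γ ∧ ¬ Mem z c) → Represents x (Ico c' γ') := by
    intro x hx z
    constructor
    · intro hz
      obtain ⟨h1, h2⟩ := (hx ⟨z, hM.subset_of_mem x.2 hz⟩).1 hz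
      rw [mem_iff, hγ] at h1
      obtain ⟨δ, hδ, rfl⟩ := Ordinal.mem_toZFSet_iff.1 h1
      rw [mem_iff, hc, Ordinal.toZFSet_mem_toZFSet_iff, not_lt] at h2
      exact ⟨δ, ⟨h2, hδ⟩, rfl⟩
    · rintro ⟨δ, ⟨h1, h2⟩, rfl⟩
      have hδ : δ.toZFSet ∈ (γ : ZFSet.{u}) := by
        rw [hγ]
        exact Ordinal.toZFSet_mem_toZFSet_iff.2 h2
      refine (hx ⟨_, hM.subset_of_mem γ.2 hδ⟩).2 ⟨hδ, ?_⟩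
      rw [mem_iff, hc, Ordinal.toZFSet_mem_toZFSet_iff, not_lt]
      exact h1
  have hval : ∀ δ, c' + δ = γ' → ∀ x β : M, (∀ z, Mem z x ↔ Mem z γ ∧ ¬ Mem z c) → IsOtp β x →
      (β : ZFSet.{u}) = δ.toZFSet := by
    rintro δ rfl x β hx hβ
    rw [isOtp_eq hM (hrep x hx) (fun _ h => h.2) hβ, collapse_Ico]
  constructor
  · rintro ⟨h1, x, hx, hαx⟩
    obtain ⟨δ, hδ⟩ := le_iff_exists_add.1 (hle.1 h1)
    have := hval δ hδ.symm x α hx hαx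
    rw [hα] at this
    rw [Ordinal.toZFSet_injective this, hδ]
  · intro h
    refine ⟨hle.2 (h ▸ le_self_add), ?_⟩
    obtain ⟨x, hx⟩ := hZ.exists_sep (R := fun _ _ z c _ => ¬ Mem z c) (.not (.mem _ _)) γ c c
    obtain ⟨β, hβ⟩ := exists_isOtp hM hZ (hrep x hx) (fun _ h => h.2)
    have : α = β := Subtype.ext (hα.trans (hval α' h x β hx hβ).symm)
    exact ⟨x, hx, this ▸ hβ⟩

/-- The coding is absolute. Restricting the base and its multiples to `m` loses nothing, since all
are at most the top point of the block, which lies in `A' ⊆ Iio θ`. -/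
theorem codes_iff (hM : M.IsTransitive) (hZ : ModelsZFCMinus M) {m A x i v : M} {θ : Ordinal.{u}}
    {A' X : Set Ordinal.{u}} {i' v' : Ordinal.{u}} (hm : (m : ZFSet.{u}) = θ.toZFSet)
    (hA : Represents A A') (hA' : A' ⊆ Iio θ) (hx : Represents x X)
    (hi : (i : ZFSet.{u}) = i'.toZFSet) (hv : (v : ZFSet.{u}) = v'.toZFSet) :
    Codes m A x i v ↔ IsCode A' X i' v' := by
  have hord : ∀ {α}, α < θ → α.toZFSet ∈ M := fun h =>
    hM.subset_of_mem m.2 (hm ▸ Ordinal.toZFSet_mem_toZFSet_iff.2 h)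
  have hmem : ∀ c : M, Mem c m → ∃ c' < θ, (c : ZFSet.{u}) = c'.toZFSet := by
    intro c hc
    rw [mem_iff, hm, Ordinal.mem_toZFSet_iff] at hc
    obtain ⟨c', hc', h⟩ := hc
    exact ⟨c', hc', h.symm⟩
  have hsum : ∀ {c α : M} {c' α' : Ordinal.{u}}, (c : ZFSet.{u}) = c'.toZFSet →
      (α : ZFSet.{u}) = α'.toZFSet → ((∃ γ, Mem γ A ∧ AddRel c α γ) ↔ c' + α' ∈ A') := by
    intro c α c' α' hc hα
    constructor
    · rintro ⟨γ, hγ, h⟩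
      obtain ⟨γ', hγ', h'⟩ := (hA γ).1 hγ
      rwa [(addRel_iff hM hZ hc hα h'.symm).1 h]
    · intro h
      refine ⟨⟨_, hord (hA' h)⟩, hA.toZFSet_mem_iff.2 h, (addRel_iff hM hZ hc hα rfl).2 rfl⟩
  constructor
  · rintro ⟨c, d₂, d₃, d₄, ⟨hc, hd₂, hd₃, hd₄⟩, ⟨h2, h3, h4⟩, hdA, hxc, hxA, ⟨hic, hiA⟩, hvc, hvA⟩
    obtain ⟨c', hc', hcc⟩ := hmem c hc
    obtain ⟨d₂', hd₂', hdd₂⟩ := hmem d₂ hd₂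
    obtain ⟨d₃', hd₃', hdd₃⟩ := hmem d₃ hd₃
    obtain ⟨d₄', hd₄', hdd₄⟩ := hmem d₄ hd₄
    obtain rfl := (addRel_iff hM hZ hcc hcc hdd₂).1 h2
    obtain rfl := (addRel_iff hM hZ hdd₂ hcc hdd₃).1 h3
    obtain rfl := (addRel_iff hM hZ hdd₃ hcc hdd₄).1 h4
    have hcmem : ∀ {a : M} {a' : Ordinal.{u}}, (a : ZFSet.{u}) = a'.toZFSet →
        (Mem a c ↔ a' < c') := by
      intro a a' ha
      rw [mem_iff, ha, hcc, Ordinal.toZFSet_mem_toZFSet_iff]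
    refine ⟨c', ?_, ?_, ?_, ⟨(hcmem hi).1 hic, (hsum hdd₂ hi).1 hiA⟩, (hcmem hv).1 hvc,
      (hsum hdd₃ hv).1 hvA⟩
    · rw [mem_iff, hdd₄] at hdA
      exact hA.toZFSet_mem_iff.1 hdA
    · intro α hα
      have hαx := hx.toZFSet_mem_iff.2 hα
      exact (hcmem rfl).1 (hxc ⟨_, hM.subset_of_mem x.2 hαx⟩ hαx)
    · intro α hα
      rw [← hx.toZFSet_mem_iff]
      exact (hxA ⟨_, hord (hα.trans hc')⟩ ((hcmem rfl).2 hα)).trans (hsum hcc rfl)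
  · rintro ⟨c, h4, hXc, hX, ⟨hic, hiA⟩, hvc, hvA⟩
    have h4' : c + c + c + c < θ := hA' h4
    have h3' : c + c + c < θ := le_self_add.trans_lt h4'
    have h2' : c + c < θ := le_self_add.trans_lt h3'
    have h1' : c < θ := le_self_add.trans_lt h2'
    have hmm : ∀ {α} (h : α < θ), Mem (⟨α.toZFSet, hord h⟩ : M) m := by
      intro α h
      rw [mem_iff, hm]
      exact Ordinal.toZFSet_mem_toZFSet_iff.2 h
    refine ⟨⟨_, hord h1'⟩, ⟨_, hord h2'⟩, ⟨_, hord h3'⟩, ⟨_, hord h4'⟩,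
      ⟨hmm h1', hmm h2', hmm h3', hmm h4'⟩, ⟨(addRel_iff hM hZ rfl rfl rfl).2 rfl,
        (addRel_iff hM hZ rfl rfl rfl).2 rfl, (addRel_iff hM hZ rfl rfl rfl).2 rfl⟩,
      hA.toZFSet_mem_iff.2 h4, ?_, ?_, ⟨?_, (hsum rfl hi).2 hiA⟩, ?_, (hsum rfl hv).2 hvA⟩
    · intro z hz
      obtain ⟨α, hα, h⟩ := (hx z).1 hz
      rw [mem_iff, ← h]
      exact Ordinal.toZFSet_mem_toZFSet_iff.2 (hXc hα)
    · intro α hα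
      obtain ⟨α', hα', h⟩ := Ordinal.mem_toZFSet_iff.1 hα
      have h : (α : ZFSet.{u}) = α'.toZFSet := h.symm
      refine Iff.trans ?_ (hsum (c' := c) rfl h).symm
      rw [← hX α' hα', mem_iff, h, hx.toZFSet_mem_iff]
    · rw [mem_iff, hi]
      exact Ordinal.toZFSet_mem_toZFSet_iff.2 hic
    · rw [mem_iff, hv]
      exact Ordinal.toZFSet_mem_toZFSet_iff.2 hvc

end Transitive


/-! ### Near supercompactness yields normal fine ultrafilters -/

theorem IsTrans.toZFSet {M : ZFSet.{u}} {α : Ordinal.{u}} {a : M}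
    (ha : (a : ZFSet.{u}) = α.toZFSet) : IsTrans a := by
  intro b hb c hc
  rw [mem_iff, ha] at hb ⊢
  exact (ZFSet.isOrdinal_toZFSet α).isTransitive.subset_of_mem hb hc

theorem IsTrans.subset_of_mem {M : ZFSet.{u}} (hM : M.IsTransitive) {a : M} (ha : IsTrans a)
    {x y : ZFSet.{u}} (hx : x ∈ (a : ZFSet.{u})) (hy : y ∈ x) : y ∈ (a : ZFSet.{u}) := by
  have hxM : x ∈ M := hM.subset_of_mem a.2 hx
  exact ha ⟨x, hxM⟩ hx ⟨y, hM.subset_of_mem hxM hy⟩ hy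

/-- If `κ = ω`, every element of `ω` is zero or the successor of an element of `ω`, and by
elementarity the same holds for `j ω`. But `ω ∈ j ω` is neither. -/
theorem IsNearlySupercompact.aleph0_lt {κ μ : Cardinal.{u}} (hκ : ℵ₀ ≤ κ) (hκμ : κ ≤ μ)
    (h : IsNearlySupercompact κ μ) : ℵ₀ < κ := by
  by_contra! hle
  obtain rfl : κ = ℵ₀ := le_antisymm hle hκ
  obtain ⟨M, N, hM, hN, -, -, -, -, j, -, ⟨k, hk, hμk⟩, -⟩ := h ∅ (by simp)
  rw [Cardinal.ord_aleph0] at hk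
  have hR : IsFO.{u + 1} 1 fun M _ v => IsTrans (v 0) ∧ ∀ z : M, Mem z (v 0) →
      (∀ w, ¬ Mem w z) ∨ ∃ y, Mem y (v 0) ∧ ∀ w, Mem w z ↔ Mem w y ∨ w = y :=
    .and (.isTrans _) (.all (.imp (.mem _ _) (.or (.all (.not (.mem _ _)))
      (.ex (.and (.mem _ _) (.all (.iff (.mem _ _) (.or (.mem _ _) (.eq _ _)))))))))
  obtain ⟨htr, hsucc⟩ := (hR.map_iff j ![k]).2 (by
    refine ⟨IsTrans.toZFSet hk, fun z hz => ?_⟩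
    have hz' : (z : ZFSet.{u}) ∈ (k : ZFSet.{u}) := hz
    rw [hk, Ordinal.mem_toZFSet_iff] at hz'
    obtain ⟨α, hα, hαz⟩ := hz'
    obtain ⟨n, rfl⟩ := Ordinal.lt_omega0.1 hα
    cases n with
    | zero =>
      left
      intro w hw
      rw [mem_iff, ← hαz, Nat.cast_zero, Ordinal.toZFSet_zero] at hw
      exact ZFSet.notMem_empty _ hw
    | succ n =>
      right
      have hn : (n : Ordinal.{u}).toZFSet ∈ (k : ZFSet.{u}) := by
        rw [hk]
        exact Ordinal.toZFSet_mem_toZFSet_iff.2 (Ordinal.natCast_lt_omega0 n)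
      refine ⟨⟨_, hM.subset_of_mem k.2 hn⟩, hn, fun w => ?_⟩
      rw [mem_iff, ← hαz, Nat.cast_succ, Ordinal.toZFSet_add_one, ZFSet.mem_insert_iff, or_comm]
      exact or_congr_right ⟨fun h => Subtype.ext h, fun h => congrArg Subtype.val h⟩)
  have hωk : Ordinal.omega0.toZFSet ∈ (j k : ZFSet.{u}) := by
    have hωμ : Ordinal.omega0 ≤ μ.ord := by simpa using hκμ
    rcases hωμ.eq_or_lt with h | h
    · rwa [h]
    · exact htr.subset_of_mem hN hμk (Ordinal.toZFSet_mem_toZFSet_iff.2 h)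
  have hωN : Ordinal.omega0.toZFSet ∈ N := hN.subset_of_mem (j k).2 hωk
  have hmemN : ∀ {x}, x ∈ Ordinal.omega0.toZFSet → x ∈ N := fun hx => hN.subset_of_mem hωN hx
  rcases hsucc ⟨_, hωN⟩ hωk with h | ⟨y, -, hy⟩
  · have h0 : (0 : Ordinal.{u}).toZFSet ∈ Ordinal.omega0.toZFSet :=
      Ordinal.toZFSet_mem_toZFSet_iff.2 Ordinal.omega0_pos
    exact h ⟨_, hmemN h0⟩ h0
  · have hyω : (y : ZFSet.{u}) ∈ Ordinal.omega0.toZFSet := (hy y).2 (Or.inr rfl)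
    obtain ⟨α, hα, hαy⟩ := Ordinal.mem_toZFSet_iff.1 hyω
    have h1 : (α + 1).toZFSet ∈ Ordinal.omega0.toZFSet :=
      Ordinal.toZFSet_mem_toZFSet_iff.2 (Ordinal.isSuccLimit_omega0.succ_lt hα)
    have h2 : (α + 1).toZFSet ∈ (y : ZFSet.{u}) ∨ (α + 1).toZFSet = y :=
      ((hy ⟨_, hmemN h1⟩).1 h1).imp id (congrArg Subtype.val)
    rw [← hαy, Ordinal.toZFSet_mem_toZFSet_iff, Ordinal.toZFSet_injective.eq_iff] at h2
    have h3 : α < α + 1 := Order.lt_add_one_iff.2 le_rfl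
    rcases h2 with h2 | h2
    · exact lt_asymm h2 h3
    · exact h3.ne' h2

theorem mk_le_card_collapse {X : Set Ordinal.{u}} {θ : Ordinal.{u}} (hX : X ⊆ Iio θ) :
    #X ≤ Cardinal.lift.{u + 1} (collapse X θ).card := by
  rw [← Cardinal.mk_Iio_ordinal]
  refine Cardinal.mk_le_of_injective (f := fun α : X =>
    (⟨collapse X α, collapse_lt α.2 (hX α.2)⟩ : Iio (collapse X θ))) fun α β h => ?_
  exact Subtype.ext (collapse_injOn X α.2 β.2 (congrArg (fun z : Iio (collapse X θ) => z.1) h))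

theorem represents_of_subset {x : ZFSet.{u}} {θ : Ordinal.{u}} (hx : ∀ z ∈ x, z ∈ θ.toZFSet) :
    Represents x {α | α.toZFSet ∈ x} ∧ {α : Ordinal.{u} | α.toZFSet ∈ x} ⊆ Iio θ := by
  refine ⟨fun z => ⟨fun hz => ?_, ?_⟩, fun α hα => Ordinal.toZFSet_mem_toZFSet_iff.1 (hx _ hα)⟩
  · obtain ⟨α, -, rfl⟩ := Ordinal.mem_toZFSet_iff.1 (hx z hz)
    exact ⟨α, hz, rfl⟩
  · rintro ⟨α, hα, rfl⟩
    exact hα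

/-- The set `A` is large enough to code the values `F i x` for all small sets `x` and `i ∈ x`. -/
theorem exists_coding_function {κ μ : Cardinal.{u}} (hκ : ℵ₀ < κ) (hκμ : κ ≤ μ) (hμ : μ = μ ^< κ)
    (F : Ordinal.{u} → Set Ordinal.{u} → Ordinal.{u}) (hF : ∀ i x, i ∈ x → F i x ∈ x) :
    ∃ A ⊆ Iio μ.ord, ∀ x i v, IsCode A x i v ↔ IsSmallSubset κ μ x ∧ i ∈ x ∧ F i x = v := by
  have hμ0 : ℵ₀ < μ := hκ.trans_le hκμ
  have hμ' : ℵ₀ ≤ Cardinal.lift.{u + 1} μ := by simpa using hμ0.le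
  refine exists_coding_set hμ0
    {t | IsSmallSubset κ μ t.1 ∧ t.2.1 ∈ t.1 ∧ F t.2.1 t.1 = t.2.2} ?_ ?_
  · let f : {t : Set Ordinal.{u} × Ordinal.{u} × Ordinal.{u} |
        IsSmallSubset κ μ t.1 ∧ t.2.1 ∈ t.1 ∧ F t.2.1 t.1 = t.2.2} →
        {x : Set Ordinal.{u} // x ⊆ Iio μ.ord ∧ #x < Cardinal.lift.{u + 1} κ} × Iio μ.ord :=
      fun t => (⟨t.1.1, t.2.1.1, t.2.1.2.1⟩, ⟨t.1.2.1, t.2.1.1 t.2.2.1⟩)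
    have hf : Function.Injective f := by
      rintro ⟨⟨x, i, v⟩, h1, h2, h3⟩ ⟨⟨x', i', v'⟩, h1', h2', h3'⟩ h
      obtain rfl : x = x' := congrArg (fun p => p.1.1) h
      obtain rfl : i = i' := congrArg (fun p => p.2.1) h
      obtain rfl : v = v' := h3.symm.trans h3'
      rfl
    refine (Cardinal.mk_le_of_injective hf).trans ?_
    rw [Cardinal.mk_prod, Cardinal.lift_id, Cardinal.lift_id, Cardinal.mk_Iio_ordinal,
      Cardinal.card_ord]
    exact (mul_le_mul' (mk_smallSubsets_le hμ0.le hκμ hμ) le_rfl).trans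
      (Cardinal.mul_eq_self hμ').le
  · rintro ⟨x, i, v⟩ ⟨h1, h2, h3⟩
    obtain rfl : F i x = v := h3
    obtain ⟨η, hη, hxη⟩ := exists_bound_of_mk_lt hμ0.le hμ h1.1 h1.2.1
    exact ⟨η, hη, hxη, hxη h2, hxη (hF i x h2)⟩

/-- In the structure `M`, every subset of the ordinal `m` of order type below `k` that meets `k` in
an ordinal has all its regressive values coded into the set `a`. -/
def CodesRegressive {M : Type v} [setLang.Structure M] (k m a : M) : Prop :=
  ∀ x, (∀ z, Mem z x → Mem z m) → (∃ β, Mem β k ∧ IsOtp β x) →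
    (∃ δ, Mem δ k ∧ ∀ z, Mem z δ ↔ Mem z x ∧ Mem z k) →
    ∀ i, Mem i x → ∃ v, Mem v x ∧ Codes m a x i v

theorem IsFO.codesRegressive {n : ℕ} (i j k : Fin n) :
    IsFO.{w} n fun _ _ v => CodesRegressive (v i) (v j) (v k) :=
  .all (.imp (.all (.imp (.mem _ _) (.mem _ _))) (.imp (.ex (.and (.mem _ _) (.isOtp _ _)))
    (.imp (.ex (.and (.mem _ _) (.all (.iff (.mem _ _) (.and (.mem _ _) (.mem _ _))))))
      (.all (.imp (.mem _ _) (.ex (.and (.mem _ _) (.codes _ _ _ _ _))))))))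

/-- The role of the ultrafilter is played by the seed `s = j '' μ`: the constant value `c i` is
determined by `j (c i)` being the coded value at `j i` of the function on `s`. -/
theorem IsNearlySupercompact.hasNormalUltrafilters {κ μ : Cardinal.{u}} (hκ : ℵ₀ ≤ κ)
    (hκμ : κ ≤ μ) (hμ : μ = μ ^< κ) (h : IsNearlySupercompact κ μ) :
    HasNormalUltrafilters κ μ := by
  classical
  intro F hF
  have hκ' : ℵ₀ < κ := h.aleph0_lt hκ hκμ
  have hκμ' : κ.ord ≤ μ.ord := by simpa using hκμ
  have hμ0 : 0 < μ := aleph0_pos.trans_le (hκ.trans hκμ)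
  obtain ⟨A, hA, hAF⟩ := exists_coding_function hκ' hκμ hμ F hF
  obtain ⟨M, N, hM, hN, hZ, -, hμM, hAM, j, ⟨-, hcrit⟩, ⟨k, hk, hμk⟩, s, hsN, hs⟩ :=
    h (ordSet μ A) fun z hz => (ZFSet.mem_sep.1 hz).1
  have hord : ∀ {α}, α < μ.ord → α.toZFSet ∈ M := fun hα =>
    hM.subset_of_mem hμM (Ordinal.toZFSet_mem_toZFSet_iff.2 hα)
  let m : M := ⟨_, hμM⟩
  let a : M := ⟨_, hAM⟩
  have ha : Represents (a : ZFSet.{u}) A := fun z => mem_ordSet_iff hA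
  have hjmem : ∀ x y : M, Mem (j x) (j y) ↔ Mem x y := fun x y =>
    (IsFO.mem.{u + 1} (n := 2) 0 1).map_iff j ![x, y]
  obtain ⟨hjm, hjm'⟩ := ((IsFO.and (.isTrans 0) (.all (.imp (.mem _ _) (.isTrans _))) :
    IsFO.{u + 1} 1 fun _ _ v => IsTrans (v 0) ∧ ∀ z, Mem z (v 0) → IsTrans z).map_iff j ![m]).2 (by
      refine ⟨IsTrans.toZFSet rfl, fun z hz => ?_⟩
      obtain ⟨α, -, hαz⟩ := Ordinal.mem_toZFSet_iff.1 hz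
      exact IsTrans.toZFSet hαz.symm)
  have hjk : IsTrans (j k) := ((IsFO.isTrans.{u + 1} (n := 1) 0).map_iff j ![k]).2
    (IsTrans.toZFSet hk)
  have hjmord : ZFSet.IsOrdinal (j m : ZFSet.{u}) := by
    refine ⟨fun x hx y hy => hjm.subset_of_mem hN hx hy, fun {x y z} hxy hyz hz => ?_⟩
    exact (hjm' ⟨z, hN.subset_of_mem (j m).2 hz⟩ hz).subset_of_mem hN hyz hxy
  let θ := (j m : ZFSet.{u}).rank
  have hθ : (j m : ZFSet.{u}) = θ.toZFSet := hjmord.toZFSet_rank_eq.symm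
  let e : Ordinal.{u} → Ordinal.{u} := fun α =>
    if hα : α < μ.ord then (j ⟨α.toZFSet, hord hα⟩ : ZFSet.{u}).rank else 0
  have he : ∀ α (hα : α < μ.ord), (j ⟨α.toZFSet, hord hα⟩ : ZFSet.{u}) = (e α).toZFSet := by
    intro α hα
    have hmem : (j ⟨α.toZFSet, hord hα⟩ : ZFSet.{u}) ∈ (j m : ZFSet.{u}) :=
      (hjmem _ m).2 (Ordinal.toZFSet_mem_toZFSet_iff.2 hα)
    simp only [e, dif_pos hα]
    exact (hjmord.mem hmem).toZFSet_rank_eq.symm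
  have heθ : ∀ α < μ.ord, e α < θ := by
    intro α hα
    rw [← Ordinal.toZFSet_mem_toZFSet_iff, ← he α hα, ← hθ]
    exact (hjmem _ m).2 (Ordinal.toZFSet_mem_toZFSet_iff.2 hα)
  have hemono : StrictMonoOn e (Iio μ.ord) := by
    intro α hα β hβ hαβ
    rw [← Ordinal.toZFSet_mem_toZFSet_iff, ← he α hα, ← he β hβ]
    exact (hjmem _ _).2 (Ordinal.toZFSet_mem_toZFSet_iff.2 hαβ)
  have hsrep : Represents s (e '' Iio μ.ord) := by
    intro z
    rw [hs]
    constructor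
    · rintro ⟨b, hb, rfl⟩
      obtain ⟨α, hα, hαb⟩ := Ordinal.mem_toZFSet_iff.1 hb
      obtain rfl : b = ⟨_, hord hα⟩ := Subtype.ext hαb.symm
      exact ⟨_, ⟨α, hα, rfl⟩, (he α hα).symm⟩
    · rintro ⟨_, ⟨α, hα, rfl⟩, rfl⟩
      exact ⟨⟨_, hord hα⟩, Ordinal.toZFSet_mem_toZFSet_iff.2 hα, he α hα⟩
  have hsm : ∀ z, Mem z (⟨s, hsN⟩ : N) → Mem z (j m) := by
    intro z hz
    obtain ⟨b, hb, hbz⟩ := (hs z).1 hz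
    rw [mem_iff, ← hbz]
    exact (hjmem b m).2 hb
  -- Nothing but elementarity is known about `N`, so the existence of order types for subsets of `j
  -- μ` is transferred from `M`. The order type of `s` is `μ`, which lies in `j κ`.
  have hotp : ∃ β, Mem β (j k) ∧ IsOtp β (⟨s, hsN⟩ : N) := by
    obtain ⟨β, hβ⟩ := ((IsFO.all (.imp (.all (.imp (.mem _ _) (.mem _ _))) (.ex (.isOtp _ _))) :
      IsFO.{u + 1} 1 fun _ _ v => ∀ x, (∀ z, Mem z x → Mem z (v 0)) → ∃ β, IsOtp β x).map_iff
        j ![m]).2 (by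
          intro x hx
          obtain ⟨h1, h2⟩ := represents_of_subset (x := (x : ZFSet.{u})) (θ := μ.ord)
            fun z hz => hx ⟨z, hM.subset_of_mem x.2 hz⟩ hz
          exact exists_isOtp hM hZ h1 h2) ⟨s, hsN⟩ hsm
    refine ⟨β, ?_, hβ⟩
    rw [mem_iff, isOtp_eq hN hsrep (θ := θ) (by
      rintro _ ⟨α, hα, rfl⟩
      exact heθ α hα) hβ, collapse_image hemono heθ]
    exact hμk
  have hκk : κ.ord.toZFSet ∈ (j k : ZFSet.{u}) := by
    rcases hκμ'.eq_or_lt with h | h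
    · rwa [h]
    · exact hjk.subset_of_mem hN hμk (Ordinal.toZFSet_mem_toZFSet_iff.2 h)
  -- The intersection of `s` with `j κ` is exactly `κ`: below `κ` the embedding is the identity, and
  -- `j b ∈ j κ` implies `b ∈ κ`.
  have hmeet : ∃ δ, Mem δ (j k) ∧ ∀ z, Mem z δ ↔ Mem z (⟨s, hsN⟩ : N) ∧ Mem z (j k) := by
    refine ⟨⟨_, hN.subset_of_mem (j k).2 hκk⟩, hκk, fun z => ⟨fun hz => ?_, fun hz => ?_⟩⟩
    · obtain ⟨γ, hγ, hγz⟩ := Ordinal.mem_toZFSet_iff.1 hz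
      have hγμ : γ < μ.ord := hγ.trans_le hκμ'
      obtain rfl : z = j ⟨_, hord hγμ⟩ := Subtype.ext (hγz.symm.trans (hcrit γ hγ _ rfl).symm)
      refine ⟨(hs _).2 ⟨_, Ordinal.toZFSet_mem_toZFSet_iff.2 hγμ, rfl⟩, (hjmem _ _).2 ?_⟩
      rw [mem_iff, hk]
      exact Ordinal.toZFSet_mem_toZFSet_iff.2 hγ
    · obtain ⟨b, hb, hbz⟩ := (hs z).1 hz.1
      obtain rfl : j b = z := Subtype.ext hbz
      have hbk := (hjmem _ _).1 hz.2
      rw [mem_iff, hk] at hbk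
      obtain ⟨γ, hγ, hγb⟩ := Ordinal.mem_toZFSet_iff.1 hbk
      rw [mem_iff, hcrit γ hγ b hγb.symm]
      exact Ordinal.toZFSet_mem_toZFSet_iff.2 hγ
  -- In `M` every set satisfying the premises is small, and `A` codes the values of `F` on it. The
  -- transferred statement applies to `s`.
  have hcodes : CodesRegressive (j k) (j m) (j a) :=
    ((IsFO.codesRegressive.{u + 1} (n := 3) 0 1 2).map_iff j ![k, m, a]).2 (by
      rintro x hx ⟨β, hβk, hβ⟩ ⟨δ, hδk, hδ⟩ i hi
      obtain ⟨h1, h2⟩ := represents_of_subset (x := (x : ZFSet.{u})) (θ := μ.ord)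
        fun z hz => hx ⟨z, hM.subset_of_mem x.2 hz⟩ hz
      set X : Set Ordinal.{u} := {α | α.toZFSet ∈ (x : ZFSet.{u})}
      have hβk' : (β : ZFSet.{u}) ∈ (k : ZFSet.{u}) := hβk
      rw [hk, isOtp_eq hM h1 h2 hβ, Ordinal.toZFSet_mem_toZFSet_iff] at hβk'
      have hδk' : (δ : ZFSet.{u}) ∈ (k : ZFSet.{u}) := hδk
      rw [hk] at hδk'
      obtain ⟨δ', hδ', hδδ⟩ := Ordinal.mem_toZFSet_iff.1 hδk'
      have hX : IsSmallSubset κ μ X := by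
        refine ⟨h2, (mk_le_card_collapse h2).trans_lt
          (Cardinal.lift_lt.2 (Cardinal.lt_ord.1 hβk')), δ', hδ', ?_⟩
        ext γ
        constructor
        · rintro ⟨h3, h4⟩
          have := (hδ ⟨_, hord (h2 h3)⟩).2 ⟨h3, by
            change _ ∈ (k : ZFSet.{u})
            rw [hk]
            exact Ordinal.toZFSet_mem_toZFSet_iff.2 h4⟩
          rw [mem_iff, ← hδδ] at this
          exact Ordinal.toZFSet_mem_toZFSet_iff.1 this
        · intro hγ
          have hγκ : γ < κ.ord := lt_trans hγ hδ'
          refine ⟨((hδ ⟨_, hord (hγκ.trans_le hκμ')⟩).1 ?_).1, hγκ⟩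
          rw [mem_iff, ← hδδ]
          exact Ordinal.toZFSet_mem_toZFSet_iff.2 hγ
      obtain ⟨i', hi', hii⟩ := (h1 i).1 hi
      have hv := hF i' X hi'
      exact ⟨⟨_, hord (h2 hv)⟩, hv, (codes_iff hM hZ (m := m) rfl ha hA h1 hii.symm rfl).2
        ((hAF _ _ _).2 ⟨hX, hi', rfl⟩)⟩)
  -- The value coded for `s` at `j i` belongs to `s`, hence has the form `j c`.
  have hval : ∀ i (hi : i < μ.ord), ∃ c, ∃ hc : c < μ.ord,
      Codes (j m) (j a) ⟨s, hsN⟩ (j ⟨_, hord hi⟩) (j ⟨_, hord hc⟩) := by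
    intro i hi
    obtain ⟨v, hv, hcv⟩ := hcodes _ hsm hotp hmeet (j ⟨_, hord hi⟩)
      ((hs _).2 ⟨_, Ordinal.toZFSet_mem_toZFSet_iff.2 hi, rfl⟩)
    obtain ⟨b, hb, hbv⟩ := (hs v).1 hv
    obtain ⟨c, hc, hcb⟩ := Ordinal.mem_toZFSet_iff.1 hb
    obtain rfl : b = ⟨_, hord hc⟩ := Subtype.ext hcb.symm
    obtain rfl : j ⟨_, hord hc⟩ = v := Subtype.ext hbv
    exact ⟨c, hc, hcv⟩
  choose! c hc hcodesc using hval
  refine exists_ultrafilter_of_finite hμ0 F c fun t ht => ?_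
  -- Smallness of the set found below is read off from a code, so at least one index is needed even
  -- if `t` is empty.
  let t' : Finset Ordinal.{u} := insert 0 t
  have ht' : ∀ i ∈ t', i < μ.ord := by
    intro i hi
    rcases Finset.mem_insert.1 hi with rfl | hi
    · simpa using hμ0
    · exact ht i hi
  let q : Fin t'.card → Ordinal.{u} := fun r => t'.equivFin.symm r
  have hq : ∀ r, q r < μ.ord := fun r => ht' _ (t'.equivFin.symm r).2
  have hqs : ∀ i ∈ t', ∃ r, q r = i := fun i hi => ⟨t'.equivFin ⟨i, hi⟩, by simp [q]⟩
  have hR : IsFO.{u + 1} (t'.card + (t'.card + 2)) fun M _ v => ∃ x : M,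
      (∀ z, Mem z x → Mem z (v (Fin.natAdd _ (Fin.natAdd _ 0)))) ∧ ∀ r : Fin t'.card,
        Codes (v (Fin.natAdd _ (Fin.natAdd _ 0))) (v (Fin.natAdd _ (Fin.natAdd _ 1))) x
          (v (Fin.castAdd _ r)) (v (Fin.natAdd _ (Fin.castAdd _ r))) :=
    .ex (.and (.all (.imp (.mem _ _) (.mem _ _))) (.forall_fin fun r => .codes _ _ _ _ _))
  have hfin := hR.map_iff j (Fin.append (fun r => ⟨_, hord (hq r)⟩)
    (Fin.append (fun r => ⟨_, hord (hc _ (hq r))⟩) ![m, a]))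
  simp only [Function.comp_apply, Fin.append_left, Fin.append_right] at hfin
  -- The set `s` need not be in the range of `j`, but its existence with these finitely many codes
  -- is a first-order statement about parameters in the range, and so reflects to some `x` in `M`.
  obtain ⟨x, hx, hxc⟩ := hfin.1 ⟨⟨s, hsN⟩, hsm, fun r => hcodesc _ (hq r)⟩
  obtain ⟨h1, h2⟩ := represents_of_subset (x := (x : ZFSet.{u})) (θ := μ.ord)
    fun z hz => hx ⟨z, hM.subset_of_mem x.2 hz⟩ hz
  have key : ∀ i ∈ t', IsSmallSubset κ μ {α | α.toZFSet ∈ (x : ZFSet.{u})} ∧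
      i ∈ {α : Ordinal.{u} | α.toZFSet ∈ (x : ZFSet.{u})} ∧
        F i {α | α.toZFSet ∈ (x : ZFSet.{u})} = c i := by
    intro i hi
    obtain ⟨r, rfl⟩ := hqs i hi
    exact (hAF _ _ _).1 ((codes_iff hM hZ (m := m) rfl ha hA h1 rfl rfl).1 (hxc r))
  exact ⟨_, (key 0 (Finset.mem_insert_self _ _)).1, fun i hi =>
    (key i (Finset.mem_insert_of_mem hi)).2⟩

end NearSupercompact

theorem mainTheorem4 (κ μ : Cardinal.{u}) (hκ : Cardinal.aleph0 ≤ κ) (hκμ : κ ≤ μ)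
    (hμ : μ = μ ^< κ) :
    NearSupercompact.IsPiOneOneReflective κ μ ↔ NearSupercompact.IsNearlySupercompact κ μ := by
  have hμ0 : Cardinal.aleph0 ≤ μ := hκ.trans hκμ
  exact ⟨fun h => (h.hasNormalUltrafilters hκ hκμ).isNearlySupercompact hμ0 hκμ hμ,
    fun h => (h.hasNormalUltrafilters hκ hκμ hμ).isPiOneOneReflective hμ0 hκμ⟩
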